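/- Let $\mathcal{P}=\mathcal{P}^{s+}_{3,5}$ be the cone of symmetric homogeneous polynomials $f\in\mathbb{R}[x,y,z]$ of degree $5$ with $f\ge 0$ on $\mathbb{R}_+^3$, $\mathbb{R}_+=[0,\infty)$. An element $f\in\mathcal{P}\setminus\{0\}$ is extremal if $g,h\in\mathcal{P}$, $g+h=f$ imply $g,h\in\mathbb{R}_+f$; then $\mathbb{R}_+f$ is an extremal ray. Say that $e$ is characterized in $\mathcal{P}$ by a condition if the elements of $\mathcal{P}$ satisfying it are exactly the polynomials $\alpha e$, $\alpha\ge0$. Notation. Put $S_n=x^n+y^n+z^n$, $S_{m,n}=x^my^n+y^mz^n+z^mx^n$, $T_{m,n}=S_{m,n}+S_{n,m}$, $U=xyz$, and $s_0=S_5-US_{1,1}$, $s_1=T_{4,1}-2US_{1,1}$, $s_2=T_{3,2}-2US_{1,1}$, $s_3=US_2-US_{1,1}$, $s_4=US_{1,1}$. Put $$\mu_L(t)=9(t-1)^2,\quad \mu_H(t)=(t+2)(7-t),\quad \mu_A(t)=\min\{\mu_L(t),\mu_H(t)\},\quad \mu_R(t)=2-t^2+t\sqrt{(t-1)(t+2)},$$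 $$\mu_B(t)=\tfrac12\Big(\mu_R(t)-\sqrt{\mu_R(t)^2-4}\Big),\quad \mu_Z(t,u)=\frac{(t+2)(7-t)-u}{(t+2)(5t+1)},\quad \omega(u)=u+\frac1u-2.$$ For $u>0$ let $\mathbf{e}^A_{t,u}=s_0+\sum_{i=1}^4p^A_i(t,u)s_i$ with $$p_1^A=\frac{u^2-(t+2)(5t^2+t+9)u+9(t-1)^2(t+2)^2}{(5t+1)(t+2)u},$$ $$p_2^A=\frac{-t^2u^3+(t-1)(7t^3-t^2+11t+1)u^2+(t+2)(17t^5-25t^4+199t^3-59t^2+76t+8)u+9(t-1)^4(t+2)^2(t^2-12t-1)}{(5t+1)^3(t+2)u},$$ $$\begin{aligned}p_3^A=\frac{1}{(t+2)^2(5t+1)^3u}\Big(&(2t^3+4t^2+5t+1)u^3-2(t+2)(7t^4+42t^3+37t^2+48t+10)u^2\\&+(t+2)^2(91t^5+125t^4+682t^3+182t^2+523t+125)u\\&-18(t-1)^2(t+2)^3(t^4+36t^3+34t^2+60t+13)\Big),\end{aligned}$$ $$p_4^A=\frac{(t-1)^3(6t^2+6t-12+u)^3}{(t+2)^2(5t+1)^3u},$$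 and let $\mathbf{e}^A_{t,0}=(5t+1)^2s_1+(t-1)^2(t^2-12t-1)s_2-2(t^4+36t^3+34t^2+60t+13)s_3+24(t-1)^4s_4$. With $w=\omega(u)$ let $$\begin{aligned}\mathbf{e}^B_{t,u}=s_0&-(2w+3)s_1+(w^2+2w+2)s_2\\&+\Big(-\frac{2t^3+4t^2+5t+1}{t^2(t+2)}w^2+\frac{2(4t^2+5t+3)}{t+2}w-\frac{3t^3-7t^2-12t-8}{t+2}\Big)s_3\\&+\frac{(t-1)^3(-w^2-2t^2w+t^2(t-2))}{t^2(t+2)}s_4.\end{aligned}$$ Finally let $$\mathbf{e}^C_t=s_0-(t+1)s_1+ts_2+(t+1)^2s_3,\qquad \mathbf{e}^D_t=s_1+(t^2-1)s_2-2(t+1)^2s_3,\qquad \mathbf{e}^D_\infty=s_2-2s_3,$$ $$\mathbf{e}^E_t=s_1-s_2-\frac{4t^2+5t+3}{t+2}s_3+\frac{(t-1)^3}{t+2}s_4,\qquad \mathbf{e}^E_\infty=s_4.$$ Theorem. The cone $\mathcal{P}$ is five dimensional. Its extremal elements are exactly the positive multiples of the polynomials $\mathbf{e}^A_{t,u}$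 ($0\le t\le7$, $0\le u\le\mu_A(t)$), $\mathbf{e}^B_{t,u}$ ($t\ge2$, $\mu_B(t)\le u\le1$), $\mathbf{e}^C_t$ ($0\le t\le2$), $\mathbf{e}^D_t$ ($t\in[0,\infty]$), $\mathbf{e}^E_t$ ($t\in[7,\infty]$) and $U(S_2-S_{1,1})$. Moreover, the following polynomials are characterized in $\mathcal{P}$ by the following conditions on $f\in\mathcal{P}$: 1. $\mathbf{e}^A_{t,u}$, for $0<t\le7$, $t\ne1$, $0\le u\le\mu_A(t)$, $u\ne\mu_H(t)$, by $f(t,1,1)=f(\mu_Z(t,u),1,1)=0$; 2. $\mathbf{e}^B_{t,u}$, for $t\ge2$, $\mu_B(t)\le u<1$, by $f(t,1,1)=f(0,u,1)=\frac{\partial f}{\partial y}(0,u,1)=0$; 3. $\mathbf{e}^C_t$, for $0<t\le2$, $t\ne1$, by $f(t,1,1)=f(1,1,1)=f(0,1,1)=0$; 4. $\mathbf{e}^D_t$, for $0<t<\infty$, $t\ne1$, by $f(t,1,1)=f(1,1,1)=f(0,0,1)=0$; 5. $\mathbf{e}^E_t$, for $7\le t<\infty$, by $f(t,1,1)=f(0,1,1)=f(0,0,1)=0$.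 -/

import Mathlib

noncomputable section

namespace SymQuintic

open MvPolynomial

/-- The symmetric homogeneous real polynomials of degree `d` in `n` variables. -/
def symForms (n d : ℕ) : Submodule ℝ (MvPolynomial (Fin n) ℝ) :=
  homogeneousSubmodule (Fin n) ℝ d ⊓
    Subalgebra.toSubmodule (symmetricSubalgebra (Fin n) ℝ)

/-- The PSD cone on `A` in `H`: the elements of `H` that are nonnegative at every point of `A`. -/
def psdCone {n : ℕ} (A : Set (Fin n → ℝ)) (H : Submodule ℝ (MvPolynomial (Fin n) ℝ)) :
    Set (MvPolynomial (Fin n) ℝ) :=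
  {f | f ∈ H ∧ ∀ a ∈ A, 0 ≤ eval a f}

/-- The cone of symmetric forms of degree `d` in `n` variables that are nonnegative on the
closed orthant `ℝ₊ⁿ`. -/
def symPsdCone (n d : ℕ) : Set (MvPolynomial (Fin n) ℝ) :=
  psdCone {a | ∀ i, 0 ≤ a i} (symForms n d)

/-- `f` is an extremal element of the cone `P`, i.e. `f` is a nonzero element of `P` and `ℝ₊ f`
is an extremal ray. -/
def IsExtremal {V : Type*} [AddCommGroup V] [Module ℝ V] (P : Set V) (f : V) : Prop :=
  f ∈ P ∧ f ≠ 0 ∧ ∀ g ∈ P, ∀ h ∈ P, g + h = f →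
    (∃ α : ℝ, 0 ≤ α ∧ g = α • f) ∧ (∃ β : ℝ, 0 ≤ β ∧ h = β • f)

/-- `f` is characterized in the cone `P` by the condition `cond`: the elements of `P` that satisfy
`cond` are exactly the nonnegative multiples of `f`. -/
def IsCharacterizedIn {V : Type*} [AddCommGroup V] [Module ℝ V] (P : Set V) (f : V)
    (cond : V → Prop) : Prop :=
  ∀ g ∈ P, cond g ↔ ∃ α : ℝ, 0 ≤ α ∧ g = α • f

/-- Ternary real polynomials; the variables are `X 0`, `X 1`, `X 2`. -/
abbrev Poly3 : Type := MvPolynomial (Fin 3) ℝ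

/-- `S_{m,n} = x^m y^n + y^m z^n + z^m x^n`. -/
def S2 (m n : ℕ) : Poly3 :=
  X 0 ^ m * X 1 ^ n + X 1 ^ m * X 2 ^ n + X 2 ^ m * X 0 ^ n

/-- `S_n = x^n + y^n + z^n`. -/
def S1 (n : ℕ) : Poly3 := X 0 ^ n + X 1 ^ n + X 2 ^ n

/-- `T_{m,n} = S_{m,n} + S_{n,m}`. -/
def T2 (m n : ℕ) : Poly3 := S2 m n + S2 n m

/-- `U = xyz`. -/
def U : Poly3 := X 0 * X 1 * X 2

def s0 : Poly3 := S1 5 - U * S2 1 1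
def s1 : Poly3 := T2 4 1 - 2 * U * S2 1 1
def s2 : Poly3 := T2 3 2 - 2 * U * S2 1 1
def s3 : Poly3 := U * S1 2 - U * S2 1 1
def s4 : Poly3 := U * S2 1 1

def muL (t : ℝ) : ℝ := 9 * (t - 1) ^ 2
def muH (t : ℝ) : ℝ := (t + 2) * (7 - t)
def muA (t : ℝ) : ℝ := min (muL t) (muH t)
def muR (t : ℝ) : ℝ := 2 - t ^ 2 + t * √((t - 1) * (t + 2))
def muB (t : ℝ) : ℝ := (1 / 2) * (muR t - √(muR t ^ 2 - 4))
def muZ (t u : ℝ) : ℝ := ((t + 2) * (7 - t) - u) / ((t + 2) * (5 * t + 1))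

def pA1 (t u : ℝ) : ℝ :=
  (u ^ 2 - (t + 2) * (5 * t ^ 2 + t + 9) * u + 9 * (t - 1) ^ 2 * (t + 2) ^ 2) /
    ((5 * t + 1) * (t + 2) * u)

def pA2 (t u : ℝ) : ℝ :=
  (-t ^ 2 * u ^ 3 + (t - 1) * (7 * t ^ 3 - t ^ 2 + 11 * t + 1) * u ^ 2
      + (t + 2) * (17 * t ^ 5 - 25 * t ^ 4 + 199 * t ^ 3 - 59 * t ^ 2 + 76 * t + 8) * u
      + 9 * (t - 1) ^ 4 * (t + 2) ^ 2 * (t ^ 2 - 12 * t - 1)) /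
    ((5 * t + 1) ^ 3 * (t + 2) * u)

def pA3 (t u : ℝ) : ℝ :=
  ((2 * t ^ 3 + 4 * t ^ 2 + 5 * t + 1) * u ^ 3
      - 2 * (t + 2) * (7 * t ^ 4 + 42 * t ^ 3 + 37 * t ^ 2 + 48 * t + 10) * u ^ 2
      + (t + 2) ^ 2
        * (91 * t ^ 5 + 125 * t ^ 4 + 682 * t ^ 3 + 182 * t ^ 2 + 523 * t + 125) * u
      - 18 * (t - 1) ^ 2 * (t + 2) ^ 3
        * (t ^ 4 + 36 * t ^ 3 + 34 * t ^ 2 + 60 * t + 13)) /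
    ((t + 2) ^ 2 * (5 * t + 1) ^ 3 * u)

def pA4 (t u : ℝ) : ℝ :=
  ((t - 1) ^ 3 * (6 * t ^ 2 + 6 * t - 12 + u) ^ 3) / ((t + 2) ^ 2 * (5 * t + 1) ^ 3 * u)

/-- The family `e^A_{t,u}`, with its separate definition at `u = 0`. -/
def eA (t u : ℝ) : Poly3 :=
  if u = 0 then
    (5 * t + 1) ^ 2 • s1 + ((t - 1) ^ 2 * (t ^ 2 - 12 * t - 1)) • s2
      - (2 * (t ^ 4 + 36 * t ^ 3 + 34 * t ^ 2 + 60 * t + 13)) • s3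
      + (24 * (t - 1) ^ 4) • s4
  else s0 + pA1 t u • s1 + pA2 t u • s2 + pA3 t u • s3 + pA4 t u • s4

def pB1 (_t w : ℝ) : ℝ := -2 * w - 3

def pB2 (_t w : ℝ) : ℝ := w ^ 2 + 2 * w + 2

def pB3 (t w : ℝ) : ℝ :=
  -((2 * t ^ 3 + 4 * t ^ 2 + 5 * t + 1) / (t ^ 2 * (t + 2))) * w ^ 2
    + (2 * (4 * t ^ 2 + 5 * t + 3) / (t + 2)) * w
    - (3 * t ^ 3 - 7 * t ^ 2 - 12 * t - 8) / (t + 2)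

def pB4 (t w : ℝ) : ℝ :=
  ((t - 1) ^ 3 * (-w ^ 2 - 2 * t ^ 2 * w + t ^ 2 * (t - 2))) / (t ^ 2 * (t + 2))

def omega (u : ℝ) : ℝ := u + 1 / u - 2

/-- The family `e^B_{t,u}`. -/
def eB (t u : ℝ) : Poly3 :=
  s0 + pB1 t (omega u) • s1 + pB2 t (omega u) • s2 + pB3 t (omega u) • s3
    + pB4 t (omega u) • s4

/-- The family `e^C_t`. -/
def eC (t : ℝ) : Poly3 := s0 - (t + 1) • s1 + t • s2 + (t + 1) ^ 2 • s3

/-- The family `e^D_t` for finite `t`. -/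
def eD (t : ℝ) : Poly3 := s1 + (t ^ 2 - 1) • s2 - (2 * (t + 1) ^ 2) • s3

/-- `e^D_∞`. -/
def eDInf : Poly3 := s2 - (2 : ℝ) • s3

/-- The family `e^E_t` for finite `t`. -/
def eE (t : ℝ) : Poly3 :=
  s1 - s2 - ((4 * t ^ 2 + 5 * t + 3) / (t + 2)) • s3 + ((t - 1) ^ 3 / (t + 2)) • s4

/-- `e^E_∞`. -/
def eEInf : Poly3 := s4

/-- The polynomials that generate the extremal rays. -/
def generators : Set Poly3 :=
  {f | ∃ t u : ℝ, 0 ≤ t ∧ t ≤ 7 ∧ 0 ≤ u ∧ u ≤ muA t ∧ f = eA t u} ∪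
  {f | ∃ t u : ℝ, 2 ≤ t ∧ muB t ≤ u ∧ u ≤ 1 ∧ f = eB t u} ∪
  {f | ∃ t : ℝ, 0 ≤ t ∧ t ≤ 2 ∧ f = eC t} ∪
  ({f | ∃ t : ℝ, 0 ≤ t ∧ f = eD t} ∪ {eDInf}) ∪
  ({f | ∃ t : ℝ, 7 ≤ t ∧ f = eE t} ∪ {eEInf}) ∪
  {U * (S1 2 - S2 1 1)}

end SymQuintic

end

/-! A symmetric quintic form `f` is determined by `F(x) = f(x, 1, 1)`, and the cone becomes a cone
of univariate polynomials. By Euler's identity and symmetry, `F'(1) = (5/3) F(1)`; this one relation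
(`Balanced`) cuts the restrictions out of the polynomials of degree at most 5.

Nonnegativity also becomes univariate. With `s = x + y + z` and `q = xy + yz + zx` fixed, a quintic
is affine in `xyz`, because `(xyz)^2` has degree 6. The extreme values of `xyz` occur where two
variables agree or one vanishes. So `f ≥ 0` on the orthant iff `F ≥ 0` on the half-line and the
quadratic `edge F`, which describes `f(0, u, 1)` in the variable `w = u + 1/u - 2`, is nonnegative
for `w ≥ 0` (`eval_comb_nonneg_iff`).

Extremality is then a count of zeros. Write `F = Z R` with `Z` a product of powers of `X` and
squares `(X - t)^2`, and `R > 0` on the half-line. For `deg K ≤ deg R`, the polynomials `F ± ε Z K`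
stay in the cone for small `ε` as soon as `Z K` is balanced and its edge polynomial is dominated by
that of `F`. If `F` is extremal, all such `K` are multiples of `R`, so `deg R` is at most the number
of linear conditions imposed on `K` (`natDegree_le_of_isExtremal`). Balance is one condition, void
when `(X - 1)^2` divides `Z`. The edge imposes none unless `edge F` is a positive multiple of `(X -
w₀)^2` with `w₀ ≥ 0`; then it imposes two, one of them void when `Z(0) = 0`.

If the edge is not such a square, the few possible zero patterns give the families A, C, D, E and
`U(S_2 - S_{1,1})` (`slackForm_of_not_edgeSquare`). If it is, a double root `t ≥ 2` must exist, and
it determines `F` together with `w₀`: family B (`isExtremal_edgeSquare`). Conversely, a summand of a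
listed `F` is dominated by `F`, hence inherits its zeros and degree bounds, and the remaining linear
equations have a one-dimensional solution space. The same divisibility argument proves the
characterizations by zeros. -/

noncomputable section

namespace SymQuintic

open MvPolynomial

/-! ### Coordinates on the space of symmetric quintic forms -/

/-- The symmetric quintic form with coordinates `p₀, …, p₄` in the basis `s₀, …, s₄`. -/
def comb (p₀ p₁ p₂ p₃ p₄ : ℝ) : Poly3 :=
  p₀ • s0 + p₁ • s1 + p₂ • s2 + p₃ • s3 + p₄ • s4

lemma isHomogeneous_psum (n : ℕ) : (psum (Fin 3) ℝ n).IsHomogeneous n := by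
  refine IsHomogeneous.sum _ _ _ fun i _ => ?_
  simpa using (isHomogeneous_X ℝ i).pow n

lemma symForms_mul {m n : ℕ} {f g : Poly3} (hf : f ∈ symForms 3 m) (hg : g ∈ symForms 3 n) :
    f * g ∈ symForms 3 (m + n) :=
  ⟨IsHomogeneous.mul hf.1 hg.1, Subalgebra.mul_mem _ hf.2 hg.2⟩

/-- Power sums are the entry point for membership: each `sᵢ` is rewritten as a polynomial in them,
so no symmetry has to be checked by hand. -/
lemma psum_mem_symForms (n : ℕ) : psum (Fin 3) ℝ n ∈ symForms 3 n :=
  ⟨isHomogeneous_psum n, psum_isSymmetric _ _ n⟩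

lemma S1_eq_psum (n : ℕ) : S1 n = psum (Fin 3) ℝ n := by
  simp [S1, psum, Fin.sum_univ_three]

lemma T2_eq_psum (m n : ℕ) :
    T2 m n = psum (Fin 3) ℝ m * psum (Fin 3) ℝ n - psum (Fin 3) ℝ (m + n) := by
  simp only [T2, S2, psum, Fin.sum_univ_three]
  ring

lemma S2_one_one_eq_psum :
    S2 1 1 = (1 / 2 : ℝ) •
      (psum (Fin 3) ℝ 1 * psum (Fin 3) ℝ 1 - psum (Fin 3) ℝ 2) := by
  rw [eq_comm, show (1 / 2 : ℝ) = (2 : ℝ)⁻¹ by norm_num, inv_smul_eq_iff₀ two_ne_zero,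
    smul_eq_C_mul, show (C (2 : ℝ) : Poly3) = 2 from map_ofNat C 2]
  simp only [S2, psum, Fin.sum_univ_three]
  ring

lemma U_eq_psum :
    U = (1 / 6 : ℝ) • (psum (Fin 3) ℝ 1 * psum (Fin 3) ℝ 1 * psum (Fin 3) ℝ 1
      - (3 : ℝ) • (psum (Fin 3) ℝ 1 * psum (Fin 3) ℝ 2) + (2 : ℝ) • psum (Fin 3) ℝ 3) := by
  rw [eq_comm, show (1 / 6 : ℝ) = (6 : ℝ)⁻¹ by norm_num, inv_smul_eq_iff₀ (by norm_num)]
  simp only [smul_eq_C_mul, show (C (2 : ℝ) : Poly3) = 2 from map_ofNat C 2,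
    show (C (3 : ℝ) : Poly3) = 3 from map_ofNat C 3, show (C (6 : ℝ) : Poly3) = 6 from map_ofNat C 6]
  simp only [U, psum, Fin.sum_univ_three]
  ring

lemma S1_mem (n : ℕ) : S1 n ∈ symForms 3 n := S1_eq_psum n ▸ psum_mem_symForms n

lemma T2_mem (m n : ℕ) : T2 m n ∈ symForms 3 (m + n) :=
  T2_eq_psum m n ▸ Submodule.sub_mem _ (symForms_mul (psum_mem_symForms m) (psum_mem_symForms n))
    (psum_mem_symForms _)

lemma S2_one_one_mem : S2 1 1 ∈ symForms 3 2 :=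
  S2_one_one_eq_psum ▸ Submodule.smul_mem _ _ (Submodule.sub_mem _
    (symForms_mul (psum_mem_symForms 1) (psum_mem_symForms 1)) (psum_mem_symForms _))

lemma U_mem : U ∈ symForms 3 3 := by
  rw [U_eq_psum]
  refine Submodule.smul_mem _ _ (Submodule.add_mem _ (Submodule.sub_mem _ ?_
    (Submodule.smul_mem _ _ ?_)) (Submodule.smul_mem _ _ (psum_mem_symForms _)))
  · exact symForms_mul (symForms_mul (psum_mem_symForms 1) (psum_mem_symForms 1))
      (psum_mem_symForms 1)
  · exact symForms_mul (psum_mem_symForms 1) (psum_mem_symForms 2)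

lemma s4_mem : s4 ∈ symForms 3 5 := symForms_mul U_mem S2_one_one_mem

lemma s3_mem : s3 ∈ symForms 3 5 := Submodule.sub_mem _ (symForms_mul U_mem (S1_mem 2)) s4_mem

lemma two_s4_mem : 2 * U * S2 1 1 ∈ symForms 3 5 := by
  have := Submodule.smul_mem _ (2 : ℝ) s4_mem
  rwa [smul_eq_C_mul, show (C (2 : ℝ) : Poly3) = 2 from map_ofNat C 2, s4, ← mul_assoc] at this

lemma s2_mem : s2 ∈ symForms 3 5 := Submodule.sub_mem _ (T2_mem 3 2) two_s4_mem

lemma s1_mem : s1 ∈ symForms 3 5 := Submodule.sub_mem _ (T2_mem 4 1) two_s4_mem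

lemma s0_mem : s0 ∈ symForms 3 5 := Submodule.sub_mem _ (S1_mem 5) s4_mem

lemma comb_mem (p₀ p₁ p₂ p₃ p₄ : ℝ) : comb p₀ p₁ p₂ p₃ p₄ ∈ symForms 3 5 := by
  refine Submodule.add_mem _ (Submodule.add_mem _ (Submodule.add_mem _ (Submodule.add_mem _
    ?_ ?_) ?_) ?_) ?_ <;> apply Submodule.smul_mem
  exacts [s0_mem, s1_mem, s2_mem, s3_mem, s4_mem]

/-- The exponent vector `(a, b, c)`. -/
def expo (a b c : ℕ) : Fin 3 →₀ ℕ := Finsupp.equivFunOnFinite.symm ![a, b, c]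

lemma expo_eta (d : Fin 3 →₀ ℕ) : expo (d 0) (d 1) (d 2) = d := by
  ext i
  fin_cases i <;> rfl

lemma monomial_expo (a b c : ℕ) (r : ℝ) :
    monomial (expo a b c) r = C r * (X 0 ^ a * X 1 ^ b * X 2 ^ c) := by
  rw [monomial_eq, Finsupp.prod_fintype _ _ (by simp), Fin.prod_univ_three]
  rfl

lemma IsHomogeneous.eq_sum_expo {n : ℕ} {f : Poly3} (hf : f.IsHomogeneous n) :
    f = ∑ a ∈ Finset.range (n + 1), ∑ b ∈ Finset.range (n + 1 - a),
      C (coeff (expo a b (n - a - b)) f) * (X 0 ^ a * X 1 ^ b * X 2 ^ (n - a - b)) := by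
  simp_rw [← monomial_expo]
  ext d
  simp_rw [coeff_sum, coeff_monomial]
  have hval : ∀ a b c, expo a b c = d ↔ a = d 0 ∧ b = d 1 ∧ c = d 2 := by
    intro a b c
    constructor
    · rintro rfl
      exact ⟨rfl, rfl, rfl⟩
    · rintro ⟨rfl, rfl, rfl⟩
      exact expo_eta d
  by_cases hd : d 0 + d 1 + d 2 = n
  · rw [Finset.sum_eq_single (d 0), Finset.sum_eq_single (d 1)]
    · have : expo (d 0) (d 1) (n - d 0 - d 1) = d := by
        rw [hval]; omega
      rw [if_pos this, this]
    · intro b _ hb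
      rw [if_neg]
      rw [hval]; tauto
    · intro h
      exact absurd (Finset.mem_range.2 (by omega)) h
    · intro a _ ha
      refine Finset.sum_eq_zero fun b _ => ?_
      rw [if_neg]
      rw [hval]; tauto
    · intro h
      exact absurd (Finset.mem_range.2 (by omega)) h
  · have h0 : coeff d f = 0 := by
      refine hf.coeff_eq_zero ?_
      rwa [Finsupp.degree_eq_sum, Fin.sum_univ_three]
    rw [h0, eq_comm]
    refine Finset.sum_eq_zero fun a ha => Finset.sum_eq_zero fun b hb => ?_
    rw [if_neg]
    rw [hval]
    rw [Finset.mem_range] at ha hb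
    omega

lemma IsSymmetric.coeff_expo_swap {f : Poly3} (hf : f.IsSymmetric) (a b c : ℕ) :
    coeff (expo b a c) f = coeff (expo a b c) f := by
  have h := coeff_rename_mapDomain (Equiv.swap (0 : Fin 3) 1) (Equiv.injective _) f (expo a b c)
  rw [hf] at h
  rw [← h]
  congr 1
  ext i
  rw [← Finsupp.equivMapDomain_eq_mapDomain, Finsupp.equivMapDomain_apply]
  fin_cases i <;> rfl

lemma IsSymmetric.coeff_expo_swap' {f : Poly3} (hf : f.IsSymmetric) (a b c : ℕ) :
    coeff (expo a c b) f = coeff (expo a b c) f := by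
  have h := coeff_rename_mapDomain (Equiv.swap (1 : Fin 3) 2) (Equiv.injective _) f (expo a b c)
  rw [hf] at h
  rw [← h]
  congr 1
  ext i
  rw [← Finsupp.equivMapDomain_eq_mapDomain, Finsupp.equivMapDomain_apply]
  fin_cases i <;> rfl

lemma exists_eq_comb {f : Poly3} (hf : f ∈ symForms 3 5) :
    ∃ p₀ p₁ p₂ p₃ p₄ : ℝ, f = comb p₀ p₁ p₂ p₃ p₄ := by
  have hs : f.IsSymmetric := hf.2
  have e := IsHomogeneous.eq_sum_expo (n := 5) hf.1
  -- The strict inequalities orient the swaps, so that rewriting terminates with the exponents in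
  -- increasing order; five coefficients survive.
  have w : ∀ a b c : ℕ, b < a → coeff (expo a b c) f = coeff (expo b a c) f :=
    fun a b c _ => IsSymmetric.coeff_expo_swap hs b a c
  have w' : ∀ a b c : ℕ, c < b → coeff (expo a b c) f = coeff (expo a c b) f :=
    fun a b c _ => IsSymmetric.coeff_expo_swap' hs a c b
  simp (disch := norm_num) only [Finset.sum_range_succ, Finset.sum_range_zero, Nat.reduceAdd,
    Nat.reduceSub, zero_add, w, w'] at e
  refine ⟨coeff (expo 0 0 5) f, coeff (expo 0 1 4) f, coeff (expo 0 2 3) f, coeff (expo 1 1 3) f,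
    coeff (expo 1 2 2) f + coeff (expo 0 0 5) f + 2 * coeff (expo 0 1 4) f
      + 2 * coeff (expo 0 2 3) f + coeff (expo 1 1 3) f, ?_⟩
  generalize coeff (expo 0 0 5) f = a₀ at e ⊢
  generalize coeff (expo 0 1 4) f = a₁ at e ⊢
  generalize coeff (expo 0 2 3) f = a₂ at e ⊢
  generalize coeff (expo 1 1 3) f = a₃ at e ⊢
  generalize coeff (expo 1 2 2) f = a₄ at e ⊢
  rw [e]
  simp only [comb, s0, s1, s2, s3, s4, S1, S2, T2, U, smul_eq_C_mul, map_add, map_mul,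
    show (C (2 : ℝ) : Poly3) = 2 from map_ofNat C 2]
  ring

/-! ### Values of symmetric quintic forms -/

/-- The restriction of a ternary form to the line of the points `(x, 1, 1)`. -/
def diag : Poly3 →ₐ[ℝ] Polynomial ℝ := aeval ![Polynomial.X, 1, 1]

lemma eval_diag (x : ℝ) (f : Poly3) : (diag f).eval x = eval ![x, 1, 1] f := by
  have : ((Polynomial.evalRingHom x).comp (diag : Poly3 →+* Polynomial ℝ)) =
      (eval ![x, 1, 1] : Poly3 →+* ℝ) := by
    ext i
    · simp [diag]
    · fin_cases i <;> simp [diag]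
  exact congrArg (fun φ : Poly3 →+* ℝ => φ f) this

lemma eval_comb (p₀ p₁ p₂ p₃ p₄ : ℝ) (a : Fin 3 → ℝ) :
    eval a (comb p₀ p₁ p₂ p₃ p₄) =
      p₀ * (a 0 ^ 5 + a 1 ^ 5 + a 2 ^ 5)
      + p₁ * (a 0 ^ 4 * (a 1 + a 2) + a 1 ^ 4 * (a 2 + a 0) + a 2 ^ 4 * (a 0 + a 1))
      + p₂ * (a 0 ^ 3 * (a 1 ^ 2 + a 2 ^ 2) + a 1 ^ 3 * (a 2 ^ 2 + a 0 ^ 2)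
        + a 2 ^ 3 * (a 0 ^ 2 + a 1 ^ 2))
      + p₃ * (a 0 * a 1 * a 2 * (a 0 ^ 2 + a 1 ^ 2 + a 2 ^ 2))
      + (p₄ - p₀ - 2 * p₁ - 2 * p₂ - p₃)
        * (a 0 * a 1 * a 2 * (a 0 * a 1 + a 1 * a 2 + a 2 * a 0)) := by
  simp only [comb, s0, s1, s2, s3, s4, S1, S2, T2, U, map_add, map_sub, map_mul, smul_eval,
    map_pow, eval_X, map_ofNat]
  ring

lemma diag_comb (p₀ p₁ p₂ p₃ p₄ : ℝ) :
    diag (comb p₀ p₁ p₂ p₃ p₄) =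
      Polynomial.C p₀ * Polynomial.X ^ 5 + Polynomial.C (2 * p₁) * Polynomial.X ^ 4
      + Polynomial.C (2 * p₂ + p₃) * Polynomial.X ^ 3
      + Polynomial.C (2 * p₄ - 2 * p₀ - 4 * p₁ - 2 * p₂ - 2 * p₃) * Polynomial.X ^ 2
      + Polynomial.C (p₄ - p₀ - 2 * p₂ + p₃) * Polynomial.X
      + Polynomial.C (2 * p₀ + 2 * p₁ + 2 * p₂) := by
  refine Polynomial.funext fun x => ?_
  rw [eval_diag, eval_comb]
  simp only [Polynomial.eval_add, Polynomial.eval_mul, Polynomial.eval_C, Polynomial.eval_pow,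
    Polynomial.eval_X]
  simp
  ring

/-- The quadratic polynomial `g` with `f(0, u, 1) = u² (u + 1) g(u + 1/u - 2)`, where `F` is the
restriction of the symmetric quintic form `f` to the points `(x, 1, 1)`. -/
def edge (F : Polynomial ℝ) : Polynomial ℝ :=
  Polynomial.C (F.coeff 5) * Polynomial.X ^ 2
    + Polynomial.C (3 * F.coeff 5 + F.coeff 4 / 2) * Polynomial.X
    + Polynomial.C (F.coeff 0 / 2)

/-- The relation satisfied by the restrictions of symmetric quintic forms to the points
`(x, 1, 1)`. -/
def Balanced (F : Polynomial ℝ) : Prop := 3 * F.derivative.eval 1 = 5 * F.eval 1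

/-- The image of `symPsdCone 3 5` under `diag`. -/
def diagCone : Set (Polynomial ℝ) :=
  {F | F.natDegree ≤ 5 ∧ Balanced F ∧ (∀ x : ℝ, 0 ≤ x → 0 ≤ F.eval x) ∧
    ∀ w : ℝ, 0 ≤ w → 0 ≤ (edge F).eval w}

lemma eval_edge (F : Polynomial ℝ) (w : ℝ) :
    (edge F).eval w =
      F.coeff 5 * w ^ 2 + (3 * F.coeff 5 + F.coeff 4 / 2) * w + F.coeff 0 / 2 := by
  simp [edge]

lemma edge_add (F G : Polynomial ℝ) : edge (F + G) = edge F + edge G := by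
  simp only [edge, Polynomial.coeff_add, mul_add, add_div, map_add]
  ring

lemma edge_smul (c : ℝ) (F : Polynomial ℝ) : edge (c • F) = c • edge F := by
  refine Polynomial.funext fun w => ?_
  simp only [eval_edge, Polynomial.coeff_smul, Polynomial.eval_smul, smul_eq_mul]
  ring

lemma balanced_add {F G : Polynomial ℝ} (hF : Balanced F) (hG : Balanced G) :
    Balanced (F + G) := by
  simp only [Balanced, Polynomial.derivative_add, Polynomial.eval_add] at *
  linarith

lemma balanced_smul {F : Polynomial ℝ} (c : ℝ) (hF : Balanced F) : Balanced (c • F) := by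
  simp only [Balanced, Polynomial.derivative_smul, Polynomial.eval_smul, smul_eq_mul] at *
  linear_combination c * hF

lemma eq_quintic {F : Polynomial ℝ} (hF : F.natDegree ≤ 5) :
    F = Polynomial.C (F.coeff 5) * Polynomial.X ^ 5 + Polynomial.C (F.coeff 4) * Polynomial.X ^ 4
      + Polynomial.C (F.coeff 3) * Polynomial.X ^ 3 + Polynomial.C (F.coeff 2) * Polynomial.X ^ 2
      + Polynomial.C (F.coeff 1) * Polynomial.X + Polynomial.C (F.coeff 0) := by
  conv_lhs => rw [F.as_sum_range_C_mul_X_pow' (Nat.lt_succ_of_le hF)]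
  simp only [Finset.sum_range_succ, Finset.sum_range_zero, pow_zero, pow_one, mul_one]
  ring

lemma coeff_diag_comb (p₀ p₁ p₂ p₃ p₄ : ℝ) :
    (diag (comb p₀ p₁ p₂ p₃ p₄)).coeff 5 = p₀ ∧
    (diag (comb p₀ p₁ p₂ p₃ p₄)).coeff 4 = 2 * p₁ ∧
    (diag (comb p₀ p₁ p₂ p₃ p₄)).coeff 3 = 2 * p₂ + p₃ ∧
    (diag (comb p₀ p₁ p₂ p₃ p₄)).coeff 1 = p₄ - p₀ - 2 * p₂ + p₃ ∧
    (diag (comb p₀ p₁ p₂ p₃ p₄)).coeff 0 = 2 * p₀ + 2 * p₁ + 2 * p₂ := by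
  rw [diag_comb]
  refine ⟨?_, ?_, ?_, ?_, ?_⟩ <;>
    simp only [Polynomial.coeff_add, Polynomial.coeff_C_mul, Polynomial.coeff_X_pow,
      Polynomial.coeff_X, Polynomial.coeff_C] <;> norm_num

lemma natDegree_diag_comb (p₀ p₁ p₂ p₃ p₄ : ℝ) :
    (diag (comb p₀ p₁ p₂ p₃ p₄)).natDegree ≤ 5 := by
  rw [diag_comb]
  compute_degree

/-- This is Euler's identity at `(1, 1, 1)`: the three partial derivatives agree there by symmetry
and add up to `5 f(1, 1, 1)`. -/
lemma balanced_diag_comb (p₀ p₁ p₂ p₃ p₄ : ℝ) : Balanced (diag (comb p₀ p₁ p₂ p₃ p₄)) := by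
  rw [diag_comb, Balanced]
  simp only [Polynomial.derivative_add, Polynomial.derivative_mul, Polynomial.derivative_C,
    Polynomial.derivative_X_pow, Polynomial.derivative_X, Polynomial.eval_add,
    Polynomial.eval_mul, Polynomial.eval_C, Polynomial.eval_pow, Polynomial.eval_X,
    Polynomial.eval_zero, Polynomial.eval_one]
  norm_num
  ring

/-- Two coordinate tuples give the same form as soon as the restrictions to `(x, 1, 1)` agree. -/
lemma comb_eq_of_diag_eq {p₀ p₁ p₂ p₃ p₄ r₀ r₁ r₂ r₃ r₄ : ℝ}
    (h : diag (comb p₀ p₁ p₂ p₃ p₄) = diag (comb r₀ r₁ r₂ r₃ r₄)) :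
    p₀ = r₀ ∧ p₁ = r₁ ∧ p₂ = r₂ ∧ p₃ = r₃ ∧ p₄ = r₄ := by
  obtain ⟨a5, a4, a3, a1, a0⟩ := coeff_diag_comb p₀ p₁ p₂ p₃ p₄
  obtain ⟨b5, b4, b3, b1, b0⟩ := coeff_diag_comb r₀ r₁ r₂ r₃ r₄
  rw [h] at a5 a4 a3 a1 a0
  refine ⟨?_, ?_, ?_, ?_, ?_⟩ <;> linarith

lemma diag_injOn {f g : Poly3} (hf : f ∈ symForms 3 5) (hg : g ∈ symForms 3 5)
    (h : diag f = diag g) : f = g := by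
  obtain ⟨p₀, p₁, p₂, p₃, p₄, rfl⟩ := exists_eq_comb hf
  obtain ⟨r₀, r₁, r₂, r₃, r₄, rfl⟩ := exists_eq_comb hg
  obtain ⟨rfl, rfl, rfl, rfl, rfl⟩ := comb_eq_of_diag_eq h
  rfl

lemma exists_diag_eq {F : Polynomial ℝ} (hd : F.natDegree ≤ 5) (hb : Balanced F) :
    ∃ f ∈ symForms 3 5, diag f = F := by
  -- The witnesses invert the coefficient formulas of `diag_comb`; the last one is `F(1) / 3`, since
  -- only `s₄` is nonzero at `(1, 1, 1)`. The coefficients of `x` and `x^2` then match because of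
  -- `hb`.
  refine ⟨comb (F.coeff 5) (F.coeff 4 / 2) (F.coeff 0 / 2 - F.coeff 5 - F.coeff 4 / 2)
    (F.coeff 3 - F.coeff 0 + 2 * F.coeff 5 + F.coeff 4)
    ((F.coeff 5 + F.coeff 4 + F.coeff 3 + F.coeff 2 + F.coeff 1 + F.coeff 0) / 3),
    comb_mem _ _ _ _ _, ?_⟩
  rw [Balanced, eq_quintic hd] at hb
  simp only [Polynomial.derivative_add, Polynomial.derivative_mul, Polynomial.derivative_C,
    Polynomial.derivative_X_pow, Polynomial.derivative_X, Polynomial.eval_add,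
    Polynomial.eval_mul, Polynomial.eval_C, Polynomial.eval_pow, Polynomial.eval_X,
    Polynomial.eval_zero, Polynomial.eval_one] at hb
  norm_num at hb
  rw [diag_comb]
  conv_rhs => rw [eq_quintic hd]
  congr 1
  · congr 1
    · congr 1
      · congr 1
        · congr 3
          ring
        · congr 2
          ring
      · congr 2
        linarith
    · congr 2
      linarith
  · congr 1
    ring

lemma eval_comb_eq_esymm (p₀ p₁ p₂ p₃ p₄ x y z s q : ℝ) (hs : s = x + y + z)
    (hq : q = x * y + y * z + z * x) :
    eval ![x, y, z] (comb p₀ p₁ p₂ p₃ p₄) =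
      (p₀ * (s ^ 5 - 5 * s ^ 3 * q + 5 * s * q ^ 2) + p₁ * (s ^ 3 * q - 3 * s * q ^ 2)
        + p₂ * (s * q ^ 2))
      + (p₀ * (5 * s ^ 2 - 5 * q) + p₁ * (-s ^ 2 + 5 * q) + p₂ * (-2 * s ^ 2 - q)
        + p₃ * (s ^ 2 - 2 * q) + (p₄ - p₀ - 2 * p₁ - 2 * p₂ - p₃) * q) * (x * y * z) := by
  rw [eval_comb]
  simp only [Matrix.cons_val_zero, Matrix.cons_val_one, Matrix.cons_val]
  subst hs hq
  ring

/-! ### Nonnegativity on the orthant -/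

lemma lead_nonneg_of_quadratic_nonneg {a b c : ℝ}
    (h : ∀ w : ℝ, 0 ≤ w → 0 ≤ a * w ^ 2 + b * w + c) : 0 ≤ a := by
  by_contra! ha
  have hk : 0 ≤ (|b| + |c|) / (-a) := by
    have : 0 < -a := by linarith
    positivity
  have h1 := h (1 + (|b| + |c|) / (-a)) (by linarith)
  set k := (|b| + |c|) / (-a) with hkdef
  have h2 : a * k = -(|b| + |c|) := by
    rw [hkdef]; have := ha.ne; field_simp
  have hb := le_abs_self b
  have hc := le_abs_self c
  have hc' := abs_nonneg c
  have hb' := abs_nonneg b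
  nlinarith [mul_nonneg hk hc', mul_nonneg hk hb', mul_nonneg hk (sub_nonneg.2 hb)]

lemma eval_comb_pair_nonneg {p₀ p₁ p₂ p₃ p₄ : ℝ} (h0 : 0 ≤ p₀)
    (h : ∀ x : ℝ, 0 ≤ x → 0 ≤ eval ![x, 1, 1] (comb p₀ p₁ p₂ p₃ p₄)) {a b : ℝ} (ha : 0 ≤ a)
    (hb : 0 ≤ b) : 0 ≤ eval ![b, a, a] (comb p₀ p₁ p₂ p₃ p₄) := by
  rcases ha.eq_or_lt with rfl | ha
  · rw [eval_comb]
    simp only [Matrix.cons_val_zero, Matrix.cons_val_one, Matrix.cons_val]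
    have : 0 ≤ p₀ * b ^ 5 := by positivity
    nlinarith
  · have h1 := h (b / a) (by positivity)
    have : eval ![b, a, a] (comb p₀ p₁ p₂ p₃ p₄) =
        a ^ 5 * eval ![b / a, 1, 1] (comb p₀ p₁ p₂ p₃ p₄) := by
      rw [eval_comb, eval_comb]
      simp only [Matrix.cons_val_zero, Matrix.cons_val_one, Matrix.cons_val]
      field_simp
    rw [this]
    positivity

/-- For fixed `s` and `q` the form is affine in `V = xyz`, so it suffices to bound it at the two
ends of an interval containing `V`. The ends are points with two equal coordinates, or `V = 0` when
the lower one leaves the orthant. -/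
lemma eval_comb_nonneg_iff (p₀ p₁ p₂ p₃ p₄ : ℝ) :
    (∀ a : Fin 3 → ℝ, (∀ i, 0 ≤ a i) → 0 ≤ eval a (comb p₀ p₁ p₂ p₃ p₄)) ↔
      (∀ x : ℝ, 0 ≤ x → 0 ≤ eval ![x, 1, 1] (comb p₀ p₁ p₂ p₃ p₄)) ∧
      ∀ w : ℝ, 0 ≤ w → 0 ≤ p₀ * w ^ 2 + (3 * p₀ + p₁) * w + (p₀ + p₁ + p₂) := by
  constructor
  · intro h
    refine ⟨fun x hx => h _ fun i => by fin_cases i <;> simp [hx], fun w hw => ?_⟩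
    have hr : √(w ^ 2 + 4 * w) ^ 2 = w ^ 2 + 4 * w := Real.sq_sqrt (by positivity)
    have hr0 := Real.sqrt_nonneg (w ^ 2 + 4 * w)
    set r := √(w ^ 2 + 4 * w)
    -- The larger root of `u + 1/u - 2 = w`.
    set u := (w + 2 + r) / 2 with hu
    have hu0 : 0 < u := by linarith
    have hw' : u ^ 2 = (w + 2) * u - 1 := by rw [hu]; linear_combination hr / 4
    have h1 := h ![0, u, 1] fun i => by fin_cases i <;> simp [hu0.le]
    have h2 : eval ![0, u, 1] (comb p₀ p₁ p₂ p₃ p₄) =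
        (u + 1) * u ^ 2 * (p₀ * w ^ 2 + (3 * p₀ + p₁) * w + (p₀ + p₁ + p₂)) := by
      have hwu : w * u = u ^ 2 - 2 * u + 1 := by linear_combination -hw'
      rw [eval_comb]
      simp only [Matrix.cons_val_zero, Matrix.cons_val_one, Matrix.cons_val]
      linear_combination (-(u + 1) * p₀ * (w * u + u ^ 2 - 2 * u + 1)
        - (u + 1) * u * (3 * p₀ + p₁)) * hwu
    rw [h2] at h1
    exact nonneg_of_mul_nonneg_right h1 (by positivity)
  · rintro ⟨hF, hg⟩ a ha
    have h0 : 0 ≤ p₀ := lead_nonneg_of_quadratic_nonneg hg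
    obtain ⟨x, y, z, rfl⟩ : ∃ x y z, a = ![x, y, z] :=
      ⟨a 0, a 1, a 2, by ext i; fin_cases i <;> rfl⟩
    have hx : 0 ≤ x := ha 0
    have hy : 0 ≤ y := ha 1
    have hz : 0 ≤ z := ha 2
    obtain ⟨s, hs⟩ : ∃ s, s = x + y + z := ⟨_, rfl⟩
    obtain ⟨q, hq⟩ : ∃ q, q = x * y + y * z + z * x := ⟨_, rfl⟩
    obtain ⟨V, hV⟩ : ∃ V, V = x * y * z := ⟨_, rfl⟩
    have hs0 : 0 ≤ s := by rw [hs]; positivity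
    have hq0 : 0 ≤ q := by rw [hq]; positivity
    have hV0 : 0 ≤ V := by rw [hV]; positivity
    have hD : 0 ≤ s ^ 2 - 3 * q := by
      rw [hs, hq]; nlinarith [sq_nonneg (x - y), sq_nonneg (y - z), sq_nonneg (z - x)]
    have hδ := Real.sq_sqrt hD
    have hδ0 := Real.sqrt_nonneg (s ^ 2 - 3 * q)
    set δ := √(s ^ 2 - 3 * q)
    have hδs : δ ≤ s := abs_le_of_sq_le_sq' (by linarith) hs0 |>.2
    -- The discriminant of the cubic with roots `x, y, z` is nonnegative; this bounds `V` by its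
    -- values at the two points with coordinates `(s ± 2δ)/3, (s ∓ δ)/3, (s ∓ δ)/3`, which share `s`
    -- and `q`.
    have hdisc : (27 * V - (s ^ 3 - 3 * s * δ ^ 2)) ^ 2 ≤ (2 * δ ^ 3) ^ 2 := by
      have : (2 * δ ^ 3) ^ 2 - (27 * V - (s ^ 3 - 3 * s * δ ^ 2)) ^ 2 =
          27 * ((x - y) * (y - z) * (z - x)) ^ 2 := by
        have e : (2 * δ ^ 3) ^ 2 = 4 * (δ ^ 2) ^ 3 := by ring
        rw [e, hδ, hs, hq, hV]; ring
      nlinarith [sq_nonneg ((x - y) * (y - z) * (z - x))]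
    obtain ⟨hlo, hhi⟩ := abs_le_of_sq_le_sq' hdisc (by positivity)
    have hq' : q = (s ^ 2 - δ ^ 2) / 3 := by linarith
    rw [eval_comb_eq_esymm p₀ p₁ p₂ p₃ p₄ x y z s q hs hq, ← hV]
    have hmax := eval_comb_pair_nonneg h0 hF (a := (s - δ) / 3) (b := (s + 2 * δ) / 3)
      (by linarith) (by linarith)
    rw [eval_comb_eq_esymm p₀ p₁ p₂ p₃ p₄ _ _ _ s q (by ring) (by rw [hq']; ring)] at hmax
    -- The lower point lies in the orthant iff `2δ ≤ s`. Otherwise `s^2 > 4q`, and the value at `V =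
    -- 0` is an edge value with `w = (s^2 - 4q)/q`, or a vertex value when `q = 0`.
    have hmin : 0 ≤ (p₀ * (s ^ 5 - 5 * s ^ 3 * q + 5 * s * q ^ 2)
          + p₁ * (s ^ 3 * q - 3 * s * q ^ 2) + p₂ * (s * q ^ 2)) ∧ s < 2 * δ ∨
        2 * δ ≤ s := by
      rcases le_or_gt (2 * δ) s with h2 | h2
      · exact Or.inr h2
      · refine Or.inl ⟨?_, h2⟩
        rcases hq0.eq_or_lt with hq0 | hq0
        · rw [← hq0]
          have : 0 ≤ p₀ * s ^ 5 := by positivity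
          nlinarith
        · have h4 : 0 ≤ s ^ 2 - 4 * q := by nlinarith
          have h5 := hg ((s ^ 2 - 4 * q) / q) (by positivity)
          have : p₀ * (s ^ 5 - 5 * s ^ 3 * q + 5 * s * q ^ 2)
              + p₁ * (s ^ 3 * q - 3 * s * q ^ 2) + p₂ * (s * q ^ 2) =
              s * q ^ 2 * (p₀ * ((s ^ 2 - 4 * q) / q) ^ 2
                + (3 * p₀ + p₁) * ((s ^ 2 - 4 * q) / q) + (p₀ + p₁ + p₂)) := by
            field_simp
            ring
          rw [this]
          positivity
    have hmin' : ∃ m, m ≤ V ∧ 0 ≤ (p₀ * (s ^ 5 - 5 * s ^ 3 * q + 5 * s * q ^ 2)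
        + p₁ * (s ^ 3 * q - 3 * s * q ^ 2) + p₂ * (s * q ^ 2))
        + (p₀ * (5 * s ^ 2 - 5 * q) + p₁ * (-s ^ 2 + 5 * q)
        + p₂ * (-2 * s ^ 2 - q) + p₃ * (s ^ 2 - 2 * q)
        + (p₄ - p₀ - 2 * p₁ - 2 * p₂ - p₃) * q) * m := by
      rcases hmin with ⟨h1, -⟩ | h2
      · exact ⟨0, hV0, by simpa using h1⟩
      · have h3 := eval_comb_pair_nonneg h0 hF (a := (s + δ) / 3) (b := (s - 2 * δ) / 3)
          (by linarith) (by linarith)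
        rw [eval_comb_eq_esymm p₀ p₁ p₂ p₃ p₄ _ _ _ s q (by ring) (by rw [hq']; ring)] at h3
        refine ⟨_, ?_, h3⟩
        have e : (s - 2 * δ) / 3 * ((s + δ) / 3) * ((s + δ) / 3) =
            (s ^ 3 - 3 * s * δ ^ 2 - 2 * δ ^ 3) / 27 := by ring
        rw [e]
        linarith only [hlo]
    obtain ⟨m, hm, hm'⟩ := hmin'
    have hM : V ≤ (s + 2 * δ) / 3 * ((s - δ) / 3) * ((s - δ) / 3) := by
      have e : (s + 2 * δ) / 3 * ((s - δ) / 3) * ((s - δ) / 3) =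
          (s ^ 3 - 3 * s * δ ^ 2 + 2 * δ ^ 3) / 27 := by ring
      rw [e]
      linarith only [hhi]
    -- The sign of the slope in `V` decides which end bounds the value from below.
    rcases le_total 0 (p₀ * (5 * s ^ 2 - 5 * q) + p₁ * (-s ^ 2 + 5 * q)
        + p₂ * (-2 * s ^ 2 - q) + p₃ * (s ^ 2 - 2 * q)
        + (p₄ - p₀ - 2 * p₁ - 2 * p₂ - p₃) * q) with hB | hB
    · exact hm'.trans (add_le_add_right (mul_le_mul_of_nonneg_left hm hB) _)
    · exact hmax.trans (add_le_add_right (mul_le_mul_of_nonpos_left hM hB) _)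

lemma edge_diag_comb (p₀ p₁ p₂ p₃ p₄ w : ℝ) :
    (edge (diag (comb p₀ p₁ p₂ p₃ p₄))).eval w =
      p₀ * w ^ 2 + (3 * p₀ + p₁) * w + (p₀ + p₁ + p₂) := by
  obtain ⟨a5, a4, -, -, a0⟩ := coeff_diag_comb p₀ p₁ p₂ p₃ p₄
  rw [eval_edge, a5, a4, a0]
  ring

/-! ### Transport of the cone and of extremality to one variable -/

lemma mem_symPsdCone_iff {f : Poly3} (hf : f ∈ symForms 3 5) :
    f ∈ symPsdCone 3 5 ↔ diag f ∈ diagCone := by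
  obtain ⟨p₀, p₁, p₂, p₃, p₄, rfl⟩ := exists_eq_comb hf
  have h := eval_comb_nonneg_iff p₀ p₁ p₂ p₃ p₄
  simp_rw [← eval_diag, ← edge_diag_comb p₀ p₁ p₂ p₃ p₄] at h
  exact ⟨fun hp => ⟨natDegree_diag_comb _ _ _ _ _, balanced_diag_comb _ _ _ _ _, h.1 hp.2⟩,
    fun hp => ⟨hf, h.2 hp.2.2⟩⟩

lemma mem_diagCone_of_mem {f : Poly3} (hf : f ∈ symPsdCone 3 5) : diag f ∈ diagCone :=
  (mem_symPsdCone_iff hf.1).1 hf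

lemma exists_diag_eq_of_mem {F : Polynomial ℝ} (hF : F ∈ diagCone) :
    ∃ f ∈ symPsdCone 3 5, diag f = F := by
  obtain ⟨f, hf, rfl⟩ := exists_diag_eq hF.1 hF.2.1
  exact ⟨f, (mem_symPsdCone_iff hf).2 hF, rfl⟩

lemma isExtremal_iff_diag {f : Poly3} (hf : f ∈ symForms 3 5) :
    IsExtremal (symPsdCone 3 5) f ↔ IsExtremal diagCone (diag f) := by
  have key : ∀ g ∈ symForms 3 5, ∀ α : ℝ, diag g = α • diag f → g = α • f := fun g hg α h =>
    diag_injOn hg (Submodule.smul_mem _ α hf) (by rw [h, map_smul])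
  constructor
  · rintro ⟨h1, h2, h3⟩
    refine ⟨mem_diagCone_of_mem h1, fun h => h2 ?_, fun G hG H hH hGH => ?_⟩
    · simpa using key f hf 0 (by simpa using h)
    · obtain ⟨g, hg, rfl⟩ := exists_diag_eq_of_mem hG
      obtain ⟨h, hh, rfl⟩ := exists_diag_eq_of_mem hH
      rw [← map_add] at hGH
      obtain ⟨⟨α, hα, rfl⟩, β, hβ, rfl⟩ :=
        h3 g hg h hh (diag_injOn (Submodule.add_mem _ hg.1 hh.1) hf hGH)
      exact ⟨⟨α, hα, map_smul _ _ _⟩, β, hβ, map_smul _ _ _⟩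
  · rintro ⟨h1, h2, h3⟩
    refine ⟨(mem_symPsdCone_iff hf).2 h1, fun h => h2 (by rw [h, map_zero]),
      fun g hg h hh hgh => ?_⟩
    obtain ⟨⟨α, hα, e⟩, β, hβ, e'⟩ := h3 _ (mem_diagCone_of_mem hg) _ (mem_diagCone_of_mem hh)
      (by rw [← map_add, hgh])
    exact ⟨⟨α, hα, key g hg.1 α e⟩, β, hβ, key h hh.1 β e'⟩

end SymQuintic
end

noncomputable section

namespace SymQuintic

open Polynomial Filter Topology

/-! ### Univariate polynomials on the half-line -/

/-- Continuity; limits from the right keep the argument inside the half-line even at `0`. -/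
lemma eval_nonneg_of_off_point {P : ℝ[X]} {t : ℝ}
    (h : ∀ x : ℝ, 0 ≤ x → x ≠ t → 0 ≤ P.eval x) : ∀ x : ℝ, 0 ≤ x → 0 ≤ P.eval x := by
  intro x hx
  have hc : Tendsto (fun y => P.eval y) (𝓝[>] x) (𝓝 (P.eval x)) :=
    P.continuous.continuousAt.mono_left nhdsWithin_le_nhds
  refine ge_of_tendsto hc ?_
  have hne : ∀ᶠ y in 𝓝[>] x, y ≠ t := by
    by_cases hxt : x = t
    · subst hxt
      filter_upwards [self_mem_nhdsWithin] with y hy using ne_of_gt hy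
    · exact nhdsWithin_le_nhds (isOpen_ne.mem_nhds hxt)
  filter_upwards [self_mem_nhdsWithin, hne] with y hy hyt
  exact h y (hx.trans (le_of_lt hy)) hyt

lemma eval_nonneg_of_X_mul {P : ℝ[X]} (h : ∀ x : ℝ, 0 ≤ x → 0 ≤ (X * P).eval x) :
    ∀ x : ℝ, 0 ≤ x → 0 ≤ P.eval x := by
  refine eval_nonneg_of_off_point (t := 0) fun x hx hx0 => ?_
  have := h x hx
  rw [eval_mul, eval_X] at this
  exact nonneg_of_mul_nonneg_right this (lt_of_le_of_ne hx hx0.symm)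

lemma eval_nonneg_of_sq_mul {P : ℝ[X]} {t : ℝ}
    (h : ∀ x : ℝ, 0 ≤ x → 0 ≤ ((X - C t) ^ 2 * P).eval x) : ∀ x : ℝ, 0 ≤ x → 0 ≤ P.eval x := by
  refine eval_nonneg_of_off_point (t := t) fun x hx hxt => ?_
  have := h x hx
  rw [eval_mul, eval_pow, eval_sub, eval_X, eval_C] at this
  exact nonneg_of_mul_nonneg_right this (by have := sub_ne_zero.2 hxt; positivity)

lemma exists_eq_X_mul {F : ℝ[X]} (hF : ∀ x : ℝ, 0 ≤ x → 0 ≤ F.eval x) (h0 : F.eval 0 = 0) :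
    ∃ G : ℝ[X], F = X * G ∧ ∀ x : ℝ, 0 ≤ x → 0 ≤ G.eval x := by
  obtain ⟨G, rfl⟩ := X_dvd_iff.2 (F.coeff_zero_eq_eval_zero.trans h0)
  exact ⟨G, rfl, eval_nonneg_of_X_mul hF⟩

/-- An interior zero has even order: after one factor `X - t` is removed, the quotient is
nonpositive to the left of `t` and nonnegative to the right, hence vanishes at `t`. -/
lemma exists_eq_sq_mul {F : ℝ[X]} (hF : ∀ x : ℝ, 0 ≤ x → 0 ≤ F.eval x) {t : ℝ} (ht : 0 < t)
    (h0 : F.eval t = 0) :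
    ∃ G : ℝ[X], F = (X - C t) ^ 2 * G ∧ ∀ x : ℝ, 0 ≤ x → 0 ≤ G.eval x := by
  obtain ⟨G, rfl⟩ := dvd_iff_isRoot.2 h0
  have hroot : G.eval t = 0 := by
    refine le_antisymm ?_ ?_
    · have hc : Tendsto (fun y => G.eval y) (𝓝[<] t) (𝓝 (G.eval t)) :=
        G.continuous.continuousAt.mono_left nhdsWithin_le_nhds
      refine le_of_tendsto hc ?_
      filter_upwards [self_mem_nhdsWithin, Ioo_mem_nhdsLT ht] with y hy hy'
      have := hF y hy'.1.le
      rw [eval_mul, eval_sub, eval_X, eval_C] at this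
      have hy'' : y - t < 0 := sub_neg.2 hy
      nlinarith
    · have hc : Tendsto (fun y => G.eval y) (𝓝[>] t) (𝓝 (G.eval t)) :=
        G.continuous.continuousAt.mono_left nhdsWithin_le_nhds
      refine ge_of_tendsto hc ?_
      filter_upwards [self_mem_nhdsWithin] with y hy
      have hy' : t < y := hy
      have := hF y (ht.trans hy').le
      rw [eval_mul, eval_sub, eval_X, eval_C] at this
      exact nonneg_of_mul_nonneg_right this (sub_pos.2 hy')
  obtain ⟨H, rfl⟩ := dvd_iff_isRoot.2 hroot
  rw [← mul_assoc, ← sq] at hF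
  exact ⟨H, by ring, eval_nonneg_of_sq_mul hF⟩

lemma exists_eq_X_mul_of_le {G R : ℝ[X]} (h0 : ∀ x : ℝ, 0 ≤ x → 0 ≤ G.eval x)
    (h1 : ∀ x : ℝ, 0 ≤ x → G.eval x ≤ (X * R).eval x) :
    ∃ K : ℝ[X], G = X * K ∧ (∀ x : ℝ, 0 ≤ x → 0 ≤ K.eval x) ∧
      ∀ x : ℝ, 0 ≤ x → K.eval x ≤ R.eval x := by
  obtain ⟨K, rfl, hK⟩ := exists_eq_X_mul h0
    (le_antisymm (by simpa using h1 0 le_rfl) (h0 0 le_rfl))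
  refine ⟨K, rfl, hK, fun x hx => ?_⟩
  have := eval_nonneg_of_X_mul (P := R - K) (fun x hx => by
    have := h1 x hx
    rw [mul_sub, eval_sub]; linarith) x hx
  rw [eval_sub] at this
  linarith

/-- At `t = 0` nonnegativity alone would give only a simple root; the upper bound supplies the
second factor. This lets a double root at `0` be treated like any other. -/
lemma exists_eq_sq_mul_of_le {G R : ℝ[X]} {t : ℝ} (ht : 0 ≤ t)
    (h0 : ∀ x : ℝ, 0 ≤ x → 0 ≤ G.eval x)
    (h1 : ∀ x : ℝ, 0 ≤ x → G.eval x ≤ ((X - C t) ^ 2 * R).eval x) :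
    ∃ K : ℝ[X], G = (X - C t) ^ 2 * K ∧ (∀ x : ℝ, 0 ≤ x → 0 ≤ K.eval x) ∧
      ∀ x : ℝ, 0 ≤ x → K.eval x ≤ R.eval x := by
  rcases ht.eq_or_lt with rfl | ht
  · have e : (X - C (0 : ℝ)) ^ 2 = X * X := by rw [C_0, sub_zero, sq]
    rw [e, mul_assoc] at h1
    obtain ⟨K, rfl, hK, hK'⟩ := exists_eq_X_mul_of_le h0 h1
    obtain ⟨L, rfl, hL, hL'⟩ := exists_eq_X_mul_of_le hK hK'
    exact ⟨L, by rw [e, mul_assoc], hL, hL'⟩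
  · obtain ⟨K, rfl, hK⟩ := exists_eq_sq_mul h0 ht
      (le_antisymm (by simpa using h1 t ht.le) (h0 t ht.le))
    refine ⟨K, rfl, hK, fun x hx => ?_⟩
    have := eval_nonneg_of_sq_mul (P := R - K) (t := t) (fun x hx => by
      have := h1 x hx
      rw [mul_sub, eval_sub]; linarith) x hx
    rw [eval_sub] at this
    linarith

lemma natDegree_le_of_eval_le {K R : ℝ[X]} (h0 : ∀ x : ℝ, 0 ≤ x → 0 ≤ K.eval x)
    (h1 : ∀ x : ℝ, 0 ≤ x → K.eval x ≤ R.eval x) : K.natDegree ≤ R.natDegree := by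
  by_contra! hlt
  have hK : K ≠ 0 := by
    rintro rfl
    simp at hlt
  have hO : K.eval =O[atTop] R.eval := by
    refine Asymptotics.IsBigO.of_bound 1 ?_
    filter_upwards [eventually_ge_atTop 0] with x hx
    rw [one_mul, Real.norm_eq_abs, Real.norm_eq_abs, abs_of_nonneg (h0 x hx),
      abs_of_nonneg ((h0 x hx).trans (h1 x hx))]
    exact h1 x hx
  have ho := hO.trans_isLittleO (isLittleO_atTop_of_degree_lt R K (degree_lt_degree hlt))
  exact Asymptotics.isLittleO_irrefl'
    ((eventually_atTop_not_isRoot K hK).mono fun x hx => norm_ne_zero_iff.2 hx).frequently ho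

/-- The degree bound controls the quotient `K / R` near infinity, and compactness controls it
elsewhere. -/
lemma exists_abs_eval_le_mul {K R : ℝ[X]} (hR : ∀ x : ℝ, 0 ≤ x → 0 < R.eval x)
    (hd : K.natDegree ≤ R.natDegree) :
    ∃ M : ℝ, 0 < M ∧ ∀ x : ℝ, 0 ≤ x → |K.eval x| ≤ M * R.eval x := by
  have hR0 : R ≠ 0 := by
    rintro rfl
    simpa using hR 0 le_rfl
  have hdeg : K.degree ≤ R.degree := by
    rw [degree_eq_natDegree hR0]
    exact degree_le_of_natDegree_le hd
  obtain ⟨A, hA⟩ := (isBigO_atTop_of_degree_le K R hdeg).bound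
  obtain ⟨N, hN⟩ := eventually_atTop.1 hA
  have hcont : ContinuousOn (fun x => K.eval x / R.eval x) (Set.Icc 0 N) :=
    K.continuous.continuousOn.div R.continuous.continuousOn fun x hx => (hR x hx.1).ne'
  obtain ⟨B, hB⟩ := isCompact_Icc.exists_bound_of_continuousOn hcont
  refine ⟨max 1 (max A B), lt_of_lt_of_le one_pos (le_max_left _ _), fun x hx => ?_⟩
  have hRx := hR x hx
  rcases le_total N x with h | h
  · have := hN x h
    rw [Real.norm_eq_abs, Real.norm_eq_abs, abs_of_pos hRx] at this
    exact this.trans (mul_le_mul_of_nonneg_right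
      ((le_max_left _ _).trans (le_max_right _ _)) hRx.le)
  · have := hB x ⟨hx, h⟩
    rw [Real.norm_eq_abs, abs_div, abs_of_pos hRx, div_le_iff₀ hRx] at this
    exact this.trans (mul_le_mul_of_nonneg_right
      ((le_max_right _ _).trans (le_max_right _ _)) hRx.le)

/-- A polynomial that is nonnegative on the half-line is the product of a power of `X`, squares
`(X - t)²` with `t > 0`, and a polynomial that is positive on the half-line. -/
lemma exists_factorization {F : ℝ[X]} (hF0 : F ≠ 0) (hF : ∀ x : ℝ, 0 ≤ x → 0 ≤ F.eval x) :
    ∃ (i : ℕ) (ts : List ℝ) (R : ℝ[X]), (∀ t ∈ ts, 0 < t) ∧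
      F = X ^ i * (ts.map fun t => (X - C t) ^ 2).prod * R ∧ ∀ x : ℝ, 0 ≤ x → 0 < R.eval x := by
  induction hn : F.natDegree using Nat.strong_induction_on generalizing F with
  | _ n ih =>
  by_cases h : ∃ t : ℝ, 0 ≤ t ∧ F.eval t = 0
  · obtain ⟨t, ht, hroot⟩ := h
    rcases ht.eq_or_lt with rfl | ht
    · obtain ⟨G, rfl, hG⟩ := exists_eq_X_mul hF hroot
      have hG0 : G ≠ 0 := right_ne_zero_of_mul hF0
      rw [natDegree_X_mul hG0] at hn
      obtain ⟨i, ts, R, h1, h2, h3⟩ := ih G.natDegree (by omega) hG0 hG rfl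
      exact ⟨i + 1, ts, R, h1, by rw [h2]; ring, h3⟩
    · obtain ⟨G, rfl, hG⟩ := exists_eq_sq_mul hF ht hroot
      have hG0 : G ≠ 0 := right_ne_zero_of_mul hF0
      rw [natDegree_mul (left_ne_zero_of_mul hF0) hG0, natDegree_pow, natDegree_X_sub_C] at hn
      obtain ⟨i, ts, R, h1, h2, h3⟩ := ih G.natDegree (by omega) hG0 hG rfl
      refine ⟨i, t :: ts, R, ?_, ?_, h3⟩
      · simpa using ⟨ht, h1⟩
      · rw [h2, List.map_cons, List.prod_cons]
        ring
  · push Not at h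
    refine ⟨0, [], F, by simp, by simp, fun x hx => lt_of_le_of_ne (hF x hx) (h x hx).symm⟩

lemma eq_linear {K : ℝ[X]} (h : K.natDegree ≤ 1) : K = C (K.coeff 1) * X + C (K.coeff 0) :=
  eq_X_add_C_of_natDegree_le_one h

lemma eq_cubic {K : ℝ[X]} (h : K.natDegree ≤ 3) :
    K = C (K.coeff 3) * X ^ 3 + C (K.coeff 2) * X ^ 2 + C (K.coeff 1) * X + C (K.coeff 0) := by
  conv_lhs => rw [K.as_sum_range_C_mul_X_pow' (Nat.lt_succ_of_le h)]
  simp only [Finset.sum_range_succ, Finset.sum_range_zero, pow_zero, pow_one, mul_one]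
  ring

lemma eq_quadratic {K : ℝ[X]} (h : K.natDegree ≤ 2) :
    K = C (K.coeff 2) * X ^ 2 + C (K.coeff 1) * X + C (K.coeff 0) := by
  conv_lhs => rw [K.as_sum_range_C_mul_X_pow' (Nat.lt_succ_of_le h)]
  simp only [Finset.sum_range_succ, Finset.sum_range_zero, pow_zero, pow_one, mul_one]
  ring

/-! ### The cone of restrictions -/

lemma natDegree_of_eval {F : ℝ[X]} {a₅ a₄ a₃ a₂ a₁ a₀ : ℝ}
    (h : ∀ x : ℝ, F.eval x =
      a₅ * x ^ 5 + a₄ * x ^ 4 + a₃ * x ^ 3 + a₂ * x ^ 2 + a₁ * x + a₀) :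
    F.natDegree ≤ 5 ∧ F.coeff 5 = a₅ ∧ F.coeff 4 = a₄ ∧ F.coeff 0 = a₀ ∧
      (Balanced F ↔ 10 * a₅ + 7 * a₄ + 4 * a₃ + a₂ - 2 * a₁ - 5 * a₀ = 0) := by
  have e : F = C a₅ * X ^ 5 + C a₄ * X ^ 4 + C a₃ * X ^ 3 + C a₂ * X ^ 2 + C a₁ * X + C a₀ :=
    Polynomial.funext fun x => by
      rw [h]
      simp only [eval_add, eval_mul, eval_C, eval_pow, eval_X]
  subst e
  refine ⟨by compute_degree, ?_, ?_, ?_, ?_⟩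
  iterate 3
    simp only [coeff_add, coeff_C_mul, coeff_X_pow, coeff_X, coeff_C]
    norm_num
  simp only [Balanced, derivative_add, derivative_mul, derivative_C, derivative_X_pow,
    derivative_X, eval_add, eval_mul, eval_C, eval_pow, eval_X, eval_zero, eval_one]
  norm_num
  constructor <;> intro h' <;> linarith

lemma balanced_mul_iff (Z K : ℝ[X]) : Balanced (Z * K) ↔
    3 * (Z.derivative.eval 1 * K.eval 1 + Z.eval 1 * K.derivative.eval 1)
      = 5 * (Z.eval 1 * K.eval 1) := by
  simp only [Balanced, derivative_mul, eval_add, eval_mul]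

lemma smul_mem_diagCone {F : ℝ[X]} (hF : F ∈ diagCone) {c : ℝ} (hc : 0 ≤ c) :
    c • F ∈ diagCone := by
  obtain ⟨h1, h2, h3, h4⟩ := hF
  refine ⟨(natDegree_smul_le c F).trans h1, balanced_smul c h2, fun x hx => ?_, fun w hw => ?_⟩
  · rw [eval_smul, smul_eq_mul]
    exact mul_nonneg hc (h3 x hx)
  · rw [edge_smul, eval_smul, smul_eq_mul]
    exact mul_nonneg hc (h4 w hw)

lemma nonneg_of_smul_mem {F : ℝ[X]} (hF : F ∈ diagCone) (h0 : F ≠ 0) {α : ℝ}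
    (h : α • F ∈ diagCone) : 0 ≤ α := by
  obtain ⟨x, hx, hx0⟩ := ((eventually_atTop_not_isRoot F h0).and
    (Filter.eventually_ge_atTop 0)).exists
  have h1 := h.2.2.1 x hx0
  rw [eval_smul, smul_eq_mul] at h1
  exact nonneg_of_mul_nonneg_left h1 (lt_of_le_of_ne (hF.2.2.1 x hx0) (Ne.symm hx))

/-- In a decomposition of `F` each summand is dominated by `F`, both on the half-line and on the
edge. This turns extremality into a divisibility question. -/
lemma isExtremal_of_dominated {F : ℝ[X]} (hF : F ∈ diagCone) (h0 : F ≠ 0)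
    (h : ∀ G ∈ diagCone, (∀ x : ℝ, 0 ≤ x → G.eval x ≤ F.eval x) →
      (∀ w : ℝ, 0 ≤ w → (edge G).eval w ≤ (edge F).eval w) → ∃ α : ℝ, G = α • F) :
    IsExtremal diagCone F := by
  have key : ∀ G ∈ diagCone, ∀ H ∈ diagCone, G + H = F → ∃ α : ℝ, 0 ≤ α ∧ G = α • F := by
    intro G hG H hH hGH
    obtain ⟨α, hα⟩ := h G hG
      (fun x hx => by rw [← hGH, eval_add]; linarith [hH.2.2.1 x hx])
      (fun w hw => by rw [← hGH, edge_add, eval_add]; linarith [hH.2.2.2 w hw])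
    exact ⟨α, nonneg_of_smul_mem hF h0 (hα ▸ hG), hα⟩
  exact ⟨hF, h0, fun G hG H hH hGH =>
    ⟨key G hG H hH hGH, key H hH G hG (by rw [add_comm, hGH])⟩⟩

lemma isExtremal_smul {F : ℝ[X]} (hF : IsExtremal diagCone F) {c : ℝ} (hc : 0 < c) :
    IsExtremal diagCone (c • F) := by
  obtain ⟨h1, h2, h3⟩ := hF
  refine ⟨smul_mem_diagCone h1 hc.le, smul_ne_zero hc.ne' h2, fun G hG H hH hGH => ?_⟩
  have hc' : 0 ≤ c⁻¹ := by positivity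
  obtain ⟨⟨α, hα, e⟩, β, hβ, e'⟩ := h3 _ (smul_mem_diagCone hG hc') _ (smul_mem_diagCone hH hc')
    (by rw [← smul_add, hGH, inv_smul_smul₀ hc.ne'])
  refine ⟨⟨α, hα, ?_⟩, β, hβ, ?_⟩
  · rw [smul_comm, ← e, smul_inv_smul₀ hc.ne']
  · rw [smul_comm, ← e', smul_inv_smul₀ hc.ne']

/-- Two balanced multiples of `Z` with linear cofactors are proportional if `Z(1) ≠ 0`. -/
lemma exists_smul_of_linear {Z K : ℝ[X]} {a c : ℝ} (hZ : Z.eval 1 ≠ 0)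
    (h : Balanced (Z * (C a * X + C c))) (hac : a ≠ 0 ∨ c ≠ 0) (hK : Balanced (Z * K))
    (hd : K.natDegree ≤ 1) : ∃ α : ℝ, Z * K = α • (Z * (C a * X + C c)) := by
  rw [eq_linear hd] at hK ⊢
  generalize K.coeff 1 = a' at *
  generalize K.coeff 0 = c' at *
  rw [balanced_mul_iff] at h hK
  simp only [derivative_add, derivative_mul, derivative_C, derivative_X, eval_add, eval_mul,
    eval_C, eval_X, zero_mul, mul_one, zero_add, add_zero] at h hK
  -- Eliminating `Z'(1)` from the two balance equations leaves `Z(1)` times the determinant of the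
  -- two coefficient pairs.
  have hx : a' * c = a * c' := by
    have : 3 * Z.eval 1 * (a' * c - a * c') = 0 := by
      linear_combination (a + c) * hK - (a' + c') * h
    have := (mul_eq_zero.1 this).resolve_left (by simpa using hZ)
    linarith
  rcases hac with ha | hc
  · refine ⟨a' / a, Polynomial.funext fun x => ?_⟩
    simp only [eval_mul, eval_add, eval_C, eval_X, eval_smul, smul_eq_mul]
    field_simp
    linear_combination (-Z.eval x) * hx
  · refine ⟨c' / c, Polynomial.funext fun x => ?_⟩
    simp only [eval_mul, eval_add, eval_C, eval_X, eval_smul, smul_eq_mul]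
    field_simp
    linear_combination Z.eval x * x * hx

lemma exists_smul_of_constant {Z K : ℝ[X]} {c : ℝ} (hc : c ≠ 0) (hd : K.natDegree ≤ 0) :
    ∃ α : ℝ, Z * K = α • (Z * C c) := by
  rw [eq_C_of_natDegree_le_zero hd]
  refine ⟨K.coeff 0 / c, ?_⟩
  rw [smul_eq_C_mul, mul_left_comm, ← C_mul, div_mul_cancel₀ _ hc]

lemma linear_ne_zero {a c : ℝ} (h : a ≠ 0 ∨ c ≠ 0) : (C a * X + C c : ℝ[X]) ≠ 0 := by
  intro h0
  have h1 := congrArg (fun p : ℝ[X] => p.coeff 1) h0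
  have h2 := congrArg (fun p : ℝ[X] => p.coeff 0) h0
  simp at h1 h2
  tauto

/-! ### Two double roots (families A, C and D) -/

/-- A quintic with the double roots `t` and `z`. -/
def twoRoots (t z a c : ℝ) : ℝ[X] := (X - C t) ^ 2 * ((X - C z) ^ 2 * (C a * X + C c))

lemma eval_twoRoots (t z a c x : ℝ) :
    (twoRoots t z a c).eval x = (x - t) ^ 2 * ((x - z) ^ 2 * (a * x + c)) := by
  simp [twoRoots]

lemma twoRoots_coeffs (t z a c : ℝ) :
    (twoRoots t z a c).natDegree ≤ 5 ∧ (twoRoots t z a c).coeff 5 = a ∧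
      (twoRoots t z a c).coeff 4 = c - 2 * (t + z) * a ∧
      (twoRoots t z a c).coeff 0 = t ^ 2 * z ^ 2 * c ∧
      (Balanced (twoRoots t z a c) ↔
        (1 - t) * (1 - z) * ((a + c) * (t + z + 5 * t * z - 7) - 3 * a * (1 - t) * (1 - z)) = 0) := by
  have h := natDegree_of_eval (F := twoRoots t z a c) (a₅ := a) (a₄ := c - 2 * (t + z) * a)
    (a₃ := (t ^ 2 + 4 * t * z + z ^ 2) * a - 2 * (t + z) * c)
    (a₂ := (t ^ 2 + 4 * t * z + z ^ 2) * c - 2 * t * z * (t + z) * a)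
    (a₁ := t ^ 2 * z ^ 2 * a - 2 * t * z * (t + z) * c) (a₀ := t ^ 2 * z ^ 2 * c)
    (fun x => by rw [eval_twoRoots]; ring)
  obtain ⟨h1, h2, h3, h4, h5⟩ := h
  refine ⟨h1, h2, h3, h4, h5.trans ?_⟩
  constructor <;> intro h' <;> linear_combination -h'

lemma twoRoots_ne_zero (t z : ℝ) {a c : ℝ} (h : a ≠ 0 ∨ c ≠ 0) : twoRoots t z a c ≠ 0 :=
  mul_ne_zero (pow_ne_zero _ (X_sub_C_ne_zero t)) (mul_ne_zero (pow_ne_zero _ (X_sub_C_ne_zero z))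
    (linear_ne_zero h))

lemma smul_twoRoots (r t z a c : ℝ) : r • twoRoots t z a c = twoRoots t z (r * a) (r * c) := by
  refine Polynomial.funext fun x => ?_
  rw [eval_smul, eval_twoRoots, eval_twoRoots, smul_eq_mul]
  ring

lemma twoRoots_mem_iff {t z a c : ℝ} (ha : 0 ≤ a) (hc : 0 ≤ c)
    (hb : Balanced (twoRoots t z a c)) :
    twoRoots t z a c ∈ diagCone ↔
      ∀ w : ℝ, 0 ≤ w →
        0 ≤ a * w ^ 2 + (3 * a + (c - 2 * (t + z) * a) / 2) * w + t ^ 2 * z ^ 2 * c / 2 := by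
  obtain ⟨h1, h2, h3, h4, -⟩ := twoRoots_coeffs t z a c
  constructor
  · intro h w hw
    have := h.2.2.2 w hw
    rwa [eval_edge, h2, h3, h4] at this
  · intro h
    refine ⟨h1, hb, fun x hx => ?_, fun w hw => ?_⟩
    · rw [eval_twoRoots]
      positivity
    · rw [eval_edge, h2, h3, h4]
      exact h w hw

/-- The edge inequality for monic quintics with two double roots on both sides of `1`. -/
lemma edge_inequality {t z c s : ℝ} (ht : 0 ≤ t) (ht1 : t < 1) (hc : 0 ≤ c) (hs : 0 ≤ s)
    (hb : (1 + c) * (t + z + 5 * t * z - 7) = 3 * (1 - t) * (1 - z)) :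
    0 ≤ 3 + c / 2 - t - z + s * t * z := by
  -- The coefficient of `z` in the balance equation; multiplying by it eliminates `z`.
  have hden : 0 < 4 + 2 * t + c + 5 * t * c := by positivity
  have e : (3 + c / 2 - t - z + s * t * z) * (4 + 2 * t + c + 5 * t * c) =
      (c - 2) ^ 2 / 2 + t * (6 + 16 * c + 5 * c ^ 2 / 2 + 10 * s + 7 * c * s
        - t * (2 + 5 * c + 4 * s + c * s)) := by
    linear_combination (t * s - 1) * hb
  have h1 : t * (2 + 5 * c + 4 * s + c * s) ≤ 1 * (2 + 5 * c + 4 * s + c * s) :=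
    mul_le_mul_of_nonneg_right ht1.le (by positivity)
  have h2 : 0 ≤ 6 + 16 * c + 5 * c ^ 2 / 2 + 10 * s + 7 * c * s
        - t * (2 + 5 * c + 4 * s + c * s) := by
    have : 0 ≤ c * s := by positivity
    nlinarith
  refine nonneg_of_mul_nonneg_left ?_ hden
  rw [e]
  positivity

lemma add_pos_of_nonneg_of_ne {a c : ℝ} (ha : 0 ≤ a) (hc : 0 ≤ c) (hac : a ≠ 0 ∨ c ≠ 0) :
    0 < a + c :=
  hac.elim (fun h => add_pos_of_pos_of_nonneg (lt_of_le_of_ne ha h.symm) hc)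
    fun h => add_pos_of_nonneg_of_pos ha (lt_of_le_of_ne hc h.symm)

/-- The double roots must lie on opposite sides of `1`. If both were below, the two sides of `hb`
would have incompatible signs; if both were above, `t + z + 5tz - 7 > 3(t - 1)(z - 1)` would make
the left side too large. -/
lemma sign_of_balanced {t z a c : ℝ} (ht : 0 ≤ t) (ht1 : t ≠ 1) (hz1 : z ≠ 1)
    (ha : 0 ≤ a) (hc : 0 ≤ c) (hac : a ≠ 0 ∨ c ≠ 0)
    (hb : (a + c) * (t + z + 5 * t * z - 7) = 3 * a * (1 - t) * (1 - z)) :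
    (1 - t) * (1 - z) < 0 := by
  have hpos : 0 < a + c := add_pos_of_nonneg_of_ne ha hc hac
  rcases lt_or_gt_of_ne ht1 with h1 | h1 <;> rcases lt_or_gt_of_ne hz1 with h2 | h2
  · exfalso
    have h3 : t + z + 5 * t * z - 7 < 0 := by nlinarith
    have h4 : 0 ≤ 3 * a * (1 - t) * (1 - z) :=
      mul_nonneg (mul_nonneg (by positivity) (by linarith)) (by linarith)
    nlinarith
  · nlinarith
  · nlinarith
  · exfalso
    have h3 : 0 < (t - 1) * (z - 1) := mul_pos (by linarith) (by linarith)
    have h4 : 3 * ((t - 1) * (z - 1)) < t + z + 5 * t * z - 7 := by nlinarith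
    have h5 : 3 * a * (1 - t) * (1 - z) ≤ 3 * (a + c) * ((t - 1) * (z - 1)) := by
      have : 0 ≤ c * ((t - 1) * (z - 1)) := by positivity
      nlinarith
    nlinarith

lemma twoRoots_balanced_iff {t z a c : ℝ} (ht1 : t ≠ 1) (hz1 : z ≠ 1) :
    Balanced (twoRoots t z a c) ↔
      (a + c) * (t + z + 5 * t * z - 7) = 3 * a * (1 - t) * (1 - z) := by
  rw [(twoRoots_coeffs t z a c).2.2.2.2, mul_eq_zero,
    or_iff_right (mul_ne_zero (sub_ne_zero.2 ht1.symm) (sub_ne_zero.2 hz1.symm)), sub_eq_zero]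

/-- The half-line condition is evident. For `a > 0` the edge polynomial is, after division by `a`, a
square plus `w` times the quantity bounded in `edge_inequality`, with `s = √(2c/a)` chosen so that
the constant term is a square. -/
lemma twoRoots_mem {t z a c : ℝ} (ht : 0 ≤ t) (hz : 0 ≤ z) (ht1 : t ≠ 1) (hz1 : z ≠ 1)
    (ha : 0 ≤ a) (hc : 0 ≤ c) (hac : a ≠ 0 ∨ c ≠ 0) (hb : Balanced (twoRoots t z a c)) :
    twoRoots t z a c ∈ diagCone := by
  rw [twoRoots_mem_iff ha hc hb]
  intro w hw
  rw [twoRoots_balanced_iff ht1 hz1] at hb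
  rcases ha.eq_or_lt with rfl | ha
  · have : 0 ≤ c / 2 * w + t ^ 2 * z ^ 2 * c / 2 := by positivity
    linarith
  · have hb1 : (1 + c / a) * (t + z + 5 * t * z - 7) = 3 * (1 - t) * (1 - z) := by
      field_simp
      linear_combination hb
    have hsq := Real.sq_sqrt (show 0 ≤ 2 * (c / a) by positivity)
    have hs0 := Real.sqrt_nonneg (2 * (c / a))
    set s := √(2 * (c / a))
    have hE : 0 ≤ 3 + c / a / 2 - t - z + s * t * z := by
      have hsign := sign_of_balanced ht ht1 hz1 ha.le hc hac hb
      rcases lt_or_gt_of_ne ht1 with h1 | h1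
      · exact edge_inequality ht h1 (by positivity) hs0 hb1
      · have h2 : z < 1 := by nlinarith
        have := edge_inequality (t := z) (z := t) (c := c / a) hz h2 (by positivity) hs0
          (by linear_combination hb1)
        linarith
    have e : a * w ^ 2 + (3 * a + (c - 2 * (t + z) * a) / 2) * w + t ^ 2 * z ^ 2 * c / 2 =
        a * ((w - s * t * z / 2) ^ 2 + (3 + c / a / 2 - t - z + s * t * z) * w) := by
      have : c = a * (s ^ 2 / 2) := by rw [hsq]; field_simp
      have h' : c / a = s ^ 2 / 2 := by rw [hsq]; ring
      rw [h', this]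
      ring
    rw [e]
    positivity

/-- A dominated element inherits both double roots, so only a linear cofactor is free; the balance
equation removes one of its two degrees of freedom. -/
lemma isExtremal_twoRoots {t z a c : ℝ} (ht : 0 ≤ t) (hz : 0 ≤ z) (ht1 : t ≠ 1) (hz1 : z ≠ 1)
    (ha : 0 ≤ a) (hc : 0 ≤ c) (hac : a ≠ 0 ∨ c ≠ 0) (hb : Balanced (twoRoots t z a c)) :
    IsExtremal diagCone (twoRoots t z a c) := by
  refine isExtremal_of_dominated (twoRoots_mem ht hz ht1 hz1 ha hc hac hb)
    (twoRoots_ne_zero t z hac) fun G hG hle _ => ?_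
  obtain ⟨K, rfl, hK, hK'⟩ := exists_eq_sq_mul_of_le ht hG.2.2.1 hle
  obtain ⟨L, rfl, hL, hL'⟩ := exists_eq_sq_mul_of_le hz hK hK'
  have hd := (natDegree_le_of_eval_le hL hL').trans natDegree_linear_le
  have hGb := hG.2.1
  rw [twoRoots, ← mul_assoc] at hb ⊢
  rw [← mul_assoc] at hGb ⊢
  refine exists_smul_of_linear ?_ hb hac hGb hd
  have h1 := sub_ne_zero.2 ht1.symm
  have h2 := sub_ne_zero.2 hz1.symm
  simp [h1, h2]

/-- A form in the cone that vanishes at two points `(t, 1, 1)`, `(z, 1, 1)` with `t, z ≠ 1`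
is determined up to scaling. -/
lemma exists_smul_twoRoots {t z a c : ℝ} (ht : 0 < t) (hz : 0 < z) (ht1 : t ≠ 1) (hz1 : z ≠ 1)
    (htz : t ≠ z) (hac : a ≠ 0 ∨ c ≠ 0) (hb : Balanced (twoRoots t z a c))
    {G : ℝ[X]} (hG : G ∈ diagCone) (h1 : G.eval t = 0) (h2 : G.eval z = 0) :
    ∃ α : ℝ, G = α • twoRoots t z a c := by
  obtain ⟨K, rfl, hK⟩ := exists_eq_sq_mul hG.2.2.1 ht h1
  have hKz : K.eval z = 0 := by
    have := sub_ne_zero.2 htz.symm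
    simpa [this] using h2
  obtain ⟨L, rfl, hL⟩ := exists_eq_sq_mul hK hz hKz
  have hd : L.natDegree ≤ 1 := by
    by_cases hL0 : L = 0
    · simp [hL0]
    · have := hG.1
      rw [natDegree_mul (pow_ne_zero _ (X_sub_C_ne_zero t)) (mul_ne_zero
        (pow_ne_zero _ (X_sub_C_ne_zero z)) hL0), natDegree_mul
        (pow_ne_zero _ (X_sub_C_ne_zero z)) hL0, natDegree_pow, natDegree_pow,
        natDegree_X_sub_C, natDegree_X_sub_C] at this
      omega
  have hGb := hG.2.1
  rw [twoRoots, ← mul_assoc] at hb ⊢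
  rw [← mul_assoc] at hGb ⊢
  refine exists_smul_of_linear ?_ hb hac hGb hd
  have h1 := sub_ne_zero.2 ht1.symm
  have h2 := sub_ne_zero.2 hz1.symm
  simp [h1, h2]

/-! ### A double root on the diagonal and one on the edge (family B) -/

/-- The quintic with the double root `t` for which `edge` is the square of `X - t v`. -/
def edgeRoot (t v : ℝ) : ℝ[X] :=
  (X - C t) ^ 2 * (X ^ 3 + C (2 * t - 6 - 4 * t * v) * X ^ 2
    + C (3 * (t - 1) * (t - 2 - v ^ 2 - 2 * t * v) / (t + 2) - 1 - (2 * t - 6 - 4 * t * v)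
      - 2 * v ^ 2) * X + C (2 * v ^ 2))

lemma eval_edgeRoot (t v x : ℝ) :
    (edgeRoot t v).eval x = (x - t) ^ 2 * (2 * v ^ 2 * (x - 1) ^ 2
      + x * (x ^ 2 - 2 * (3 - t + v ^ 2 + 2 * t * v) * x
        + (1 - 2 * (t - 2 - v ^ 2 - 2 * t * v)
          + 3 * (t - 1) * (t - 2 - v ^ 2 - 2 * t * v) / (t + 2)))) := by
  simp only [edgeRoot, eval_mul, eval_pow, eval_sub, eval_X, eval_C, eval_add]
  ring

lemma edgeRoot_coeffs {t : ℝ} (ht : 0 < t) (v : ℝ) :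
    (edgeRoot t v).natDegree ≤ 5 ∧ (edgeRoot t v).coeff 5 = 1 ∧
      edge (edgeRoot t v) = (X - C (t * v)) ^ 2 ∧ Balanced (edgeRoot t v) := by
  have h := natDegree_of_eval (F := edgeRoot t v) (a₅ := 1)
    (a₄ := (2 * t - 6 - 4 * t * v) - 2 * t)
    (a₃ := (3 * (t - 1) * (t - 2 - v ^ 2 - 2 * t * v) / (t + 2) - 1 - (2 * t - 6 - 4 * t * v)
      - 2 * v ^ 2) - 2 * t * (2 * t - 6 - 4 * t * v) + t ^ 2)
    (a₂ := 2 * v ^ 2 - 2 * t * (3 * (t - 1) * (t - 2 - v ^ 2 - 2 * t * v) / (t + 2) - 1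
      - (2 * t - 6 - 4 * t * v) - 2 * v ^ 2) + t ^ 2 * (2 * t - 6 - 4 * t * v))
    (a₁ := t ^ 2 * (3 * (t - 1) * (t - 2 - v ^ 2 - 2 * t * v) / (t + 2) - 1
      - (2 * t - 6 - 4 * t * v) - 2 * v ^ 2) - 2 * t * (2 * v ^ 2))
    (a₀ := t ^ 2 * (2 * v ^ 2))
    (fun x => by rw [eval_edgeRoot]; ring)
  obtain ⟨h1, h2, h3, h4, h5⟩ := h
  refine ⟨h1, h2, Polynomial.funext fun w => ?_, h5.2 ?_⟩
  · rw [eval_edge, h2, h3, h4, eval_pow, eval_sub, eval_X, eval_C]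
    ring
  · field_simp
    ring

lemma edgeRoot_ne_zero {t : ℝ} (ht : 0 < t) (v : ℝ) : edgeRoot t v ≠ 0 := by
  intro h
  have := (edgeRoot_coeffs ht v).2.1
  rw [h] at this
  simp at this

lemma edgeRoot_mem {t v : ℝ} (ht : 2 ≤ t) (hv : 0 ≤ v) (hn : 0 ≤ t - 2 - v ^ 2 - 2 * t * v) :
    edgeRoot t v ∈ diagCone := by
  obtain ⟨h1, -, h3, h4⟩ := edgeRoot_coeffs (by linarith : 0 < t) v
  refine ⟨h1, h4, fun x hx => ?_, fun w hw => ?_⟩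
  · rw [eval_edgeRoot]
    -- From here on only `0 ≤ n ≤ t - 2` is used, where `n = t - 2 - v^2 - 2tv`. For `n ≤ 1` the
    -- quadratic `hq` is handled by completing the square. For `n ≥ 1` its linear term helps, and
    -- its constant term is nonnegative because `(7 - t)(t - 2) ≤ t + 2` is `(t - 4)^2 ≥ 0`.
    have hn' : t - 2 - v ^ 2 - 2 * t * v ≤ t - 2 := by nlinarith [sq_nonneg v, mul_nonneg hv hx]
    have e : 3 - t + v ^ 2 + 2 * t * v = 1 - (t - 2 - v ^ 2 - 2 * t * v) := by ring
    rw [e]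
    generalize t - 2 - v ^ 2 - 2 * t * v = n at *
    have hq : 0 ≤ x ^ 2 - 2 * (1 - n) * x + (1 - 2 * n + 3 * (t - 1) * n / (t + 2)) := by
      have e2 : x ^ 2 - 2 * (1 - n) * x + (1 - 2 * n + 3 * (t - 1) * n / (t + 2)) =
          ((x ^ 2 - 2 * (1 - n) * x) * (t + 2) + (t + 2 - (7 - t) * n)) / (t + 2) := by
        field_simp
        ring
      rw [e2]
      refine div_nonneg ?_ (by linarith)
      rcases le_total n 1 with h | h
      · have h6 : n * (t + 2) ≤ 3 * (t - 1) := by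
          rcases le_total t 3 with h7 | h7
          · nlinarith
          · nlinarith
        have : 0 ≤ (x - (1 - n)) ^ 2 * (t + 2) := by positivity
        nlinarith
      · have h6 : 0 ≤ t + 2 - (7 - t) * n := by
          rcases le_total t 7 with h7 | h7
          · nlinarith [sq_nonneg (t - 4)]
          · nlinarith
        have : 0 ≤ (x ^ 2 - 2 * (1 - n) * x) * (t + 2) := by
          refine mul_nonneg ?_ (by linarith)
          nlinarith [sq_nonneg x]
        linarith
    positivity
  · rw [h3, eval_pow]
    positivity

/-- The edge polynomial fixes three coefficients of the cubic cofactor. Balance fixes the remaining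
one, whose coefficient there is a nonzero multiple of `(t - 1)(t + 2)`. -/
lemma eq_smul_edgeRoot {t v a : ℝ} (ht : 0 < t) (ht1 : t ≠ 1) {K : ℝ[X]}
    (hd : K.natDegree ≤ 3) (hb : Balanced ((X - C t) ^ 2 * K))
    (he : edge ((X - C t) ^ 2 * K) = C a * (X - C (t * v)) ^ 2) :
    (X - C t) ^ 2 * K = a • edgeRoot t v := by
  rw [eq_cubic hd] at hb he ⊢
  generalize K.coeff 3 = k₃ at *
  generalize K.coeff 2 = k₂ at *
  generalize K.coeff 1 = k₁ at *
  generalize K.coeff 0 = k₀ at *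
  have h := natDegree_of_eval
    (F := (X - C t) ^ 2 * (C k₃ * X ^ 3 + C k₂ * X ^ 2 + C k₁ * X + C k₀))
    (a₅ := k₃) (a₄ := k₂ - 2 * t * k₃) (a₃ := k₁ - 2 * t * k₂ + t ^ 2 * k₃)
    (a₂ := k₀ - 2 * t * k₁ + t ^ 2 * k₂) (a₁ := t ^ 2 * k₁ - 2 * t * k₀) (a₀ := t ^ 2 * k₀)
    (fun x => by
      simp only [eval_mul, eval_pow, eval_sub, eval_X, eval_C, eval_add]
      ring)
  obtain ⟨-, h5, h4, h0, hbal⟩ := h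
  have hb' := hbal.1 hb
  have he' : ∀ w : ℝ, k₃ * w ^ 2 + (3 * k₃ + (k₂ - 2 * t * k₃) / 2) * w + t ^ 2 * k₀ / 2 =
      a * (w - t * v) ^ 2 := fun w => by
    have := congrArg (eval w) he
    rw [eval_edge, h5, h4, h0] at this
    simpa using this
  have e0 := he' 0
  have e1 := he' 1
  have e2 := he' (-1)
  have ht0 := ht.ne'
  have ha : k₃ = a := by linarith
  have hk2 : k₂ = a * (2 * t - 6 - 4 * t * v) := by
    linear_combination e1 - e2 + (2 * t - 6) * ha
  have hk0 : k₀ = a * (2 * v ^ 2) := by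
    have : t ^ 2 * (k₀ - a * (2 * v ^ 2)) = 0 := by linear_combination 2 * e0
    have := (mul_eq_zero.1 this).resolve_left (by positivity)
    linarith
  have hk1 : k₁ = a * (3 * (t - 1) * (t - 2 - v ^ 2 - 2 * t * v) / (t + 2) - 1
      - (2 * t - 6 - 4 * t * v) - 2 * v ^ 2) := by
    have h2 : (t - 1) * ((t + 2) * k₁ - a * (3 * (t - 1) * (t - 2 - v ^ 2 - 2 * t * v)
      + (- 1 - (2 * t - 6 - 4 * t * v) - 2 * v ^ 2) * (t + 2))) = 0 := by
      rw [hk2, hk0, ha] at hb'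
      linear_combination (-1 / 2) * hb'
    have := (mul_eq_zero.1 h2).resolve_left (sub_ne_zero.2 ht1)
    field_simp
    linear_combination this
  refine Polynomial.funext fun x => ?_
  simp only [edgeRoot, eval_mul, eval_pow, eval_sub, eval_X, eval_C, eval_add, eval_smul,
    smul_eq_mul]
  rw [hk0, hk1, hk2, ha]
  ring

lemma natDegree_edge_le (F : ℝ[X]) : (edge F).natDegree ≤ 2 := by
  rw [edge]
  compute_degree

lemma natDegree_le_of_sq_mul {t : ℝ} {K : ℝ[X]} {n : ℕ}
    (h : ((X - C t) ^ 2 * K).natDegree ≤ n + 2) : K.natDegree ≤ n := by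
  by_cases hK0 : K = 0
  · simp [hK0]
  · rw [natDegree_mul (pow_ne_zero _ (X_sub_C_ne_zero t)) hK0, natDegree_pow,
      natDegree_X_sub_C] at h
    omega

lemma exists_smul_edgeRoot {t v : ℝ} (ht : 0 < t) (ht1 : t ≠ 1) (hv : 0 < v) {G : ℝ[X]}
    (hG : G ∈ diagCone) (h1 : G.eval t = 0) (h2 : (edge G).eval (t * v) = 0) :
    ∃ α : ℝ, G = α • edgeRoot t v := by
  obtain ⟨E, hE, -⟩ := exists_eq_sq_mul hG.2.2.2 (mul_pos ht hv) h2
  have hEd : E.natDegree ≤ 0 := natDegree_le_of_sq_mul (hE ▸ natDegree_edge_le G)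
  rw [eq_C_of_natDegree_le_zero hEd, mul_comm] at hE
  obtain ⟨K, rfl, -⟩ := exists_eq_sq_mul hG.2.2.1 ht h1
  exact ⟨_, eq_smul_edgeRoot ht ht1 (natDegree_le_of_sq_mul hG.1) hG.2.1 hE⟩

/-- Domination is used twice: on the half-line it passes on the double root `t`, and on the edge it
makes the edge polynomial a multiple of `(X - tv)^2`. -/
lemma isExtremal_edgeRoot {t v : ℝ} (ht : 2 ≤ t) (hv : 0 ≤ v)
    (hn : 0 ≤ t - 2 - v ^ 2 - 2 * t * v) : IsExtremal diagCone (edgeRoot t v) := by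
  have ht0 : 0 < t := by linarith
  refine isExtremal_of_dominated (edgeRoot_mem ht hv hn) (edgeRoot_ne_zero ht0 v)
    fun G hG hle hle' => ?_
  rw [(edgeRoot_coeffs ht0 v).2.2.1, ← mul_one ((X - C (t * v)) ^ 2)] at hle'
  obtain ⟨E, hE, -⟩ := exists_eq_sq_mul_of_le (mul_nonneg ht0.le hv) hG.2.2.2 hle'
  have hEd : E.natDegree ≤ 0 := natDegree_le_of_sq_mul (hE ▸ natDegree_edge_le G)
  rw [eq_C_of_natDegree_le_zero hEd, mul_comm] at hE
  obtain ⟨K, rfl, -⟩ := exists_eq_sq_mul_of_le ht0.le hG.2.2.1 hle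
  exact ⟨_, eq_smul_edgeRoot ht0 (by linarith) (natDegree_le_of_sq_mul hG.1) hG.2.1 hE⟩

/-! ### Members of the cone with a root at `1`, and with an edge polynomial without roots -/

lemma isExtremal_X_twoRoots {t : ℝ} (ht : 0 ≤ t) (ht2 : t ≤ 2) :
    IsExtremal diagCone (twoRoots 1 t 1 0) := by
  have hb : Balanced (twoRoots 1 t 1 0) := (twoRoots_coeffs 1 t 1 0).2.2.2.2.2 (by ring)
  refine isExtremal_of_dominated ((twoRoots_mem_iff zero_le_one le_rfl hb).2 fun w hw => ?_)
    (twoRoots_ne_zero _ _ (Or.inl one_ne_zero)) fun G hG hle _ => ?_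
  · nlinarith [mul_nonneg hw (sub_nonneg.2 ht2), sq_nonneg w]
  · have e : twoRoots 1 t 1 0 = (X - C 1) ^ 2 * ((X - C t) ^ 2 * (X * C 1)) := by
      simp [twoRoots]
    rw [e] at hle ⊢
    obtain ⟨K, rfl, hK, hK'⟩ := exists_eq_sq_mul_of_le zero_le_one hG.2.2.1 hle
    obtain ⟨L, rfl, hL, hL'⟩ := exists_eq_sq_mul_of_le ht hK hK'
    obtain ⟨M, rfl, hM, hM'⟩ := exists_eq_X_mul_of_le hL hL'
    have hd := (natDegree_le_of_eval_le hM hM').trans_eq (natDegree_C _)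
    simp only [← mul_assoc]
    exact exists_smul_of_constant one_ne_zero hd

lemma isExtremal_twoRoots_one (t : ℝ) (ht : 0 ≤ t) : IsExtremal diagCone (twoRoots 1 t 0 1) := by
  have hb : Balanced (twoRoots 1 t 0 1) := (twoRoots_coeffs 1 t 0 1).2.2.2.2.2 (by ring)
  refine isExtremal_of_dominated ((twoRoots_mem_iff le_rfl zero_le_one hb).2 fun w hw => ?_)
    (twoRoots_ne_zero _ _ (Or.inr one_ne_zero)) fun G hG hle _ => ?_
  · nlinarith [sq_nonneg t]
  · have e : twoRoots 1 t 0 1 = (X - C 1) ^ 2 * ((X - C t) ^ 2 * C 1) := by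
      simp [twoRoots]
    rw [e] at hle ⊢
    obtain ⟨K, rfl, hK, hK'⟩ := exists_eq_sq_mul_of_le zero_le_one hG.2.2.1 hle
    obtain ⟨L, rfl, hL, hL'⟩ := exists_eq_sq_mul_of_le ht hK hK'
    have hd := (natDegree_le_of_eval_le hL hL').trans_eq (natDegree_C _)
    simp only [← mul_assoc]
    exact exists_smul_of_constant one_ne_zero hd

lemma isExtremal_sq : IsExtremal diagCone ((X - C 1) ^ 2 * C 1) := by
  obtain ⟨h1, h2, h3, h4, h5⟩ := natDegree_of_eval (F := (X - C 1) ^ 2 * C 1) (a₅ := 0) (a₄ := 0)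
    (a₃ := 0) (a₂ := 1) (a₁ := -2) (a₀ := 1) (fun x => by simp; ring)
  refine isExtremal_of_dominated ⟨h1, h5.2 (by norm_num), fun x _ => ?_, fun w hw => ?_⟩
    (mul_ne_zero (pow_ne_zero _ (X_sub_C_ne_zero 1)) (by simp)) fun G hG hle _ => ?_
  · simp only [eval_mul, eval_pow, eval_sub, eval_X, eval_C]
    positivity
  · rw [eval_edge, h2, h3, h4]
    norm_num
  · obtain ⟨K, rfl, hK, hK'⟩ := exists_eq_sq_mul_of_le zero_le_one hG.2.2.1 hle
    exact exists_smul_of_constant one_ne_zero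
      ((natDegree_le_of_eval_le hK hK').trans_eq (natDegree_C _))

lemma isExtremal_X_sq : IsExtremal diagCone (X * ((X - C 1) ^ 2 * C 1)) := by
  obtain ⟨h1, h2, h3, h4, h5⟩ := natDegree_of_eval (F := X * ((X - C 1) ^ 2 * C 1)) (a₅ := 0)
    (a₄ := 0) (a₃ := 1) (a₂ := -2) (a₁ := 1) (a₀ := 0) (fun x => by simp; ring)
  refine isExtremal_of_dominated ⟨h1, h5.2 (by norm_num), fun x _ => ?_, fun w hw => ?_⟩
    (mul_ne_zero X_ne_zero (mul_ne_zero (pow_ne_zero _ (X_sub_C_ne_zero 1)) (by simp)))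
    fun G hG hle _ => ?_
  · simp only [eval_mul, eval_pow, eval_sub, eval_X, eval_C]
    positivity
  · rw [eval_edge, h2, h3, h4]
    norm_num
  · obtain ⟨K, rfl, hK, hK'⟩ := exists_eq_X_mul_of_le hG.2.2.1 hle
    obtain ⟨L, rfl, hL, hL'⟩ := exists_eq_sq_mul_of_le zero_le_one hK hK'
    simp only [← mul_assoc]
    exact exists_smul_of_constant one_ne_zero
      ((natDegree_le_of_eval_le hL hL').trans_eq (natDegree_C _))

lemma isExtremal_X_linear : IsExtremal diagCone (X * (C 2 * X + C 1)) := by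
  obtain ⟨h1, h2, h3, h4, h5⟩ := natDegree_of_eval (F := X * (C 2 * X + C 1)) (a₅ := 0)
    (a₄ := 0) (a₃ := 0) (a₂ := 2) (a₁ := 1) (a₀ := 0) (fun x => by simp; ring)
  have hb := h5.2 (by norm_num)
  refine isExtremal_of_dominated ⟨h1, hb, fun x _ => ?_, fun w hw => ?_⟩
    (mul_ne_zero X_ne_zero (linear_ne_zero (Or.inr one_ne_zero))) fun G hG hle _ => ?_
  · simp only [eval_mul, eval_X, eval_C, eval_add]
    positivity
  · rw [eval_edge, h2, h3, h4]
    norm_num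
  · obtain ⟨K, rfl, hK, hK'⟩ := exists_eq_X_mul_of_le hG.2.2.1 hle
    exact exists_smul_of_linear (by simp) hb (Or.inr one_ne_zero) hG.2.1
      ((natDegree_le_of_eval_le hK hK').trans natDegree_linear_le)

/-! ### A double root and a zero at the origin (family E) -/

/-- A quartic with the double root `t` and a root at `0`. -/
def rootAndZero (t a c : ℝ) : ℝ[X] := X * ((X - C t) ^ 2 * (C a * X + C c))

lemma eval_rootAndZero (t a c x : ℝ) :
    (rootAndZero t a c).eval x = x * ((x - t) ^ 2 * (a * x + c)) := by
  simp [rootAndZero]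

lemma rootAndZero_coeffs (t a c : ℝ) :
    (rootAndZero t a c).natDegree ≤ 5 ∧ (rootAndZero t a c).coeff 5 = 0 ∧
      (rootAndZero t a c).coeff 4 = a ∧ (rootAndZero t a c).coeff 0 = 0 ∧
      (Balanced (rootAndZero t a c) ↔
        (t - 1) * ((2 * t + 4) * (a + c) - 3 * (t - 1) * a) = 0) := by
  have h := natDegree_of_eval (F := rootAndZero t a c) (a₅ := 0) (a₄ := a)
    (a₃ := c - 2 * t * a) (a₂ := t ^ 2 * a - 2 * t * c) (a₁ := t ^ 2 * c) (a₀ := 0)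
    (fun x => by rw [eval_rootAndZero]; ring)
  obtain ⟨h1, h2, h3, h4, h5⟩ := h
  refine ⟨h1, h2, h3, h4, h5.trans ?_⟩
  constructor <;> intro h' <;> linear_combination -h'

lemma isExtremal_rootAndZero {t a c : ℝ} (ht : 0 ≤ t) (ht1 : t ≠ 1) (ha : 0 ≤ a) (hc : 0 ≤ c)
    (hac : a ≠ 0 ∨ c ≠ 0) (hb : Balanced (rootAndZero t a c)) :
    IsExtremal diagCone (rootAndZero t a c) := by
  obtain ⟨h1, h2, h3, h4, -⟩ := rootAndZero_coeffs t a c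
  refine isExtremal_of_dominated ⟨h1, hb, fun x _ => ?_, fun w hw => ?_⟩
    (mul_ne_zero X_ne_zero (mul_ne_zero (pow_ne_zero _ (X_sub_C_ne_zero t)) (linear_ne_zero hac)))
    fun G hG hle _ => ?_
  · rw [eval_rootAndZero]
    positivity
  · rw [eval_edge, h2, h3, h4]
    have : 0 ≤ a * w := by positivity
    linarith
  · obtain ⟨K, rfl, hK, hK'⟩ := exists_eq_X_mul_of_le hG.2.2.1 hle
    obtain ⟨L, rfl, hL, hL'⟩ := exists_eq_sq_mul_of_le ht hK hK'
    have hGb := hG.2.1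
    rw [rootAndZero, ← mul_assoc] at hb ⊢
    rw [← mul_assoc] at hGb ⊢
    refine exists_smul_of_linear ?_ hb hac hGb
      ((natDegree_le_of_eval_le hL hL').trans natDegree_linear_le)
    have := sub_ne_zero.2 ht1.symm
    simp [this]

/-! ### Perturbations of extremal elements -/

lemma natDegree_mul_le_of_le {Z R K : ℝ[X]} (h0 : Z * R ≠ 0) (hd : K.natDegree ≤ R.natDegree) :
    (Z * K).natDegree ≤ (Z * R).natDegree := by
  rw [natDegree_mul (left_ne_zero_of_mul h0) (right_ne_zero_of_mul h0)]
  exact natDegree_mul_le.trans (Nat.add_le_add_left hd _)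

/-- `Z R` is the sum of the halves of `Z R ± ε Z K`, both in the cone for small `ε`; the zeros in
`Z` are untouched and `R` is bounded below relative to `K`. -/
lemma exists_smul_of_perturbation {Z R K : ℝ[X]} (hF : IsExtremal diagCone (Z * R))
    (hZ : ∀ x : ℝ, 0 ≤ x → 0 ≤ Z.eval x) (hR : ∀ x : ℝ, 0 ≤ x → 0 < R.eval x)
    (hd : K.natDegree ≤ R.natDegree) (hb : Balanced (Z * K)) {M : ℝ}
    (he : ∀ w : ℝ, 0 ≤ w → |(edge (Z * K)).eval w| ≤ M * (edge (Z * R)).eval w) :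
    ∃ α : ℝ, K = α • R := by
  obtain ⟨hmem, h0, hext⟩ := hF
  obtain ⟨N, hN, hN'⟩ := exists_abs_eval_le_mul hR hd
  obtain ⟨ε, hε, hεN, hεM⟩ : ∃ ε : ℝ, 0 < ε ∧ ε * N ≤ 1 ∧ ε * M ≤ 1 := by
    refine ⟨(1 + N + |M|)⁻¹, by positivity, ?_, ?_⟩
    · rw [inv_mul_le_iff₀ (by positivity)]
      linarith [abs_nonneg M]
    · rw [inv_mul_le_iff₀ (by positivity)]
      linarith [le_abs_self M]
  have key : ∀ σ : ℝ, |σ| = ε → (1 / 2 : ℝ) • (Z * R + σ • (Z * K)) ∈ diagCone := by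
    intro σ hσ
    refine smul_mem_diagCone ⟨?_, balanced_add hmem.2.1 (balanced_smul σ hb), fun x hx => ?_,
      fun w hw => ?_⟩ (by norm_num)
    · exact (natDegree_add_le_of_degree_le le_rfl ((natDegree_smul_le _ _).trans
        (natDegree_mul_le_of_le h0 hd))).trans hmem.1
    · have h1 : |σ * K.eval x| ≤ R.eval x := by
        rw [abs_mul, hσ]
        calc ε * |K.eval x| ≤ ε * (N * R.eval x) := mul_le_mul_of_nonneg_left (hN' x hx) hε.le
          _ = (ε * N) * R.eval x := by ring
          _ ≤ 1 * R.eval x := mul_le_mul_of_nonneg_right hεN (hR x hx).le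
          _ = R.eval x := one_mul _
      have h2 := neg_le_of_abs_le h1
      have : (Z * R + σ • (Z * K)).eval x = Z.eval x * (R.eval x + σ * K.eval x) := by
        simp only [eval_add, eval_mul, eval_smul, smul_eq_mul]
        ring
      rw [this]
      exact mul_nonneg (hZ x hx) (by linarith)
    · have h1 : |σ * (edge (Z * K)).eval w| ≤ (edge (Z * R)).eval w := by
        rw [abs_mul, hσ]
        calc ε * |(edge (Z * K)).eval w| ≤ ε * (M * (edge (Z * R)).eval w) :=
              mul_le_mul_of_nonneg_left (he w hw) hε.le
          _ = (ε * M) * (edge (Z * R)).eval w := by ring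
          _ ≤ 1 * (edge (Z * R)).eval w := mul_le_mul_of_nonneg_right hεM (hmem.2.2.2 w hw)
          _ = (edge (Z * R)).eval w := one_mul _
      have h2 := neg_le_of_abs_le h1
      rw [edge_add, edge_smul, eval_add, eval_smul, smul_eq_mul]
      linarith
  obtain ⟨⟨α, -, hα⟩, -⟩ := hext _ (key ε (abs_of_pos hε)) _ (key (-ε) (by simp [abs_of_pos hε]))
    (by module)
  refine ⟨(2 * α - 1) / ε, mul_left_cancel₀ (left_ne_zero_of_mul h0) ?_⟩
  have h1 : ε • (Z * K) = (2 * α - 1) • (Z * R) := by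
    have h2 : (2 : ℝ) • ((1 / 2 : ℝ) • (Z * R + ε • (Z * K))) = (2 : ℝ) • (α • (Z * R)) := by
      rw [hα]
    rw [smul_smul, smul_smul] at h2
    norm_num at h2
    rw [sub_smul, one_smul, ← h2]
    abel
  rw [mul_smul_comm, div_eq_inv_mul, mul_smul, ← h1, inv_smul_smul₀ hε.ne']

/-- Polynomials of degree at most `d` form a space of dimension `d + 1`, so `m < d` linear
conditions leave dimension at least two, more than the line through `R`. -/
lemma exists_kernel_not_smul {m d : ℕ} (L : ℝ[X] →ₗ[ℝ] (Fin m → ℝ)) (h : m + 1 ≤ d) (R : ℝ[X]) :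
    ∃ K : ℝ[X], K.natDegree ≤ d ∧ L K = 0 ∧ ∀ α : ℝ, K ≠ α • R := by
  by_contra! hcon
  let T : (Fin (d + 1) → ℝ) →ₗ[ℝ] ℝ[X] :=
    (degreeLT ℝ (d + 1)).subtype ∘ₗ (degreeLTEquiv ℝ (d + 1)).symm.toLinearMap
  have hT : Function.Injective T :=
    Subtype.val_injective.comp (degreeLTEquiv ℝ (d + 1)).symm.injective
  have hle : (LinearMap.ker (L ∘ₗ T)).map T ≤ Submodule.span ℝ {R} := by
    rintro _ ⟨v, hv, rfl⟩
    have hdeg : (T v).natDegree ≤ d := by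
      have : T v ∈ degreeLT ℝ (d + 1) := ((degreeLTEquiv ℝ (d + 1)).symm v).2
      rw [mem_degreeLT] at this
      exact natDegree_le_of_degree_le (Order.le_of_lt_succ (by exact_mod_cast this))
    obtain ⟨α, hα⟩ := hcon (T v) hdeg hv
    exact Submodule.mem_span_singleton.2 ⟨α, hα.symm⟩
  have h1 := Submodule.finrank_mono hle
  rw [← LinearEquiv.finrank_eq (Submodule.equivMapOfInjective T hT _)] at h1
  have h2 : Module.finrank ℝ (Submodule.span ℝ {R}) ≤ 1 := by
    simpa using finrank_span_le_card (R := ℝ) ({R} : Set ℝ[X])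
  have h3 := LinearMap.finrank_range_add_finrank_ker (L ∘ₗ T)
  have h4 := Submodule.finrank_le (LinearMap.range (L ∘ₗ T))
  rw [Module.finrank_fin_fun] at h3 h4
  omega

/-- The linear functional whose kernel consists of the balanced polynomials. -/
def balance : ℝ[X] →ₗ[ℝ] ℝ := (3 : ℝ) • (leval 1 ∘ₗ derivative) - (5 : ℝ) • leval 1

lemma balance_eq_zero_iff (F : ℝ[X]) : balance F = 0 ↔ Balanced F := by
  simp [balance, Balanced, sub_eq_zero, leval_apply]

/-- If the edge polynomial of every multiple of `Z` in the kernel of `m` linear functionals is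
dominated by that of an extremal element `Z R`, then `R` has degree at most `m`. -/
lemma natDegree_le_of_isExtremal {Z R : ℝ[X]} {m : ℕ} (φ : Fin m → ℝ[X] →ₗ[ℝ] ℝ)
    (hF : IsExtremal diagCone (Z * R)) (hZ : ∀ x : ℝ, 0 ≤ x → 0 ≤ Z.eval x)
    (hR : ∀ x : ℝ, 0 ≤ x → 0 < R.eval x)
    (hφ : ∀ K : ℝ[X], K.natDegree ≤ R.natDegree → (∀ j, φ j (Z * K) = 0) →
      Balanced (Z * K) ∧ ∃ M : ℝ, ∀ w : ℝ, 0 ≤ w →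
        |(edge (Z * K)).eval w| ≤ M * (edge (Z * R)).eval w) :
    R.natDegree ≤ m := by
  by_contra! hlt
  obtain ⟨K, hd, hK, hne⟩ := exists_kernel_not_smul
    (LinearMap.pi φ ∘ₗ LinearMap.mulLeft ℝ Z) hlt R
  obtain ⟨hb, M, hM⟩ := hφ K hd fun j => by simpa using congrFun hK j
  obtain ⟨α, hα⟩ := exists_smul_of_perturbation hF hZ hR hd hb hM
  exact hne α hα

lemma exists_abs_le_mul {a b : ℝ} (hb : 0 ≤ b) (h : b = 0 → a = 0) :
    ∃ M : ℝ, 0 ≤ M ∧ |a| ≤ M * b := by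
  rcases hb.eq_or_lt with hb | hb
  · exact ⟨0, le_rfl, by simp [h hb.symm]⟩
  · exact ⟨|a| / b, by positivity, by rw [div_mul_cancel₀ _ hb.ne']⟩

/-- The edge polynomial is the square of a linear polynomial with a nonnegative root. -/
def EdgeSquare (F : ℝ[X]) (a w₀ : ℝ) : Prop :=
  0 < a ∧ 0 ≤ w₀ ∧ edge F = C a * (X - C w₀) ^ 2

/-- Domination can fail only through a zero of `edge (Z * R)` or a drop of its degree. A zero at `w
= 0` comes from `Z(0) = 0` and is shared by `Z K`; a drop of degree is inherited from the degree
bound. A positive zero is double and, like a double zero at `0` with positive leading coefficient,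
would make the edge polynomial a square. -/
lemma exists_edge_le_of_not_edgeSquare {Z R K : ℝ[X]} (hF : Z * R ∈ diagCone) (h0 : Z * R ≠ 0)
    (hR : ∀ x : ℝ, 0 ≤ x → 0 < R.eval x) (hd : K.natDegree ≤ R.natDegree)
    (hS : ¬ ∃ a w₀, EdgeSquare (Z * R) a w₀) :
    ∃ M : ℝ, ∀ w : ℝ, 0 ≤ w → |(edge (Z * K)).eval w| ≤ M * (edge (Z * R)).eval w := by
  have hdeg := natDegree_mul_le_of_le h0 hd
  have hzero : (Z * R).coeff 0 = 0 → (Z * K).coeff 0 = 0 := by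
    intro h
    rw [mul_coeff_zero] at h ⊢
    have : R.coeff 0 ≠ 0 := by
      rw [coeff_zero_eq_eval_zero]
      exact (hR 0 le_rfl).ne'
    rw [(mul_eq_zero.1 h).resolve_right this, zero_mul]
  have hedge := hF.2.2.2
  have hF5 := hF.1
  have hc0 : 0 ≤ (Z * R).coeff 0 := by
    rw [coeff_zero_eq_eval_zero]
    exact hF.2.2.1 0 le_rfl
  unfold EdgeSquare at hS
  generalize Z * R = F at *
  generalize Z * K = H at *
  have h5 : 0 ≤ F.coeff 5 := by
    refine lead_nonneg_of_quadratic_nonneg (b := 3 * F.coeff 5 + F.coeff 4 / 2)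
      (c := F.coeff 0 / 2) fun w hw => ?_
    rw [← eval_edge]
    exact hedge w hw
  rcases h5.eq_or_lt with h5 | h5
  · have hF4 : F.natDegree ≤ 4 := by
      by_contra! hlt
      have e : F.natDegree = 5 := by omega
      have : F.leadingCoeff = 0 := by rw [leadingCoeff, e, ← h5]
      exact h0 (leadingCoeff_eq_zero.1 this)
    have hH5 : H.coeff 5 = 0 := coeff_eq_zero_of_natDegree_lt (by omega)
    have h4 : 0 ≤ F.coeff 4 / 2 := by
      refine lead_nonneg_of_quadratic_nonneg (b := 0) (c := F.coeff 0 / 2) fun w hw => ?_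
      have := hedge (w ^ 2) (by positivity)
      rw [eval_edge, ← h5] at this
      linarith
    have h4' : F.coeff 4 / 2 = 0 → H.coeff 4 / 2 = 0 := by
      intro h
      have hF3 : F.natDegree ≤ 3 := by
        by_contra! hlt
        have e : F.natDegree = 4 := by omega
        have : F.leadingCoeff = 0 := by rw [leadingCoeff, e]; linarith
        exact h0 (leadingCoeff_eq_zero.1 this)
      rw [coeff_eq_zero_of_natDegree_lt (by omega : H.natDegree < 4), zero_div]
    obtain ⟨M₁, hM₁, h1⟩ := exists_abs_le_mul h4 h4'
    obtain ⟨M₂, hM₂, h2⟩ := exists_abs_le_mul (a := H.coeff 0 / 2) (by linarith :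
      0 ≤ F.coeff 0 / 2) (fun h => by rw [hzero (by linarith), zero_div])
    refine ⟨M₁ + M₂, fun w hw => ?_⟩
    rw [eval_edge, eval_edge, hH5, ← h5]
    have h3 : |H.coeff 4 / 2 * w| ≤ M₁ * (F.coeff 4 / 2) * w := by
      rw [abs_mul, abs_of_nonneg hw]
      exact mul_le_mul_of_nonneg_right h1 hw
    have h6 := abs_add_le (H.coeff 4 / 2 * w) (H.coeff 0 / 2)
    have h7 : 0 ≤ M₂ * (F.coeff 4 / 2 * w) := by positivity
    have h8 : 0 ≤ M₁ * (F.coeff 0 / 2) := by positivity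
    calc |0 * w ^ 2 + (3 * 0 + H.coeff 4 / 2) * w + H.coeff 0 / 2|
        = |H.coeff 4 / 2 * w + H.coeff 0 / 2| := by ring_nf
      _ ≤ _ := by linarith
  · rcases hc0.eq_or_lt with hc0 | hc0
    · have hlin : ∀ w : ℝ, 0 ≤ w →
          0 ≤ (C (F.coeff 5) * X + C (3 * F.coeff 5 + F.coeff 4 / 2)).eval w := by
        refine eval_nonneg_of_X_mul fun w hw => ?_
        have := hedge w hw
        rw [eval_edge, ← hc0] at this
        simp only [eval_mul, eval_X, eval_add, eval_C]
        linarith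
      have hb0 : 0 ≤ 3 * F.coeff 5 + F.coeff 4 / 2 := by simpa using hlin 0 le_rfl
      have hb : 0 < 3 * F.coeff 5 + F.coeff 4 / 2 := by
        refine lt_of_le_of_ne hb0 fun hb => hS ⟨F.coeff 5, 0, h5, le_rfl, ?_⟩
        rw [edge, ← hb, ← hc0]
        simp
      obtain ⟨M, -, hM⟩ := exists_abs_eval_le_mul
        (K := C (H.coeff 5) * X + C (3 * H.coeff 5 + H.coeff 4 / 2))
        (R := C (F.coeff 5) * X + C (3 * F.coeff 5 + F.coeff 4 / 2))
        (fun w hw => by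
          simp only [eval_mul, eval_X, eval_add, eval_C]
          have : 0 ≤ F.coeff 5 * w := by positivity
          linarith)
        (natDegree_linear_le.trans_eq (natDegree_linear h5.ne').symm)
      refine ⟨M, fun w hw => ?_⟩
      have := mul_le_mul_of_nonneg_left (hM w hw) hw
      simp only [eval_mul, eval_X, eval_add, eval_C] at this
      rw [eval_edge, eval_edge, hzero hc0.symm, ← hc0]
      rw [← abs_of_nonneg hw, ← abs_mul, abs_of_nonneg hw] at this
      calc _ = |w * (H.coeff 5 * w + (3 * H.coeff 5 + H.coeff 4 / 2))| := by ring_nf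
        _ ≤ _ := this
        _ = _ := by ring
    · have hlead : (edge F).natDegree = 2 := by
        rw [edge]
        exact natDegree_quadratic h5.ne'
      have hpos : ∀ w : ℝ, 0 ≤ w → 0 < (edge F).eval w := by
        refine fun w hw => lt_of_le_of_ne (hedge w hw) fun hw0 => hS ?_
        have hw' : 0 < w := by
          refine lt_of_le_of_ne hw ?_
          rintro rfl
          rw [eval_edge] at hw0
          linarith
        obtain ⟨E, hE, -⟩ := exists_eq_sq_mul hedge hw' hw0.symm
        have hEd : E.natDegree ≤ 0 := natDegree_le_of_sq_mul (hE ▸ natDegree_edge_le F)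
        rw [eq_C_of_natDegree_le_zero hEd] at hE
        refine ⟨F.coeff 5, w, h5, hw, ?_⟩
        have hco : (edge F).coeff 2 = F.coeff 5 := by
          simp [edge]
        rw [hE, show (X - C w) ^ 2 * C (E.coeff 0) = C (E.coeff 0) * X ^ 2
          + C (-2 * w * E.coeff 0) * X + C (w ^ 2 * E.coeff 0) by
            simp only [map_mul, map_neg, map_pow, map_ofNat]; ring] at hco
        simp only [coeff_add, coeff_C_mul, coeff_X_pow, coeff_X, coeff_C] at hco
        norm_num at hco
        rw [hE, hco, mul_comm]
      obtain ⟨M, -, hM⟩ := exists_abs_eval_le_mul hpos ((natDegree_edge_le H).trans_eq hlead.symm)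
      exact ⟨M, hM⟩

lemma exists_edge_le_of_edgeSquare {F H : ℝ[X]} {a w₀ : ℝ} (hS : EdgeSquare F a w₀)
    (h1 : 3 * H.coeff 5 + H.coeff 4 / 2 + 2 * w₀ * H.coeff 5 = 0)
    (h0 : H.coeff 0 / 2 - w₀ ^ 2 * H.coeff 5 = 0) :
    ∃ M : ℝ, ∀ w : ℝ, 0 ≤ w → |(edge H).eval w| ≤ M * (edge F).eval w := by
  obtain ⟨ha, -, hE⟩ := hS
  refine ⟨|H.coeff 5| / a, fun w _ => ?_⟩
  rw [hE, eval_edge]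
  have e : H.coeff 5 * w ^ 2 + (3 * H.coeff 5 + H.coeff 4 / 2) * w + H.coeff 0 / 2 =
      H.coeff 5 * (w - w₀) ^ 2 := by
    linear_combination w * h1 + h0
  rw [e, abs_mul, abs_of_nonneg (sq_nonneg (w - w₀))]
  simp only [eval_mul, eval_C, eval_pow, eval_sub, eval_X]
  rw [← mul_assoc, div_mul_cancel₀ _ ha.ne']

/-! ### Classification of the extremal elements -/

/-- Both the value and the derivative at `1` vanish, so a double root at `1` makes the balance
condition void. -/
lemma balanced_sq_one_mul (P : ℝ[X]) : Balanced ((X - C 1) ^ 2 * P) := by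
  rw [balanced_mul_iff]
  simp [sq]

lemma natDegree_le_one_of_not_edgeSquare {Z R : ℝ[X]} (hF : IsExtremal diagCone (Z * R))
    (hZ : ∀ x : ℝ, 0 ≤ x → 0 ≤ Z.eval x) (hR : ∀ x : ℝ, 0 ≤ x → 0 < R.eval x)
    (hS : ¬ ∃ a w₀, EdgeSquare (Z * R) a w₀) : R.natDegree ≤ 1 :=
  natDegree_le_of_isExtremal ![balance] hF hZ hR fun _ hd hK =>
    ⟨(balance_eq_zero_iff _).1 (hK 0),
      exists_edge_le_of_not_edgeSquare hF.1 hF.2.1 hR hd hS⟩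

lemma natDegree_le_zero_of_not_edgeSquare {Z R : ℝ[X]}
    (hF : IsExtremal diagCone ((X - C 1) ^ 2 * Z * R))
    (hZ : ∀ x : ℝ, 0 ≤ x → 0 ≤ Z.eval x) (hR : ∀ x : ℝ, 0 ≤ x → 0 < R.eval x)
    (hS : ¬ ∃ a w₀, EdgeSquare ((X - C 1) ^ 2 * Z * R) a w₀) : R.natDegree ≤ 0 := by
  refine natDegree_le_of_isExtremal ![] hF (fun x hx => ?_) hR fun K hd _ =>
    ⟨by rw [mul_assoc]; exact balanced_sq_one_mul _,
      exists_edge_le_of_not_edgeSquare hF.1 hF.2.1 hR hd hS⟩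
  rw [eval_mul, eval_pow]
  exact mul_nonneg (sq_nonneg _) (hZ x hx)

/-- A linear functional that vanishes when the edge polynomial is a multiple of `(X - w₀)²`. -/
def edgeSlope (w₀ : ℝ) : ℝ[X] →ₗ[ℝ] ℝ :=
  (3 + 2 * w₀) • lcoeff ℝ 5 + (1 / 2 : ℝ) • lcoeff ℝ 4

/-- The functional that, with `edgeSlope`, vanishes when the edge polynomial is a multiple of
`(X - w₀)²`. -/
def edgeConst (w₀ : ℝ) : ℝ[X] →ₗ[ℝ] ℝ := (1 / 2 : ℝ) • lcoeff ℝ 0 - w₀ ^ 2 • lcoeff ℝ 5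

lemma exists_edge_le_of_functionals {F H : ℝ[X]} {a w₀ : ℝ} (hS : EdgeSquare F a w₀)
    (h1 : edgeSlope w₀ H = 0) (h0 : edgeConst w₀ H = 0) :
    ∃ M : ℝ, ∀ w : ℝ, 0 ≤ w → |(edge H).eval w| ≤ M * (edge F).eval w := by
  simp only [edgeSlope, edgeConst, LinearMap.add_apply, LinearMap.sub_apply,
    LinearMap.smul_apply, lcoeff_apply, smul_eq_mul] at h1 h0
  exact exists_edge_le_of_edgeSquare hS (by linarith) (by linarith)

lemma edgeSquare_coeffs {F : ℝ[X]} {a w₀ : ℝ} (hS : EdgeSquare F a w₀) :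
    F.coeff 5 = a ∧ 3 * F.coeff 5 + F.coeff 4 / 2 = -2 * w₀ * a ∧
      F.coeff 0 / 2 = a * w₀ ^ 2 := by
  have h : ∀ w : ℝ, F.coeff 5 * w ^ 2 + (3 * F.coeff 5 + F.coeff 4 / 2) * w + F.coeff 0 / 2 =
      a * (w - w₀) ^ 2 := fun w => by
    rw [← eval_edge, hS.2.2]
    simp
  have h0 := h 0
  have h1 := h 1
  have h2 := h (-1)
  refine ⟨?_, ?_, ?_⟩ <;> linarith

lemma edgeSquare_root_eq_zero {F : ℝ[X]} {a w₀ : ℝ} (hS : EdgeSquare F a w₀)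
    (h : F.coeff 0 = 0) : w₀ = 0 := by
  have h0 := (edgeSquare_coeffs hS).2.2
  rw [h, zero_div] at h0
  exact pow_eq_zero_iff two_ne_zero |>.1 ((mul_eq_zero.1 h0.symm).resolve_left hS.1.ne')

lemma edgeConst_eq_zero {Z R K : ℝ[X]} {a w₀ : ℝ} (hS : EdgeSquare (Z * R) a w₀)
    (hZ0 : Z.coeff 0 = 0) : edgeConst w₀ (Z * K) = 0 := by
  have : w₀ = 0 := edgeSquare_root_eq_zero hS (by rw [mul_coeff_zero, hZ0, zero_mul])
  simp [edgeConst, this, hZ0, mul_coeff_zero]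

/-- There are three conditions: balance, and the two that make the edge polynomial proportional to
`(X - w₀)^2`. A root at `0` forces `w₀ = 0` and voids `edgeConst`; a double root at `1` voids
balance. -/
lemma natDegree_le_of_edgeSquare {Z R : ℝ[X]} {a w₀ : ℝ} (hF : IsExtremal diagCone (Z * R))
    (hZ : ∀ x : ℝ, 0 ≤ x → 0 ≤ Z.eval x) (hR : ∀ x : ℝ, 0 ≤ x → 0 < R.eval x)
    (hS : EdgeSquare (Z * R) a w₀) :
    R.natDegree ≤ 3 ∧ (Z.coeff 0 = 0 → R.natDegree ≤ 2) ∧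
      ((X - C 1) ^ 2 ∣ Z → R.natDegree ≤ 2) ∧
      (Z.coeff 0 = 0 → (X - C 1) ^ 2 ∣ Z → R.natDegree ≤ 1) := by
  have hone : (X - C 1) ^ 2 ∣ Z → ∀ K, Balanced (Z * K) := by
    rintro ⟨Y, rfl⟩ K
    rw [mul_assoc]
    exact balanced_sq_one_mul _
  refine ⟨?_, fun h0 => ?_, fun h1 => ?_, fun h0 h1 => ?_⟩
  · exact natDegree_le_of_isExtremal ![balance, edgeSlope w₀, edgeConst w₀] hF hZ hR
      fun K _ hK => ⟨(balance_eq_zero_iff _).1 (hK 0),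
        exists_edge_le_of_functionals hS (hK 1) (hK 2)⟩
  · exact natDegree_le_of_isExtremal ![balance, edgeSlope w₀] hF hZ hR
      fun K _ hK => ⟨(balance_eq_zero_iff _).1 (hK 0),
        exists_edge_le_of_functionals hS (hK 1) (edgeConst_eq_zero hS h0)⟩
  · exact natDegree_le_of_isExtremal ![edgeSlope w₀, edgeConst w₀] hF hZ hR
      fun K _ hK => ⟨hone h1 K, exists_edge_le_of_functionals hS (hK 0) (hK 1)⟩
  · exact natDegree_le_of_isExtremal ![edgeSlope w₀] hF hZ hR
      fun K _ hK => ⟨hone h1 K,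
        exists_edge_le_of_functionals hS (hK 0) (edgeConst_eq_zero hS h0)⟩

lemma exists_eq_linear_of_nonneg {P : ℝ[X]} (hd : P.natDegree ≤ 1) (h0 : P ≠ 0)
    (hP : ∀ x : ℝ, 0 ≤ x → 0 ≤ P.eval x) :
    ∃ a c : ℝ, 0 ≤ a ∧ 0 ≤ c ∧ (a ≠ 0 ∨ c ≠ 0) ∧ P = C a * X + C c := by
  have e := eq_linear hd
  refine ⟨P.coeff 1, P.coeff 0, ?_, ?_, ?_, e⟩
  · refine lead_nonneg_of_quadratic_nonneg (b := 0) (c := P.coeff 0) fun w _ => ?_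
    have := hP (w ^ 2) (by positivity)
    rw [e] at this
    simp only [eval_add, eval_mul, eval_C, eval_X] at this
    linarith
  · rw [coeff_zero_eq_eval_zero]
    exact hP 0 le_rfl
  · by_contra! h
    rw [h.1, h.2] at e
    exact h0 (by simpa using e)

lemma exists_eq_const_of_pos {R : ℝ[X]} (hd : R.natDegree ≤ 0)
    (hR : ∀ x : ℝ, 0 ≤ x → 0 < R.eval x) : ∃ c : ℝ, 0 < c ∧ R = C c := by
  have e := eq_C_of_natDegree_le_zero hd
  refine ⟨R.coeff 0, ?_, e⟩
  rw [coeff_zero_eq_eval_zero]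
  exact hR 0 le_rfl

lemma exists_eq_smul_edgeRoot {F : ℝ[X]} (hF : F ∈ diagCone) {a w₀ : ℝ}
    (hS : EdgeSquare F a w₀) {t : ℝ} (ht : 0 < t) (ht1 : t ≠ 1) (hroot : F.eval t = 0) :
    ∃ v : ℝ, 2 ≤ t ∧ 0 ≤ v ∧ 0 ≤ t - 2 - v ^ 2 - 2 * t * v ∧ F = a • edgeRoot t v := by
  obtain ⟨ha, hw, he⟩ := hS
  obtain ⟨v, hv, rfl⟩ : ∃ v, 0 ≤ v ∧ w₀ = t * v :=
    ⟨w₀ / t, by positivity, by field_simp⟩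
  obtain ⟨K, rfl, -⟩ := exists_eq_sq_mul hF.2.2.1 ht hroot
  have hFe := eq_smul_edgeRoot ht ht1 (natDegree_le_of_sq_mul hF.1) hF.2.1 he
  have hpos : ∀ x : ℝ, 0 ≤ x → x ≠ t → 0 ≤ (2 * v ^ 2 * (x - 1) ^ 2
      + x * (x ^ 2 - 2 * (3 - t + v ^ 2 + 2 * t * v) * x
        + (1 - 2 * (t - 2 - v ^ 2 - 2 * t * v)
          + 3 * (t - 1) * (t - 2 - v ^ 2 - 2 * t * v) / (t + 2)))) * (t + 2) := by
    intro x hx hxt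
    have := hF.2.2.1 x hx
    rw [hFe, eval_smul, smul_eq_mul, eval_edgeRoot] at this
    have h1 := nonneg_of_mul_nonneg_right this ha
    have h2 := nonneg_of_mul_nonneg_right h1 (by have := sub_ne_zero.2 hxt; positivity)
    exact mul_nonneg h2 (by linarith)
  -- At `x = 1` the cofactor of `(x - t)^2` reduces to `3(t - 1)n/(t + 2)` with `n = t - 2 - v^2 -
  -- 2tv`.
  have hone : 0 ≤ (t - 1) * (t - 2 - v ^ 2 - 2 * t * v) := by
    have h1 := hpos 1 zero_le_one ht1.symm
    have : (2 * v ^ 2 * ((1 : ℝ) - 1) ^ 2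
      + 1 * (1 ^ 2 - 2 * (3 - t + v ^ 2 + 2 * t * v) * 1
        + (1 - 2 * (t - 2 - v ^ 2 - 2 * t * v)
          + 3 * (t - 1) * (t - 2 - v ^ 2 - 2 * t * v) / (t + 2)))) * (t + 2) =
        3 * ((t - 1) * (t - 2 - v ^ 2 - 2 * t * v)) := by
      field_simp
      ring
    rw [this] at h1
    linarith
  rcases lt_or_gt_of_ne ht1 with hlt | hgt
  · exfalso
    -- For `t < 1` also `n < 0`, so `hone` gives no contradiction. Instead, the value at `4` forces
    -- `v^2 ≤ 2t`, and then the value at `3` is negative.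
    have h4 := hpos 4 (by norm_num) (by linarith)
    have h3 := hpos 3 (by norm_num) (by linarith)
    have e4 : (2 * v ^ 2 * ((4 : ℝ) - 1) ^ 2
      + 4 * (4 ^ 2 - 2 * (3 - t + v ^ 2 + 2 * t * v) * 4
        + (1 - 2 * (t - 2 - v ^ 2 - 2 * t * v)
          + 3 * (t - 1) * (t - 2 - v ^ 2 - 2 * t * v) / (t + 2)))) * (t + 2) =
        t * (18 * (2 * t - v ^ 2 - 4 * v * (1 + t))) := by
      field_simp
      ring
    have e3 : (2 * v ^ 2 * ((3 : ℝ) - 1) ^ 2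
      + 3 * (3 ^ 2 - 2 * (3 - t + v ^ 2 + 2 * t * v) * 3
        + (1 - 2 * (t - 2 - v ^ 2 - 2 * t * v)
          + 3 * (t - 1) * (t - 2 - v ^ 2 - 2 * t * v) / (t + 2)))) * (t + 2) =
        (21 * t + 6) * (t - 1) + v ^ 2 * (1 - 13 * t) - v * (42 * t ^ 2 + 30 * t) := by
      field_simp
      ring
    rw [e4] at h4
    rw [e3] at h3
    have h5 := nonneg_of_mul_nonneg_right h4 ht
    have h6 : v ^ 2 ≤ 2 * t := by nlinarith [mul_nonneg hv ht.le]
    have h7 : 0 ≤ v * (42 * t ^ 2 + 30 * t) := by positivity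
    have h8 : (21 * t + 6) * (t - 1) < 0 := mul_neg_of_pos_of_neg (by positivity) (by linarith)
    rcases le_total (1 - 13 * t) 0 with h9 | h9
    · nlinarith [mul_nonneg (sq_nonneg v) (neg_nonneg.2 h9)]
    · have := mul_le_mul_of_nonneg_right h6 h9
      nlinarith
  · have hn : 0 ≤ t - 2 - v ^ 2 - 2 * t * v :=
      nonneg_of_mul_nonneg_right hone (by linarith)
    refine ⟨v, ?_, hv, hn, hFe⟩
    have : 0 ≤ t * v := by positivity
    nlinarith [sq_nonneg v]

/-- It remains to exclude that all zeros on the half-line are `0` or `1`. Here `F` has degree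
exactly 5, so the degree bounds on `R` force many such zeros, and the patterns left violate
positivity or the edge condition. -/
lemma isExtremal_edgeSquare {F : ℝ[X]} (hF : IsExtremal diagCone F) {a w₀ : ℝ}
    (hS : EdgeSquare F a w₀) :
    ∃ t v : ℝ, 2 ≤ t ∧ 0 ≤ v ∧ 0 ≤ t - 2 - v ^ 2 - 2 * t * v ∧ F = a • edgeRoot t v := by
  by_cases hex : ∃ t : ℝ, 0 < t ∧ t ≠ 1 ∧ F.eval t = 0
  · obtain ⟨t, ht, ht1, hroot⟩ := hex
    exact ⟨t, exists_eq_smul_edgeRoot hF.1 hS ht ht1 hroot⟩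
  exfalso
  push Not at hex
  obtain ⟨hc5, hc4, hc0⟩ := edgeSquare_coeffs hS
  have hdegF : F.natDegree = 5 :=
    le_antisymm hF.1.1 (le_natDegree_of_ne_zero (by rw [hc5]; exact hS.1.ne'))
  have hw := hS.2.1
  have ha := hS.1
  have hwa : 0 ≤ w₀ * a := by positivity
  -- The linear coefficient of the edge polynomial would be `(2 - z)a + c'/2 > 0`, whereas a square
  -- with root `w₀ ≥ 0` has `-2 w₀ a ≤ 0`.
  have htwo : ∀ z a' c' : ℝ, z ≤ 1 → 0 ≤ c' → F ≠ twoRoots 1 z a' c' := by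
    intro z a' c' hz hc' h
    obtain ⟨-, h5, h4, -, -⟩ := twoRoots_coeffs 1 z a' c'
    rw [h, h5] at hc5
    rw [h, h5, h4, hc5] at hc4
    nlinarith
  obtain ⟨i, ts, R, hts, hFe, hR⟩ := exists_factorization hF.2.1 hF.1.2.2.1
  have hR0 : R ≠ 0 := by
    rintro rfl
    simpa using hR 0 le_rfl
  have hlin : ∀ k : ℕ, k + R.natDegree ≤ 1 → ∃ a' c' : ℝ, 0 ≤ a' ∧ 0 ≤ c' ∧
      (a' ≠ 0 ∨ c' ≠ 0) ∧ X ^ k * R = C a' * X + C c' := fun k hk =>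
    exists_eq_linear_of_nonneg (by rwa [natDegree_mul (pow_ne_zero _ X_ne_zero) hR0,
      natDegree_X_pow]) (mul_ne_zero (pow_ne_zero _ X_ne_zero) hR0) fun x hx => by
        rw [eval_mul, eval_pow, eval_X]
        exact mul_nonneg (pow_nonneg hx _) (hR x hx).le
  have hone : ∀ t ∈ ts, t = 1 := by
    intro t ht
    by_contra h1
    refine hex t (hts t ht) h1 ?_
    rw [hFe, eval_mul, eval_mul, eval_list_prod, List.prod_eq_zero, mul_zero, zero_mul]
    exact List.mem_map.2 ⟨(X - C t) ^ 2, List.mem_map.2 ⟨t, ht, rfl⟩, by simp⟩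
  match ts, hts, hone, hFe with
  | [], _, _, hFe =>
    simp only [List.map_nil, List.prod_nil, mul_one] at hFe
    have hdeg : i + R.natDegree = 5 := by
      rw [← hdegF, hFe, natDegree_mul (pow_ne_zero _ X_ne_zero) hR0, natDegree_X_pow]
    have hbound := natDegree_le_of_edgeSquare (hFe ▸ hF) (fun x hx => by
      rw [eval_pow, eval_X]; positivity) hR (hFe ▸ hS)
    rcases Nat.lt_or_ge i 3 with hi | hi
    · rcases Nat.eq_zero_or_pos i with rfl | hi'
      · have := hbound.1
        omega
      · have := hbound.2.1 (by simp [coeff_X_pow]; omega)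
        omega
    · obtain ⟨k, rfl⟩ := Nat.exists_eq_add_of_le hi
      have hd : (X ^ k * R).natDegree ≤ 2 := by
        rw [natDegree_mul (pow_ne_zero _ X_ne_zero) hR0, natDegree_X_pow]
        omega
      rw [pow_add, mul_assoc, eq_quadratic hd] at hFe
      generalize (X ^ k * R).coeff 2 = p₂ at hFe
      generalize (X ^ k * R).coeff 1 = p₁ at hFe
      generalize (X ^ k * R).coeff 0 = p₀ at hFe
      obtain ⟨-, h5, h4, h0, hb⟩ := natDegree_of_eval (F := F) (a₅ := p₂) (a₄ := p₁) (a₃ := p₀)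
        (a₂ := 0) (a₁ := 0) (a₀ := 0) (fun x => by
          rw [hFe]
          simp only [eval_mul, eval_pow, eval_X, eval_add, eval_C]
          ring)
      have hb' := hb.1 hF.1.2.1
      have hw0 := edgeSquare_root_eq_zero hS h0
      rw [h5] at hc5
      rw [h5, h4, hc5, hw0] at hc4
      -- With `w₀ = 0` and balance, `F = a X^3 (X - 2)(X - 4)`, which is negative at `3`.
      have h3 := hF.1.2.2.1 3 (by norm_num)
      rw [hFe] at h3
      simp only [eval_mul, eval_pow, eval_X, eval_add, eval_C] at h3
      linarith
  | [t], _, hone, hFe =>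
    obtain rfl : t = 1 := hone t (by simp)
    simp only [List.map_cons, List.map_nil, List.prod_cons, List.prod_nil, mul_one] at hFe
    have hsq : (X - C (1 : ℝ)) ^ 2 ≠ 0 := pow_ne_zero _ (X_sub_C_ne_zero 1)
    have hdeg : i + 2 + R.natDegree = 5 := by
      rw [← hdegF, hFe, natDegree_mul (mul_ne_zero (pow_ne_zero _ X_ne_zero) hsq) hR0,
        natDegree_mul (pow_ne_zero _ X_ne_zero) hsq, natDegree_X_pow, natDegree_pow,
        natDegree_X_sub_C]
    have hbound := natDegree_le_of_edgeSquare (hFe ▸ hF) (fun x hx => by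
      simp only [eval_mul, eval_pow, eval_X, eval_sub, eval_C]; positivity) hR (hFe ▸ hS)
    rcases Nat.lt_or_ge i 2 with hi | hi
    · rcases Nat.eq_zero_or_pos i with rfl | hi'
      · have := hbound.2.2.1 (dvd_mul_left _ _)
        omega
      · have := hbound.2.2.2 (by simp [mul_coeff_zero, coeff_X_pow]; omega) (dvd_mul_left _ _)
        omega
    · obtain ⟨k, rfl⟩ := Nat.exists_eq_add_of_le hi
      obtain ⟨a', c', -, hc', -, hk⟩ := hlin k (by omega)
      refine htwo 0 a' c' zero_le_one hc' ?_
      rw [hFe, twoRoots, ← hk, C_0, sub_zero]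
      ring
  | [t₁, t₂], _, hone, hFe =>
    obtain rfl : t₁ = 1 := hone t₁ (by simp)
    obtain rfl : t₂ = 1 := hone t₂ (by simp)
    simp only [List.map_cons, List.map_nil, List.prod_cons, List.prod_nil, mul_one] at hFe
    have hsq : (X - C (1 : ℝ)) ^ 2 ≠ 0 := pow_ne_zero _ (X_sub_C_ne_zero 1)
    have hdeg : i + 4 + R.natDegree = 5 := by
      rw [← hdegF, hFe, natDegree_mul (mul_ne_zero (pow_ne_zero _ X_ne_zero)
        (mul_ne_zero hsq hsq)) hR0, natDegree_mul (pow_ne_zero _ X_ne_zero)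
        (mul_ne_zero hsq hsq), natDegree_mul hsq hsq, natDegree_X_pow, natDegree_pow,
        natDegree_X_sub_C]
    obtain ⟨a', c', -, hc', -, hk⟩ := hlin i (by omega)
    refine htwo 1 a' c' le_rfl hc' ?_
    rw [hFe, twoRoots, ← hk]
    ring
  | t₁ :: t₂ :: t₃ :: ts, _, _, hFe =>
    have : (X - C t₁) ^ 2 * ((X - C t₂) ^ 2 * (X - C t₃) ^ 2) ∣ F := by
      rw [hFe]
      simp only [List.map_cons, List.prod_cons]
      exact ⟨X ^ i * (ts.map fun t => (X - C t) ^ 2).prod * R, by ring⟩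
    have := natDegree_le_of_dvd this hF.2.1
    have hsq : ∀ t : ℝ, (X - C t) ^ 2 ≠ 0 := fun t => pow_ne_zero _ (X_sub_C_ne_zero t)
    rw [natDegree_mul (hsq _) (mul_ne_zero (hsq _) (hsq _)), natDegree_mul (hsq _) (hsq _),
      natDegree_pow, natDegree_pow, natDegree_pow, natDegree_X_sub_C, natDegree_X_sub_C,
      natDegree_X_sub_C] at this
    omega

/-- The extremal elements whose edge polynomial is not a square. -/
def SlackForm (F : ℝ[X]) : Prop :=
  (∃ t z a c : ℝ, 0 ≤ t ∧ 0 ≤ z ∧ t ≠ 1 ∧ z ≠ 1 ∧ 0 ≤ a ∧ 0 ≤ c ∧ (a ≠ 0 ∨ c ≠ 0) ∧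
    F = twoRoots t z a c) ∨
  (∃ t c : ℝ, 0 ≤ t ∧ t ≤ 2 ∧ 0 < c ∧ F = c • twoRoots 1 t 1 0) ∨
  (∃ t c : ℝ, 0 ≤ t ∧ 0 < c ∧ F = c • twoRoots 1 t 0 1) ∨
  (∃ c : ℝ, 0 < c ∧ F = c • ((X - C 1) ^ 2 * C 1)) ∨
  (∃ t a c : ℝ, 0 < t ∧ t ≠ 1 ∧ 0 ≤ a ∧ 0 ≤ c ∧ (a ≠ 0 ∨ c ≠ 0) ∧ F = rootAndZero t a c) ∨
  (∃ c : ℝ, 0 < c ∧ F = c • (X * ((X - C 1) ^ 2 * C 1))) ∨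
  ∃ c : ℝ, 0 < c ∧ F = c • (X * (C 2 * X + C 1))

lemma slackForm_of_two_roots {F R : ℝ[X]} {t : ℝ} {i : ℕ} (hF : IsExtremal diagCone F)
    (hS : ¬ ∃ a w₀, EdgeSquare F a w₀) (ht : 0 ≤ t)
    (hFe : F = (X - C 1) ^ 2 * (X ^ i * (X - C t) ^ 2) * R) (hi : i ≤ 1)
    (hR : ∀ x : ℝ, 0 ≤ x → 0 < R.eval x) : SlackForm F := by
  have hd := natDegree_le_zero_of_not_edgeSquare (hFe ▸ hF) (fun x hx => by
    simp only [eval_mul, eval_pow, eval_X, eval_sub, eval_C]; positivity) hR (hFe ▸ hS)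
  obtain ⟨c, hc, rfl⟩ := exists_eq_const_of_pos hd hR
  interval_cases i
  · refine Or.inr (Or.inr (Or.inl ⟨t, c, ht, hc, ?_⟩))
    rw [hFe, smul_eq_C_mul]
    simp only [twoRoots, map_zero, map_one]
    ring
  · have e : F = c • twoRoots 1 t 1 0 := by
      rw [hFe, smul_eq_C_mul]
      simp only [twoRoots, map_zero, map_one]
      ring
    refine Or.inr (Or.inl ⟨t, c, ht, ?_, hc, e⟩)
    by_contra! h2
    -- The edge polynomial is `c` times `w^2 - (t - 2) w`, tested at its minimum.
    have h1 := hF.1.2.2.2 ((t - 2) / 2) (by linarith)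
    obtain ⟨-, h5, h4, h0, -⟩ := twoRoots_coeffs 1 t 1 0
    rw [e, edge_smul, eval_smul, smul_eq_mul, eval_edge, h5, h4, h0] at h1
    have h3 := nonneg_of_mul_nonneg_right h1 hc
    nlinarith

/-- The cofactor `R` has degree at most one, and is constant once `(X - 1)^2` divides `F`. The cases
are the numbers of positive double roots; a factor `X^2` is read as a double root at `0`. -/
lemma slackForm_of_not_edgeSquare {F : ℝ[X]} (hF : IsExtremal diagCone F)
    (hS : ¬ ∃ a w₀, EdgeSquare F a w₀) : SlackForm F := by
  obtain ⟨i, ts, R, hts, hFe, hR⟩ := exists_factorization hF.2.1 hF.1.2.2.1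
  have hR0 : R ≠ 0 := by
    rintro rfl
    simpa using hR 0 le_rfl
  have hsq : ∀ t : ℝ, (X - C t) ^ 2 ≠ 0 := fun t => pow_ne_zero _ (X_sub_C_ne_zero t)
  have hX : ∀ k : ℕ, (X ^ k : ℝ[X]) ≠ 0 := fun k => pow_ne_zero _ X_ne_zero
  have hlin : ∀ k : ℕ, k + R.natDegree ≤ 1 → ∃ a' c' : ℝ, 0 ≤ a' ∧ 0 ≤ c' ∧
      (a' ≠ 0 ∨ c' ≠ 0) ∧ X ^ k * R = C a' * X + C c' := fun k hk =>
    exists_eq_linear_of_nonneg (by rwa [natDegree_mul (hX k) hR0, natDegree_X_pow])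
      (mul_ne_zero (hX k) hR0) fun x hx => by
        rw [eval_mul, eval_pow, eval_X]
        exact mul_nonneg (pow_nonneg hx _) (hR x hx).le
  have hd5 := hF.1.1
  have hbal := hF.1.2.1
  match ts, hts, hFe with
  | [], _, hFe =>
    simp only [List.map_nil, List.prod_nil, mul_one] at hFe
    have hd := natDegree_le_one_of_not_edgeSquare (hFe ▸ hF) (fun x hx => by
      simp only [eval_pow, eval_X]; positivity) hR (hFe ▸ hS)
    obtain ⟨a, c, ha, hc, hac, hk⟩ := hlin 0 (by omega)
    rw [pow_zero, one_mul] at hk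
    have hpos : 0 < a + c := add_pos_of_nonneg_of_ne ha hc hac
    rw [hFe, hk, balanced_mul_iff] at hbal
    simp only [derivative_X_pow, eval_mul, eval_pow, eval_X, one_pow, mul_one, eval_add, eval_C,
      derivative_add, derivative_mul, derivative_C, derivative_X, zero_mul, zero_add,
      add_zero, one_mul] at hbal
    -- Balance reads `3a = (5 - 3i)(a + c)`, and `0 ≤ a ≤ a + c` leaves only `i = 1`.
    obtain rfl : i = 1 := by
      rcases Nat.lt_or_ge i 2 with h | h
      · interval_cases i
        · simp at hbal
          linarith
        · rfl
      · have h2 : (2 : ℝ) ≤ i := by exact_mod_cast h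
        nlinarith [mul_le_mul_of_nonneg_right h2 hpos.le]
    have hac' : a = 2 * c := by
      simp at hbal
      linarith
    refine Or.inr (Or.inr (Or.inr (Or.inr (Or.inr (Or.inr ⟨c, by linarith, ?_⟩)))))
    rw [hFe, hk, hac', smul_eq_C_mul]
    simp only [map_mul, map_one]
    ring
  | [t], hts, hFe =>
    have ht : 0 < t := hts t (by simp)
    simp only [List.map_cons, List.map_nil, List.prod_cons, List.prod_nil, mul_one] at hFe
    have hdeg : i + 2 + R.natDegree ≤ 5 := by
      rwa [hFe, natDegree_mul (mul_ne_zero (hX i) (hsq t)) hR0, natDegree_mul (hX i) (hsq t),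
        natDegree_X_pow, natDegree_pow, natDegree_X_sub_C] at hd5
    by_cases ht1 : t = 1
    · subst ht1
      rcases Nat.lt_or_ge i 2 with hi | hi
      · have hFe' : F = (X - C 1) ^ 2 * X ^ i * R := by rw [hFe]; ring
        have hd := natDegree_le_zero_of_not_edgeSquare (hFe' ▸ hF) (fun x hx => by
          simp only [eval_pow, eval_X]; positivity) hR (hFe' ▸ hS)
        obtain ⟨c, hc, rfl⟩ := exists_eq_const_of_pos hd hR
        interval_cases i
        · refine Or.inr (Or.inr (Or.inr (Or.inl ⟨c, hc, ?_⟩)))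
          rw [hFe, smul_eq_C_mul, C_1]
          ring
        · refine Or.inr (Or.inr (Or.inr (Or.inr (Or.inr (Or.inl ⟨c, hc, ?_⟩)))))
          rw [hFe, smul_eq_C_mul, C_1]
          ring
      · obtain ⟨k, rfl⟩ := Nat.exists_eq_add_of_le hi
        refine slackForm_of_two_roots (i := k) hF hS le_rfl ?_ (by omega) hR
        rw [hFe, C_0, sub_zero]
        ring
    · have hd := natDegree_le_one_of_not_edgeSquare (hFe ▸ hF) (fun x hx => by
        simp only [eval_mul, eval_pow, eval_X, eval_sub, eval_C]; positivity) hR (hFe ▸ hS)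
      rcases Nat.lt_or_ge i 2 with hi | hi
      · obtain ⟨a, c, ha, hc, hac, hk⟩ := hlin 0 (by omega)
        rw [pow_zero, one_mul] at hk
        rw [hk] at hFe
        have hpos : 0 < a + c := add_pos_of_nonneg_of_ne ha hc hac
        interval_cases i
        · exfalso
          obtain ⟨-, -, -, -, h5⟩ := natDegree_of_eval (F := F) (a₅ := 0) (a₄ := 0) (a₃ := a)
            (a₂ := c - 2 * t * a) (a₁ := t ^ 2 * a - 2 * t * c) (a₀ := t ^ 2 * c) (fun x => by
              rw [hFe]
              simp only [eval_mul, eval_pow, eval_X, eval_sub, eval_C, eval_add]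
              ring)
          have h6 : (1 - t) * ((1 + 5 * t) * (a + c) + 3 * (1 - t) * a) = 0 := by
            linear_combination h5.1 hbal
          have h7 := (mul_eq_zero.1 h6).resolve_left (sub_ne_zero.2 (Ne.symm ht1))
          nlinarith [mul_nonneg ht.le ha, mul_nonneg ht.le hc]
        · refine Or.inr (Or.inr (Or.inr (Or.inr (Or.inl ⟨t, a, c, ht, ht1, ha, hc, hac, ?_⟩))))
          rw [hFe, rootAndZero]
          ring
      · obtain ⟨k, rfl⟩ := Nat.exists_eq_add_of_le hi
        obtain ⟨a, c, ha, hc, hac, hk⟩ := hlin k (by omega)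
        refine Or.inl ⟨t, 0, a, c, ht.le, le_rfl, ht1, zero_ne_one, ha, hc, hac, ?_⟩
        rw [hFe, twoRoots, ← hk, C_0, sub_zero]
        ring
  | [t₁, t₂], hts, hFe =>
    have ht₁ : 0 < t₁ := hts t₁ (by simp)
    have ht₂ : 0 < t₂ := hts t₂ (by simp)
    simp only [List.map_cons, List.map_nil, List.prod_cons, List.prod_nil, mul_one] at hFe
    have hdeg : i + 4 + R.natDegree ≤ 5 := by
      rwa [hFe, natDegree_mul (mul_ne_zero (hX i) (mul_ne_zero (hsq _) (hsq _))) hR0,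
        natDegree_mul (hX i) (mul_ne_zero (hsq _) (hsq _)), natDegree_mul (hsq _) (hsq _),
        natDegree_X_pow, natDegree_pow, natDegree_X_sub_C, natDegree_pow,
        natDegree_X_sub_C] at hd5
    by_cases h1 : t₁ = 1
    · subst h1
      exact slackForm_of_two_roots hF hS ht₂.le (by rw [hFe]; ring) (by omega) hR
    by_cases h2 : t₂ = 1
    · subst h2
      exact slackForm_of_two_roots hF hS ht₁.le (by rw [hFe]; ring) (by omega) hR
    obtain ⟨a, c, ha, hc, hac, hk⟩ := hlin i (by omega)
    refine Or.inl ⟨t₁, t₂, a, c, ht₁.le, ht₂.le, h1, h2, ha, hc, hac, ?_⟩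
    rw [hFe, twoRoots, ← hk]
    ring
  | t₁ :: t₂ :: t₃ :: ts, _, hFe =>
    exfalso
    have : (X - C t₁) ^ 2 * ((X - C t₂) ^ 2 * (X - C t₃) ^ 2) ∣ F := by
      rw [hFe]
      simp only [List.map_cons, List.prod_cons]
      exact ⟨X ^ i * (ts.map fun t => (X - C t) ^ 2).prod * R, by ring⟩
    have := natDegree_le_of_dvd this hF.2.1
    rw [natDegree_mul (hsq _) (mul_ne_zero (hsq _) (hsq _)), natDegree_mul (hsq _) (hsq _),
      natDegree_pow, natDegree_pow, natDegree_pow, natDegree_X_sub_C, natDegree_X_sub_C,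
      natDegree_X_sub_C] at this
    omega

/-! ### Restrictions of the generators -/

lemma eval_diag_comb (p₀ p₁ p₂ p₃ p₄ x : ℝ) :
    (diag (comb p₀ p₁ p₂ p₃ p₄)).eval x =
      (x - 1) ^ 2 * (p₀ * ((x + 1) * (x ^ 2 + x + 2)) + 2 * p₁ * (x + 1) ^ 2
        + 2 * p₂ * (x + 1) + p₃ * x) + p₄ * (x * (2 * x + 1)) := by
  rw [diag_comb]
  simp only [eval_add, eval_mul, eval_C, eval_pow, eval_X]
  ring

lemma eA_eq_comb (t : ℝ) {u : ℝ} (hu : u ≠ 0) :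
    eA t u = comb 1 (pA1 t u) (pA2 t u) (pA3 t u) (pA4 t u) := by
  rw [eA, if_neg hu, comb, one_smul]

lemma eA_zero_eq_comb (t : ℝ) :
    eA t 0 = comb 0 ((5 * t + 1) ^ 2) ((t - 1) ^ 2 * (t ^ 2 - 12 * t - 1))
      (-(2 * (t ^ 4 + 36 * t ^ 3 + 34 * t ^ 2 + 60 * t + 13))) (24 * (t - 1) ^ 4) := by
  rw [eA, if_pos rfl, comb, zero_smul, zero_add, neg_smul, ← sub_eq_add_neg]

/-- This explains the parameter range: `u ≤ muH t` says that the second root is nonnegative, and `u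
≤ muL t` that the constant term of the linear cofactor is. -/
lemma diag_eA {t u : ℝ} (ht : 0 ≤ t) (hu : u ≠ 0) :
    diag (eA t u) = twoRoots t (muZ t u) 1
      (2 * (t + 2) * (9 * (t - 1) ^ 2 - u) / ((5 * t + 1) * u)) := by
  have h1 : t + 2 ≠ 0 := by positivity
  have h2 : 5 * t + 1 ≠ 0 := by positivity
  rw [eA_eq_comb t hu]
  refine Polynomial.funext fun x => ?_
  rw [eval_diag_comb, eval_twoRoots, pA1, pA2, pA3, pA4, muZ]
  field_simp
  ring

lemma diag_eA_zero {t : ℝ} (ht : 0 ≤ t) :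
    diag (eA t 0) = twoRoots t (muZ t 0) 0 (2 * (5 * t + 1) ^ 2) := by
  have h1 : t + 2 ≠ 0 := by positivity
  have h2 : 5 * t + 1 ≠ 0 := by positivity
  rw [eA_zero_eq_comb t]
  refine Polynomial.funext fun x => ?_
  rw [eval_diag_comb, eval_twoRoots, muZ]
  field_simp
  ring

lemma eB_eq_comb (t u : ℝ) :
    eB t u = comb 1 (pB1 t (omega u)) (pB2 t (omega u)) (pB3 t (omega u)) (pB4 t (omega u)) := by
  rw [eB, comb, one_smul]

lemma diag_eB {t : ℝ} (ht : 0 < t) (u : ℝ) : diag (eB t u) = edgeRoot t (omega u / t) := by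
  rw [eB_eq_comb]
  generalize omega u = w
  refine Polynomial.funext fun x => ?_
  rw [eval_diag_comb, eval_edgeRoot, pB1, pB2, pB3, pB4]
  field_simp
  ring

lemma eC_eq_comb (t : ℝ) : eC t = comb 1 (-(t + 1)) t ((t + 1) ^ 2) 0 := by
  rw [eC, comb, one_smul, zero_smul, add_zero, neg_smul, ← sub_eq_add_neg]

lemma diag_eC (t : ℝ) : diag (eC t) = twoRoots 1 t 1 0 := by
  rw [eC_eq_comb]
  refine Polynomial.funext fun x => ?_
  rw [eval_diag_comb, eval_twoRoots]
  ring

lemma eD_eq_comb (t : ℝ) : eD t = comb 0 1 (t ^ 2 - 1) (-(2 * (t + 1) ^ 2)) 0 := by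
  rw [eD, comb, one_smul, zero_smul, zero_smul, add_zero, zero_add, neg_smul, ← sub_eq_add_neg]

lemma diag_eD (t : ℝ) : diag (eD t) = (2 : ℝ) • twoRoots 1 t 0 1 := by
  rw [eD_eq_comb]
  refine Polynomial.funext fun x => ?_
  rw [eval_diag_comb, eval_smul, eval_twoRoots, smul_eq_mul]
  ring

lemma eDInf_eq_comb : eDInf = comb 0 0 1 (-2) 0 := by
  rw [eDInf, comb]
  module

lemma diag_eDInf : diag eDInf = (2 : ℝ) • ((X - C 1) ^ 2 * C 1) := by
  rw [eDInf_eq_comb]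
  refine Polynomial.funext fun x => ?_
  rw [eval_diag_comb, eval_smul, smul_eq_mul]
  simp only [eval_mul, eval_pow, eval_sub, eval_X, eval_C]
  ring

lemma eE_eq_comb (t : ℝ) :
    eE t = comb 0 1 (-1) (-((4 * t ^ 2 + 5 * t + 3) / (t + 2))) ((t - 1) ^ 3 / (t + 2)) := by
  rw [eE, comb]
  module

lemma diag_eE {t : ℝ} (ht : 0 ≤ t) :
    diag (eE t) = rootAndZero t 2 ((t - 7) / (t + 2)) := by
  rw [eE_eq_comb]
  refine Polynomial.funext fun x => ?_
  rw [eval_diag_comb, eval_rootAndZero]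
  field_simp
  ring

lemma eEInf_eq_comb : eEInf = comb 0 0 0 0 1 := by
  rw [eEInf, comb]
  module

lemma diag_eEInf : diag eEInf = X * (C 2 * X + C 1) := by
  rw [eEInf_eq_comb]
  refine Polynomial.funext fun x => ?_
  rw [eval_diag_comb]
  simp only [eval_mul, eval_add, eval_X, eval_C]
  ring

lemma U_mul_eq_comb : U * (S1 2 - S2 1 1) = comb 0 0 0 1 0 := by
  rw [mul_sub, ← s3, comb]
  module

lemma diag_U_mul : diag (U * (S1 2 - S2 1 1)) = X * ((X - C 1) ^ 2 * C 1) := by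
  rw [U_mul_eq_comb]
  refine Polynomial.funext fun x => ?_
  rw [eval_diag_comb]
  simp only [eval_mul, eval_pow, eval_sub, eval_X, eval_C]
  ring

/-! ### The parameter ranges -/

lemma two_le_muR {t : ℝ} (ht : 2 ≤ t) : 2 ≤ muR t := by
  have h : t ≤ √((t - 1) * (t + 2)) := Real.le_sqrt_of_sq_le (by nlinarith)
  rw [muR]
  nlinarith

lemma muB_spec {t : ℝ} (ht : 2 ≤ t) :
    0 < muB t ∧ muB t ≤ 1 ∧ muB t ^ 2 - muR t * muB t + 1 = 0 := by
  have hR := two_le_muR ht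
  have hsq := Real.sq_sqrt (show 0 ≤ muR t ^ 2 - 4 by nlinarith)
  have hs0 := Real.sqrt_nonneg (muR t ^ 2 - 4)
  rw [muB]
  set s := √(muR t ^ 2 - 4)
  have h1 : s < muR t := lt_of_pow_lt_pow_left₀ 2 (by linarith) (by linarith)
  have h2 : muR t - 2 ≤ s := by
    refine Real.le_sqrt_of_sq_le ?_
    nlinarith
  refine ⟨by linarith, by linarith, ?_⟩
  linear_combination hsq / 4

lemma omega_eq {u : ℝ} (hu : 0 < u) : omega u = (1 - u) ^ 2 / u := by
  rw [omega]
  field_simp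
  ring

/-- `muB t` and its inverse are the roots of `u + 1/u = muR t`, and `omega` decreases on `(0, 1]`;
the identity `e` makes this explicit. -/
lemma muB_le_iff {t u : ℝ} (ht : 2 ≤ t) (hu : 0 < u) (hu1 : u ≤ 1) :
    muB t ≤ u ↔ omega u ≤ muR t - 2 := by
  obtain ⟨h0, h1, h2⟩ := muB_spec ht
  have e : (muR t - 2 - omega u) * (u * muB t) = (u - muB t) * (1 - u * muB t) := by
    rw [omega]
    field_simp
    linear_combination -u * h2
  have hp : 0 < u * muB t := by positivity
  constructor
  · intro h
    have : 0 ≤ (u - muB t) * (1 - u * muB t) := mul_nonneg (by linarith) (by nlinarith)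
    rw [← e] at this
    linarith [nonneg_of_mul_nonneg_left this hp]
  · intro h
    by_contra! hlt
    have : (u - muB t) * (1 - u * muB t) < 0 := mul_neg_of_neg_of_pos (by linarith) (by nlinarith)
    rw [← e] at this
    nlinarith

/-- The right side is `(t - 1)(t + 2) - ((w + t^2)/t)^2`; taking square roots produces `muR`. -/
lemma le_muR_iff {t w : ℝ} (ht : 2 ≤ t) (hw : 0 ≤ w) :
    w ≤ muR t - 2 ↔ 0 ≤ t - 2 - (w / t) ^ 2 - 2 * t * (w / t) := by
  have ht0 : 0 < t := by linarith
  have hr : 0 ≤ (t - 1) * (t + 2) := mul_nonneg (by linarith) (by linarith)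
  have e : t - 2 - (w / t) ^ 2 - 2 * t * (w / t) =
      (t - 1) * (t + 2) - ((w + t ^ 2) / t) ^ 2 := by
    field_simp
    ring
  rw [e, sub_nonneg, ← Real.le_sqrt' (by positivity), div_le_iff₀ ht0, muR]
  constructor <;> intro h <;> linarith

lemma exists_omega_eq {w : ℝ} (hw : 0 ≤ w) : ∃ u : ℝ, 0 < u ∧ u ≤ 1 ∧ omega u = w := by
  have hsq := Real.sq_sqrt (show 0 ≤ w ^ 2 + 4 * w by positivity)
  have hs0 := Real.sqrt_nonneg (w ^ 2 + 4 * w)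
  set s := √(w ^ 2 + 4 * w)
  have h1 : s < w + 2 := lt_of_pow_lt_pow_left₀ 2 (by linarith) (by linarith)
  have h2 : w ≤ s := Real.le_sqrt_of_sq_le (by linarith)
  have hu : 0 < (w + 2 - s) / 2 := by linarith
  refine ⟨(w + 2 - s) / 2, hu, by linarith, ?_⟩
  rw [omega_eq hu, div_eq_iff hu.ne']
  linear_combination hsq / 4

lemma muZ_spec {t u : ℝ} (ht : 0 ≤ t) (hu : 0 ≤ u) (hL : u ≤ muL t) (hH : u ≤ muH t)
    (ht1 : t ≠ 1) : 0 ≤ muZ t u ∧ muZ t u ≠ 1 := by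
  have hD : 0 < (t + 2) * (5 * t + 1) := by positivity
  rw [muL] at hL
  rw [muH] at hH
  refine ⟨div_nonneg (by linarith) hD.le, fun h => ?_⟩
  rw [muZ, div_eq_one_iff_eq hD.ne'] at h
  have h2 : u = 6 * (t + 2) * (1 - t) := by linarith
  rcases lt_or_gt_of_ne ht1 with h1 | h1
  · nlinarith
  · nlinarith

lemma muZ_eq {t z : ℝ} (ht : 0 ≤ t) : muZ t ((t + 2) * (7 - t - z - 5 * t * z)) = z := by
  have h1 : t + 2 ≠ 0 := by positivity
  have h2 : 5 * t + 1 ≠ 0 := by positivity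
  rw [muZ]
  field_simp
  ring

/-! ### The generators are extremal -/

lemma balanced_diag {f : Poly3} (hf : f ∈ symForms 3 5) : Balanced (diag f) := by
  obtain ⟨p₀, p₁, p₂, p₃, p₄, rfl⟩ := exists_eq_comb hf
  exact balanced_diag_comb _ _ _ _ _

lemma eA_mem (t u : ℝ) : eA t u ∈ symForms 3 5 := by
  by_cases hu : u = 0
  · rw [hu, eA_zero_eq_comb]
    exact comb_mem _ _ _ _ _
  · rw [eA_eq_comb t hu]
    exact comb_mem _ _ _ _ _

lemma eB_mem (t u : ℝ) : eB t u ∈ symForms 3 5 := eB_eq_comb t u ▸ comb_mem _ _ _ _ _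

lemma eC_mem (t : ℝ) : eC t ∈ symForms 3 5 := eC_eq_comb t ▸ comb_mem _ _ _ _ _

lemma eD_mem (t : ℝ) : eD t ∈ symForms 3 5 := eD_eq_comb t ▸ comb_mem _ _ _ _ _

lemma eDInf_mem : eDInf ∈ symForms 3 5 := eDInf_eq_comb ▸ comb_mem _ _ _ _ _

lemma eE_mem (t : ℝ) : eE t ∈ symForms 3 5 := eE_eq_comb t ▸ comb_mem _ _ _ _ _

lemma eEInf_mem : eEInf ∈ symForms 3 5 := eEInf_eq_comb ▸ comb_mem _ _ _ _ _

lemma U_mul_mem : U * (S1 2 - S2 1 1) ∈ symForms 3 5 := U_mul_eq_comb ▸ comb_mem _ _ _ _ _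

/-- The restriction of `eA t u`, in a form that covers `u = 0`. -/
lemma exists_diag_eA {t u : ℝ} (ht : 0 ≤ t) (hu : 0 ≤ u) (hL : u ≤ muL t) :
    ∃ a c : ℝ, 0 ≤ a ∧ 0 ≤ c ∧ (a ≠ 0 ∨ c ≠ 0) ∧
      diag (eA t u) = twoRoots t (muZ t u) a c := by
  rcases hu.eq_or_lt with rfl | hu
  · exact ⟨0, _, le_rfl, by positivity, Or.inr (by positivity), diag_eA_zero ht⟩
  · refine ⟨1, _, zero_le_one, ?_, Or.inl one_ne_zero, diag_eA ht hu.ne'⟩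
    rw [muL] at hL
    have : 0 ≤ 9 * (t - 1) ^ 2 - u := by linarith
    positivity

lemma isExtremal_eA {t u : ℝ} (ht : 0 ≤ t) (hu : 0 ≤ u) (hA : u ≤ muA t) :
    IsExtremal (symPsdCone 3 5) (eA t u) := by
  have hL : u ≤ muL t := hA.trans (min_le_left _ _)
  have hH : u ≤ muH t := hA.trans (min_le_right _ _)
  rw [isExtremal_iff_diag (eA_mem t u)]
  -- At `t = 1` the bound `muL` forces `u = 0`, both double roots merge at `1`, and the form is a
  -- multiple of `eD 1`.
  by_cases ht1 : t = 1
  · subst ht1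
    have hu0 : u = 0 := le_antisymm (by simpa [muL] using hL) hu
    subst hu0
    have e : diag (eA 1 0) = (72 : ℝ) • twoRoots 1 1 0 1 := by
      rw [diag_eA_zero ht, smul_twoRoots]
      norm_num [muZ]
    rw [e]
    exact isExtremal_smul (isExtremal_twoRoots_one 1 zero_le_one) (by norm_num)
  · obtain ⟨a, c, ha, hc, hac, e⟩ := exists_diag_eA ht hu hL
    obtain ⟨hz, hz1⟩ := muZ_spec ht hu hL hH ht1
    have hb := balanced_diag (eA_mem t u)
    rw [e] at hb ⊢
    exact isExtremal_twoRoots ht hz ht1 hz1 ha hc hac hb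

lemma eB_parameters {t u : ℝ} (ht : 2 ≤ t) (hB : muB t ≤ u) (hu1 : u ≤ 1) :
    0 < u ∧ 0 ≤ omega u / t ∧
      0 ≤ t - 2 - (omega u / t) ^ 2 - 2 * t * (omega u / t) := by
  have hu := (muB_spec ht).1.trans_le hB
  have hw : 0 ≤ omega u := by
    rw [omega_eq hu]
    positivity
  exact ⟨hu, div_nonneg hw (by linarith), (le_muR_iff ht hw).1 ((muB_le_iff ht hu hu1).1 hB)⟩

lemma isExtremal_eB {t u : ℝ} (ht : 2 ≤ t) (hB : muB t ≤ u) (hu1 : u ≤ 1) :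
    IsExtremal (symPsdCone 3 5) (eB t u) := by
  obtain ⟨-, hv, hn⟩ := eB_parameters ht hB hu1
  rw [isExtremal_iff_diag (eB_mem t u), diag_eB (by linarith)]
  exact isExtremal_edgeRoot ht hv hn

lemma isExtremal_eC {t : ℝ} (ht : 0 ≤ t) (ht2 : t ≤ 2) : IsExtremal (symPsdCone 3 5) (eC t) := by
  rw [isExtremal_iff_diag (eC_mem t), diag_eC]
  exact isExtremal_X_twoRoots ht ht2

lemma isExtremal_eD {t : ℝ} (ht : 0 ≤ t) : IsExtremal (symPsdCone 3 5) (eD t) := by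
  rw [isExtremal_iff_diag (eD_mem t), diag_eD]
  exact isExtremal_smul (isExtremal_twoRoots_one t ht) two_pos

lemma isExtremal_eDInf : IsExtremal (symPsdCone 3 5) eDInf := by
  rw [isExtremal_iff_diag eDInf_mem, diag_eDInf]
  exact isExtremal_smul isExtremal_sq two_pos

lemma isExtremal_eE {t : ℝ} (ht : 7 ≤ t) : IsExtremal (symPsdCone 3 5) (eE t) := by
  have ht0 : 0 ≤ t := by linarith
  have hb := balanced_diag (eE_mem t)
  rw [isExtremal_iff_diag (eE_mem t)]
  rw [diag_eE ht0] at hb ⊢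
  exact isExtremal_rootAndZero ht0 (by linarith) two_pos.le
    (div_nonneg (by linarith) (by linarith)) (Or.inl two_ne_zero) hb

lemma isExtremal_eEInf : IsExtremal (symPsdCone 3 5) eEInf := by
  rw [isExtremal_iff_diag eEInf_mem, diag_eEInf]
  exact isExtremal_X_linear

lemma isExtremal_U_mul : IsExtremal (symPsdCone 3 5) (U * (S1 2 - S2 1 1)) := by
  rw [isExtremal_iff_diag U_mul_mem, diag_U_mul]
  exact isExtremal_X_sq

lemma isExtremal_of_mem_generators {e : Poly3} (he : e ∈ generators) :
    IsExtremal (symPsdCone 3 5) e := by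
  rcases he with
    ((((⟨t, u, ht, -, hu, hA, rfl⟩ | ⟨t, u, ht, hB, hu, rfl⟩) | ⟨t, ht, ht2, rfl⟩) |
      ⟨t, ht, rfl⟩ | rfl) | ⟨t, ht, rfl⟩ | rfl) | rfl
  · exact isExtremal_eA ht hu hA
  · exact isExtremal_eB ht hB hu
  · exact isExtremal_eC ht ht2
  · exact isExtremal_eD ht
  · exact isExtremal_eDInf
  · exact isExtremal_eE ht
  · exact isExtremal_eEInf
  · exact isExtremal_U_mul

lemma mem_symForms_of_mem_generators {e : Poly3} (he : e ∈ generators) : e ∈ symForms 3 5 :=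
  (isExtremal_of_mem_generators he).1.1

/-! ### Every extremal element is a multiple of a generator -/

/-- The parameter `u` solves `muZ t u = z`. Since the roots lie on opposite sides of `1`, balance
gives `h1` and `h2`, which amount to `0 ≤ u` and `u ≤ muL t`; the case `u = 0` is the quartic one,
`a = 0`. -/
lemma exists_eA_of_twoRoots {t z a c : ℝ} (ht : 0 ≤ t) (hz : 0 ≤ z) (ht1 : t ≠ 1) (hz1 : z ≠ 1)
    (ha : 0 ≤ a) (hc : 0 ≤ c) (hac : a ≠ 0 ∨ c ≠ 0) (hb : Balanced (twoRoots t z a c)) :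
    ∃ u r : ℝ, t ≤ 7 ∧ 0 ≤ u ∧ u ≤ muA t ∧ 0 < r ∧ twoRoots t z a c = r • diag (eA t u) := by
  rw [twoRoots_balanced_iff ht1 hz1] at hb
  have hsign := sign_of_balanced ht ht1 hz1 ha hc hac hb
  have hpos : 0 < a + c := add_pos_of_nonneg_of_ne ha hc hac
  have h1 : 0 ≤ 7 - t - z - 5 * t * z := by
    refine nonneg_of_mul_nonneg_right (a := a + c) ?_ hpos
    nlinarith [mul_nonneg ha (neg_nonneg.2 hsign.le)]
  have h2 : 0 ≤ 2 * t + 2 * z + t * z - 5 := by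
    refine nonneg_of_mul_nonneg_right (a := 2 * (a + c)) ?_ (by linarith)
    have e : 2 * (a + c) * (2 * t + 2 * z + t * z - 5) = 3 * (c * -((1 - t) * (1 - z))) := by
      linear_combination hb
    rw [e]
    exact mul_nonneg (by norm_num) (mul_nonneg hc (neg_nonneg.2 hsign.le))
  have htz : 0 ≤ t * z := mul_nonneg ht hz
  have hu : 0 ≤ (t + 2) * (7 - t - z - 5 * t * z) := mul_nonneg (by linarith) h1
  refine ⟨(t + 2) * (7 - t - z - 5 * t * z), ?_⟩
  have hA : (t + 2) * (7 - t - z - 5 * t * z) ≤ muA t := by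
    refine le_min ?_ ?_
    · rw [muL]
      nlinarith [mul_nonneg (by positivity : 0 ≤ 1 + 5 * t) h2]
    · rw [muH]
      nlinarith [mul_nonneg (by positivity : 0 ≤ t + 2) (by positivity : 0 ≤ z + 5 * t * z)]
  rcases h1.eq_or_lt with h0 | h0
  · have ha0 : a = 0 := by
      have : a * ((1 - t) * (1 - z)) = 0 := by
        linear_combination (-1 / 3) * hb + (a + c) / 3 * h0
      exact (mul_eq_zero.1 this).resolve_right hsign.ne
    have hcpos : 0 < c := by linarith
    refine ⟨c / (2 * (5 * t + 1) ^ 2), by linarith, hu, hA, by positivity, ?_⟩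
    have e := muZ_eq (z := z) ht
    rw [← h0, mul_zero] at e ⊢
    rw [diag_eA_zero ht, e, smul_twoRoots, ha0, mul_zero, div_mul_cancel₀ _ (by positivity)]
  · have hapos : 0 < a := by
      refine lt_of_le_of_ne ha fun h => ?_
      rw [← h] at hb hpos
      nlinarith
    refine ⟨a, by linarith, hu, hA, hapos, ?_⟩
    have hune : (t + 2) * (7 - t - z - 5 * t * z) ≠ 0 := by positivity
    rw [diag_eA ht hune, muZ_eq ht, smul_twoRoots, mul_one]
    congr 1
    have h5 : 5 * t + 1 ≠ 0 := by positivity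
    have e : 9 * (t - 1) ^ 2 - (t + 2) * (7 - t - z - 5 * t * z) =
        (5 * t + 1) * (2 * t + 2 * z + t * z - 5) := by ring
    have e2 : c * (7 - t - z - 5 * t * z) = a * (2 * (2 * t + 2 * z + t * z - 5)) := by
      linear_combination -hb
    rw [e]
    rw [← mul_div_assoc, eq_div_iff (mul_ne_zero h5 hune)]
    linear_combination (5 * t + 1) * (t + 2) * e2

lemma exists_generator {F : ℝ[X]} (hF : IsExtremal diagCone F) :
    ∃ e ∈ generators, ∃ r : ℝ, 0 < r ∧ F = r • diag e := by
  by_cases hS : ∃ a w₀, EdgeSquare F a w₀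
  · obtain ⟨a, w₀, hS⟩ := hS
    obtain ⟨t, v, ht, hv, hn, rfl⟩ := isExtremal_edgeSquare hF hS
    have ht0 : 0 < t := by linarith
    obtain ⟨u, hu, hu1, hw⟩ := exists_omega_eq (mul_nonneg ht0.le hv)
    have hvw : omega u / t = v := by rw [hw]; field_simp
    refine ⟨eB t u, ?_, a, hS.1, by rw [diag_eB ht0, hvw]⟩
    refine Or.inl (Or.inl (Or.inl (Or.inl (Or.inr ⟨t, u, ht, ?_, hu1, rfl⟩))))
    rw [muB_le_iff ht hu hu1, le_muR_iff ht (hw ▸ mul_nonneg ht0.le hv), hvw]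
    exact hn
  · rcases slackForm_of_not_edgeSquare hF hS with ⟨t, z, a, c, ht, hz, ht1, hz1, ha, hc, hac, rfl⟩ |
      ⟨t, c, ht, ht2, hc, rfl⟩ | ⟨t, c, ht, hc, rfl⟩ | ⟨c, hc, rfl⟩ |
      ⟨t, a, c, ht, ht1, ha, hc, hac, rfl⟩ | ⟨c, hc, rfl⟩ | ⟨c, hc, rfl⟩
    · obtain ⟨u, r, ht7, hu, hA, hr, e⟩ :=
        exists_eA_of_twoRoots ht hz ht1 hz1 ha hc hac hF.1.2.1
      exact ⟨eA t u, Or.inl (Or.inl (Or.inl (Or.inl (Or.inl ⟨t, u, ht, ht7, hu, hA, rfl⟩)))),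
        r, hr, e⟩
    · exact ⟨eC t, Or.inl (Or.inl (Or.inl (Or.inr ⟨t, ht, ht2, rfl⟩))), c, hc, by rw [diag_eC]⟩
    · refine ⟨eD t, Or.inl (Or.inl (Or.inr (Or.inl ⟨t, ht, rfl⟩))), c / 2, by positivity, ?_⟩
      rw [diag_eD, smul_smul, div_mul_cancel₀ _ two_ne_zero]
    · refine ⟨eDInf, Or.inl (Or.inl (Or.inr (Or.inr rfl))), c / 2, by positivity, ?_⟩
      rw [diag_eDInf, smul_smul, div_mul_cancel₀ _ two_ne_zero]
    · have h1 := ((rootAndZero_coeffs t a c).2.2.2.2.1 hF.1.2.1)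
      have h2 := (mul_eq_zero.1 h1).resolve_left (sub_ne_zero.2 ht1)
      have h3 : (2 * t + 4) * c = (t - 7) * a := by linear_combination h2
      have hapos : 0 < a := by
        refine lt_of_le_of_ne ha fun h => ?_
        rw [← h, mul_zero] at h3
        have := (mul_eq_zero.1 h3).resolve_left (by positivity)
        exact hac.elim (fun h' => h' h.symm) (fun h' => h' this)
      -- Balance gives `(2t + 4) c = (t - 7) a`; this is where the threshold `7` comes from.
      have ht7 : 7 ≤ t := by
        have : 0 ≤ (t - 7) * a := h3 ▸ by positivity
        linarith [nonneg_of_mul_nonneg_left this hapos]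
      refine ⟨eE t, Or.inl (Or.inr (Or.inl ⟨t, ht7, rfl⟩)), a / 2, by positivity, ?_⟩
      rw [diag_eE ht.le]
      refine Polynomial.funext fun x => ?_
      rw [eval_smul, smul_eq_mul, eval_rootAndZero, eval_rootAndZero]
      have hc' : c = a / 2 * ((t - 7) / (t + 2)) := by
        field_simp
        linear_combination h3
      rw [hc']
      ring
    · exact ⟨_, Or.inr rfl, c, hc, by rw [diag_U_mul]⟩
    · exact ⟨eEInf, Or.inl (Or.inr (Or.inr rfl)), c, hc, by rw [diag_eEInf]⟩

lemma isExtremal_iff_exists_generator (f : Poly3) :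
    IsExtremal (symPsdCone 3 5) f ↔ ∃ e ∈ generators, ∃ c : ℝ, 0 < c ∧ f = c • e := by
  constructor
  · intro h
    have hf : f ∈ symForms 3 5 := h.1.1
    obtain ⟨e, he, c, hc, hfe⟩ := exists_generator ((isExtremal_iff_diag hf).1 h)
    exact ⟨e, he, c, hc, diag_injOn hf
      (Submodule.smul_mem _ c (mem_symForms_of_mem_generators he)) (by rw [hfe, map_smul])⟩
  · rintro ⟨e, he, c, hc, rfl⟩
    have hs := mem_symForms_of_mem_generators he
    rw [isExtremal_iff_diag (Submodule.smul_mem _ c hs), map_smul]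
    exact isExtremal_smul ((isExtremal_iff_diag hs).1 (isExtremal_of_mem_generators he)) hc

/-! ### The dimension of the cone -/

lemma finrank_span_symPsdCone :
    Module.finrank ℝ (Submodule.span ℝ (symPsdCone 3 5)) = 5 := by
  have hli : LinearIndependent ℝ ![s0, s1, s2, s3, s4] := by
    rw [Fintype.linearIndependent_iff]
    intro g hg
    have h : comb (g 0) (g 1) (g 2) (g 3) (g 4) = comb 0 0 0 0 0 := by
      rw [Fin.sum_univ_five] at hg
      simpa [comb] using hg
    obtain ⟨h0, h1, h2, h3, h4⟩ := comb_eq_of_diag_eq (congrArg diag h)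
    intro i
    fin_cases i <;> assumption
  have hspan : Submodule.span ℝ (symPsdCone 3 5) =
      Submodule.span ℝ (Set.range ![s0, s1, s2, s3, s4]) := by
    refine le_antisymm (Submodule.span_le.2 fun f hf => ?_) (Submodule.span_le.2 ?_)
    · obtain ⟨p₀, p₁, p₂, p₃, p₄, rfl⟩ := exists_eq_comb hf.1
      have hs : ∀ i, ![s0, s1, s2, s3, s4] i ∈
          Submodule.span ℝ (Set.range ![s0, s1, s2, s3, s4]) := fun i =>
        Submodule.subset_span ⟨i, rfl⟩
      refine Submodule.add_mem _ (Submodule.add_mem _ (Submodule.add_mem _ (Submodule.add_mem _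
        ?_ ?_) ?_) ?_) ?_ <;> apply Submodule.smul_mem
      exacts [hs 0, hs 1, hs 2, hs 3, hs 4]
    -- The extremal elements `eEInf`, `U(S_2 - S_{1,1})`, `eDInf`, `eD 1`, `eC 0` are triangular
    -- with respect to `s₄, s₃, s₂, s₁, s₀`.
    · have hsub : ∀ {f}, IsExtremal (symPsdCone 3 5) f →
          f ∈ Submodule.span ℝ (symPsdCone 3 5) := fun h => Submodule.subset_span h.1
      have h4 : s4 ∈ Submodule.span ℝ (symPsdCone 3 5) := hsub isExtremal_eEInf
      have h3 : s3 ∈ Submodule.span ℝ (symPsdCone 3 5) := by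
        have := hsub isExtremal_U_mul
        rwa [mul_sub, ← s3] at this
      have h2 : s2 ∈ Submodule.span ℝ (symPsdCone 3 5) := by
        have := Submodule.add_mem _ (hsub isExtremal_eDInf) (Submodule.smul_mem _ (2 : ℝ) h3)
        rwa [eDInf, sub_add_cancel] at this
      have h1 : s1 ∈ Submodule.span ℝ (symPsdCone 3 5) := by
        have := Submodule.add_mem _ (hsub (isExtremal_eD zero_le_one))
          (Submodule.smul_mem _ (8 : ℝ) h3)
        have e : eD 1 + (8 : ℝ) • s3 = s1 := by
          rw [eD]
          module
        rwa [e] at this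
      have h0 : s0 ∈ Submodule.span ℝ (symPsdCone 3 5) := by
        have := Submodule.sub_mem _ (Submodule.add_mem _
          (hsub (isExtremal_eC le_rfl zero_le_two)) h1) h3
        have e : eC 0 + s1 - s3 = s0 := by
          rw [eC]
          module
        rwa [e] at this
      rw [Set.range_subset_iff, Fin.forall_fin_succ, Fin.forall_fin_succ, Fin.forall_fin_succ,
        Fin.forall_fin_two]
      exact ⟨h0, h1, h2, h3, h4⟩
  rw [hspan, finrank_span_eq_card hli, Fintype.card_fin]

/-! ### Equality conditions -/

lemma isCharacterizedIn_of_diag {e : Poly3} (he : IsExtremal (symPsdCone 3 5) e)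
    {cond : Poly3 → Prop} (h1 : ∀ α : ℝ, cond (α • e))
    (h2 : ∀ g ∈ symPsdCone 3 5, cond g → ∃ α : ℝ, diag g = α • diag e) :
    IsCharacterizedIn (symPsdCone 3 5) e cond := by
  have he' := (isExtremal_iff_diag he.1.1).1 he
  intro g hg
  constructor
  · intro hc
    obtain ⟨α, hα⟩ := h2 g hg hc
    exact ⟨α, nonneg_of_smul_mem he'.1 he'.2.1 (hα ▸ mem_diagCone_of_mem hg),
      diag_injOn hg.1 (Submodule.smul_mem _ α he.1.1) (by rw [hα, map_smul])⟩
  · rintro ⟨α, -, rfl⟩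
    exact h1 α

lemma eval_edge_point {f : Poly3} (hf : f ∈ symForms 3 5) {u : ℝ} (hu : u ≠ 0) :
    MvPolynomial.eval ![0, u, 1] f = (u + 1) * u ^ 2 * (edge (diag f)).eval (omega u) := by
  obtain ⟨p₀, p₁, p₂, p₃, p₄, rfl⟩ := exists_eq_comb hf
  rw [edge_diag_comb, eval_comb, omega]
  simp only [Matrix.cons_val_zero, Matrix.cons_val_one, Matrix.cons_val]
  field_simp
  ring

lemma eval_vertex {f : Poly3} (hf : f ∈ symForms 3 5) :
    MvPolynomial.eval ![0, 0, 1] f = (diag f).coeff 5 := by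
  obtain ⟨p₀, p₁, p₂, p₃, p₄, rfl⟩ := exists_eq_comb hf
  rw [(coeff_diag_comb p₀ p₁ p₂ p₃ p₄).1, eval_comb]
  simp

lemma eval_pderiv_comb (p₀ p₁ p₂ p₃ p₄ u : ℝ) :
    MvPolynomial.eval ![0, u, 1] (MvPolynomial.pderiv 1 (comb p₀ p₁ p₂ p₃ p₄)) =
      5 * p₀ * u ^ 4 + p₁ * (4 * u ^ 3 + 1) + p₂ * (3 * u ^ 2 + 2 * u) := by
  simp only [comb, s0, s1, s2, s3, s4, S1, S2, T2, U, MvPolynomial.smul_eq_C_mul]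
  simp [MvPolynomial.pderiv_X]
  ring

lemma natDegree_le_four {F : ℝ[X]} (hd : F.natDegree ≤ 5) (h : F.coeff 5 = 0) :
    F.natDegree ≤ 4 := by
  by_contra! hlt
  have e : F.natDegree = 5 := by omega
  have h0 : F = 0 := leadingCoeff_eq_zero.1 (by rw [leadingCoeff, e, h])
  rw [h0] at e
  simp at e

/-! ### The five families characterized by their zeros -/

lemma eA_characterized {t u : ℝ} (ht : 0 < t) (ht1 : t ≠ 1) (hu : 0 ≤ u) (hA : u ≤ muA t)
    (huH : u ≠ muH t) :
    IsCharacterizedIn (symPsdCone 3 5) (eA t u) fun f =>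
      MvPolynomial.eval ![t, 1, 1] f = 0 ∧ MvPolynomial.eval ![muZ t u, 1, 1] f = 0 := by
  have hL : u ≤ muL t := hA.trans (min_le_left _ _)
  have hH : u ≤ muH t := hA.trans (min_le_right _ _)
  obtain ⟨a, c, ha, hc, hac, e⟩ := exists_diag_eA ht.le hu hL
  obtain ⟨hz, hz1⟩ := muZ_spec ht.le hu hL hH ht1
  have hb := balanced_diag (eA_mem t u)
  rw [e] at hb
  have hsign := sign_of_balanced ht.le ht1 hz1 ha hc hac ((twoRoots_balanced_iff ht1 hz1).1 hb)
  -- Here `u ≠ muH t` enters: a zero at `0` need not be double, so the second root has to be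
  -- positive.
  have hz0 : 0 < muZ t u := by
    refine div_pos ?_ (by positivity)
    have := lt_of_le_of_ne hH huH
    rw [muH] at this
    linarith
  have htz : t ≠ muZ t u := by
    intro h
    rw [← h] at hsign
    nlinarith [sq_nonneg (1 - t)]
  refine isCharacterizedIn_of_diag (isExtremal_eA ht.le hu hA) (fun α => ?_) fun g hg hcond => ?_
  · simp only [← eval_diag, map_smul, e, eval_smul, eval_twoRoots]
    simp
  · simp only [← eval_diag] at hcond
    rw [e]
    exact exists_smul_twoRoots ht hz0 ht1 hz1 htz hac hb (mem_diagCone_of_mem hg) hcond.1 hcond.2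

/-- Since `u < 1` gives `omega u > 0`, a zero of the edge polynomial there is automatically double.
Within the cone the derivative condition thus follows from the vanishing at `(0, u, 1)`; it is only
verified for `eB`. -/
lemma eB_characterized {t u : ℝ} (ht : 2 ≤ t) (hB : muB t ≤ u) (hu1 : u < 1) :
    IsCharacterizedIn (symPsdCone 3 5) (eB t u) fun f =>
      MvPolynomial.eval ![t, 1, 1] f = 0 ∧ MvPolynomial.eval ![0, u, 1] f = 0 ∧
        MvPolynomial.eval ![0, u, 1] (MvPolynomial.pderiv 1 f) = 0 := by
  have ht0 : 0 < t := by linarith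
  obtain ⟨hu, -, -⟩ := eB_parameters ht hB hu1.le
  have hw : 0 < omega u := by
    rw [omega_eq hu]
    have := sub_pos.2 hu1
    positivity
  have hv : t * (omega u / t) = omega u := by field_simp
  refine isCharacterizedIn_of_diag (isExtremal_eB ht hB hu1.le) (fun α => ⟨?_, ?_, ?_⟩)
    fun g hg hcond => ?_
  · rw [← eval_diag, map_smul, diag_eB ht0, eval_smul, eval_edgeRoot]
    simp
  · rw [eval_edge_point (Submodule.smul_mem _ α (eB_mem t u)) hu.ne', map_smul, edge_smul,
      diag_eB ht0, (edgeRoot_coeffs ht0 _).2.2.1, hv]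
    simp
  · rw [Derivation.map_smul, MvPolynomial.smul_eval, eB_eq_comb, eval_pderiv_comb, pB1, pB2, omega]
    refine mul_eq_zero_of_right _ ?_
    field_simp
    ring
  · have h2 := hcond.2.1
    rw [eval_edge_point hg.1 hu.ne'] at h2
    have h3 := (mul_eq_zero.1 h2).resolve_left (by positivity)
    rw [diag_eB ht0]
    exact exists_smul_edgeRoot ht0 (by linarith) (by positivity) (mem_diagCone_of_mem hg)
      (by rw [eval_diag]; exact hcond.1) (by rw [hv]; exact h3)

lemma exists_eq_of_roots_one {t : ℝ} (ht : 0 < t) (ht1 : t ≠ 1) {G : ℝ[X]} (hG : G ∈ diagCone)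
    (h1 : G.eval t = 0) (h2 : G.eval 1 = 0) :
    ∃ K : ℝ[X], G = (X - C 1) ^ 2 * ((X - C t) ^ 2 * K) ∧ ∀ x : ℝ, 0 ≤ x → 0 ≤ K.eval x := by
  obtain ⟨K, rfl, hK⟩ := exists_eq_sq_mul hG.2.2.1 one_pos h2
  have hKt : K.eval t = 0 := by
    have := sub_ne_zero.2 ht1
    simpa [this] using h1
  obtain ⟨L, rfl, hL⟩ := exists_eq_sq_mul hK ht hKt
  exact ⟨L, rfl, hL⟩

lemma eC_characterized {t : ℝ} (ht : 0 < t) (ht2 : t ≤ 2) (ht1 : t ≠ 1) :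
    IsCharacterizedIn (symPsdCone 3 5) (eC t) fun f =>
      MvPolynomial.eval ![t, 1, 1] f = 0 ∧ MvPolynomial.eval ![1, 1, 1] f = 0 ∧
        MvPolynomial.eval ![0, 1, 1] f = 0 := by
  refine isCharacterizedIn_of_diag (isExtremal_eC ht.le ht2) (fun α => ?_) fun g hg hcond => ?_
  · simp only [← eval_diag, map_smul, diag_eC, eval_smul, eval_twoRoots]
    simp
  · simp only [← eval_diag] at hcond
    have hG := mem_diagCone_of_mem hg
    obtain ⟨K, hK, hK'⟩ := exists_eq_of_roots_one ht ht1 hG hcond.1 hcond.2.1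
    have hK0 : K.eval 0 = 0 := by
      have := hcond.2.2
      rw [hK] at this
      simpa [ht.ne'] using this
    obtain ⟨L, rfl, -⟩ := exists_eq_X_mul hK' hK0
    have hd := hG.1
    rw [hK] at hd
    have hd1 := natDegree_le_of_sq_mul (n := 1) (natDegree_le_of_sq_mul (n := 3) hd)
    have hd0 : L.natDegree ≤ 0 := by
      by_cases hL : L = 0
      · simp [hL]
      · rw [natDegree_X_mul hL] at hd1
        omega
    obtain ⟨α, hα⟩ := exists_smul_of_constant (Z := (X - C 1) ^ 2 * (X - C t) ^ 2 * X)
      (c := 1) one_ne_zero hd0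
    refine ⟨α, ?_⟩
    rw [hK, diag_eC, twoRoots]
    simp only [mul_assoc, C_0, add_zero, C_1, one_mul, mul_one] at hα ⊢
    exact hα

lemma eD_characterized {t : ℝ} (ht : 0 < t) (ht1 : t ≠ 1) :
    IsCharacterizedIn (symPsdCone 3 5) (eD t) fun f =>
      MvPolynomial.eval ![t, 1, 1] f = 0 ∧ MvPolynomial.eval ![1, 1, 1] f = 0 ∧
        MvPolynomial.eval ![0, 0, 1] f = 0 := by
  refine isCharacterizedIn_of_diag (isExtremal_eD ht.le) (fun α => ⟨?_, ?_, ?_⟩)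
    fun g hg hcond => ?_
  · rw [← eval_diag, map_smul, diag_eD, eval_smul, eval_smul, eval_twoRoots]
    simp
  · rw [← eval_diag, map_smul, diag_eD, eval_smul, eval_smul, eval_twoRoots]
    simp
  · rw [eval_vertex (Submodule.smul_mem _ α (eD_mem t)), map_smul, diag_eD, coeff_smul, coeff_smul,
      (twoRoots_coeffs 1 t 0 1).2.1]
    simp
  · rw [eval_vertex hg.1] at hcond
    simp only [← eval_diag] at hcond
    have hG := mem_diagCone_of_mem hg
    obtain ⟨K, hK, -⟩ := exists_eq_of_roots_one ht ht1 hG hcond.1 hcond.2.1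
    -- Vanishing at `(0, 0, 1)` is the vanishing of the leading coefficient; the two double roots
    -- then leave a constant cofactor.
    have hd := natDegree_le_four hG.1 hcond.2.2
    rw [hK] at hd
    have hd0 := natDegree_le_of_sq_mul (n := 0) (natDegree_le_of_sq_mul (n := 2) hd)
    obtain ⟨α, hα⟩ := exists_smul_of_constant (Z := (X - C 1) ^ 2 * (X - C t) ^ 2)
      (c := 2) two_ne_zero hd0
    refine ⟨α, ?_⟩
    rw [hK, diag_eD, smul_twoRoots, twoRoots]
    simp only [mul_assoc, mul_zero, C_0, zero_mul, zero_add, mul_one] at hα ⊢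
    exact hα

lemma eE_characterized {t : ℝ} (ht : 7 ≤ t) :
    IsCharacterizedIn (symPsdCone 3 5) (eE t) fun f =>
      MvPolynomial.eval ![t, 1, 1] f = 0 ∧ MvPolynomial.eval ![0, 1, 1] f = 0 ∧
        MvPolynomial.eval ![0, 0, 1] f = 0 := by
  have ht0 : 0 < t := by linarith
  refine isCharacterizedIn_of_diag (isExtremal_eE ht) (fun α => ⟨?_, ?_, ?_⟩)
    fun g hg hcond => ?_
  · rw [← eval_diag, map_smul, diag_eE ht0.le, eval_smul, eval_rootAndZero]
    simp
  · rw [← eval_diag, map_smul, diag_eE ht0.le, eval_smul, eval_rootAndZero]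
    simp
  · rw [eval_vertex (Submodule.smul_mem _ α (eE_mem t)), map_smul, diag_eE ht0.le, coeff_smul,
      (rootAndZero_coeffs _ _ _).2.1, smul_zero]
  · rw [eval_vertex hg.1] at hcond
    simp only [← eval_diag] at hcond
    have hG := mem_diagCone_of_mem hg
    have hd := natDegree_le_four hG.1 hcond.2.2
    have hb := balanced_diag (eE_mem t)
    rw [diag_eE ht0.le] at hb ⊢
    obtain ⟨K, hK, hK'⟩ := exists_eq_X_mul hG.2.2.1 hcond.2.1
    have hKt : K.eval t = 0 := by
      have := hcond.1
      rw [hK] at this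
      simpa [ht0.ne'] using this
    obtain ⟨L, rfl, -⟩ := exists_eq_sq_mul hK' ht0 hKt
    have hGb := hG.2.1
    rw [hK] at hd hGb ⊢
    have hd1 : L.natDegree ≤ 1 := by
      refine natDegree_le_of_sq_mul (t := t) ?_
      by_cases hL : (X - C t) ^ 2 * L = 0
      · simp [hL]
      · rw [natDegree_X_mul hL] at hd
        omega
    rw [rootAndZero, ← mul_assoc] at hb ⊢
    rw [← mul_assoc] at hGb ⊢
    refine exists_smul_of_linear ?_ hb (Or.inl two_ne_zero) hGb hd1
    have : (1 : ℝ) - t ≠ 0 := by linarith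
    simp [this]

end SymQuintic
end

open SymQuintic MvPolynomial in
theorem theorem1p4 :
    -- the cone is five dimensional
    Module.finrank ℝ (Submodule.span ℝ (symPsdCone 3 5)) = 5 ∧
    -- the extremal elements are exactly the positive multiples of the listed polynomials
    (∀ f : Poly3, IsExtremal (symPsdCone 3 5) f ↔
      ∃ e ∈ generators, ∃ c : ℝ, 0 < c ∧ f = c • e) ∧
    -- the equality conditions that characterize the members of the five families
    (∀ t u : ℝ, 0 < t → t ≤ 7 → t ≠ 1 → 0 ≤ u → u ≤ muA t → u ≠ muH t →
      IsCharacterizedIn (symPsdCone 3 5) (eA t u) fun f =>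
        eval ![t, 1, 1] f = 0 ∧ eval ![muZ t u, 1, 1] f = 0) ∧
    (∀ t u : ℝ, 2 ≤ t → muB t ≤ u → u < 1 →
      IsCharacterizedIn (symPsdCone 3 5) (eB t u) fun f =>
        eval ![t, 1, 1] f = 0 ∧ eval ![0, u, 1] f = 0 ∧ eval ![0, u, 1] (pderiv 1 f) = 0) ∧
    (∀ t : ℝ, 0 < t → t ≤ 2 → t ≠ 1 →
      IsCharacterizedIn (symPsdCone 3 5) (eC t) fun f =>
        eval ![t, 1, 1] f = 0 ∧ eval ![1, 1, 1] f = 0 ∧ eval ![0, 1, 1] f = 0) ∧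
    (∀ t : ℝ, 0 < t → t ≠ 1 →
      IsCharacterizedIn (symPsdCone 3 5) (eD t) fun f =>
        eval ![t, 1, 1] f = 0 ∧ eval ![1, 1, 1] f = 0 ∧ eval ![0, 0, 1] f = 0) ∧
    (∀ t : ℝ, 7 ≤ t →
      IsCharacterizedIn (symPsdCone 3 5) (eE t) fun f =>
        eval ![t, 1, 1] f = 0 ∧ eval ![0, 1, 1] f = 0 ∧ eval ![0, 0, 1] f = 0) := by
  exact ⟨finrank_span_symPsdCone, isExtremal_iff_exists_generator,
    fun t u ht _ ht1 hu hA huH => eA_characterized ht ht1 hu hA huH,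
    fun t u ht hB hu => eB_characterized ht hB hu,
    fun t ht ht2 ht1 => eC_characterized ht ht2 ht1,
    fun t ht ht1 => eD_characterized ht ht1,
    fun t ht => eE_characterized ht⟩
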